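/- **Setting.** A $d$-ary cuckoo hash table ($d\ge 2$) stores keys from a universe $U$ in an array with slots $[n]$; every stored key $x$ occupies exactly one slot, one of $h_1(x),\dots,h_d(x)$, where $h_1,\dots,h_d:U\to[n]$ are independent and fully random (all values $h_i(y)$ are independent and uniform on $[n]$). Let $\mathrm{choice}(x)$ be the index $i$ of the hash function by which $x$ was put into its current slot, and $\mathrm{choice}(x)=0$ if $x$ is not in the table. The *basic bubble-up policy* with threshold constant $c$ inserts (or re-places, after an eviction) a key $x$ as follows. * If $\mathrm{choice}(x)=d$, move $x$ to $h_{d-1}(x)$ and evict the key there, if any (Type 1 move). * If $\mathrm{choice}(x)=d-1$, move $x$ to $h_d(x)$ and evict the key there, if any (Type 2 move). * If $\mathrm{choice}(x)<d-1$, check the slots $h_{\mathrm{choice}(x)+1}(x),\dots,h_{d-2}(x)$ in this order, and put $x$ into the first free one (Type 3 move); if none of them is free, move $x$ to $h_{d-1}(x)$ and evict the key there, if any (Type 4 move). * An evicted key goes through the same process; the insertion ends when a move uses a free slot. If $\lceil c\log n\rceil$ Type 1 or Type 2 moves are made in a row without finding a free slot, the insertion fails, and the process stops. So the keys with $\mathrm{choice}(x)\in\{d-1,d\}$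 form a 2-ary cuckoo table on the last two hashes, which lives in the same slots. The time of an insertion is the number of slots examined: one for each Type 1 or Type 2 move, and one for each probe of a Type 3 or Type 4 move (evaluating $\mathrm{choice}$ takes constant time). An insertion that is not carried out because an earlier one failed takes time $0$. **Theorem.** There is a constant $c_0>0$ such that for every $c\ge c_0$ there is a constant $C>0$, depending only on $c$, with the following property. Let $n\ge 1$, let $\epsilon\in(n^{-1/4},1)$, let $d=\lceil 3\ln\epsilon^{-1}\rceil+1$, and insert a fixed sequence of distinct keys one by one into an empty table with $n$ slots by the basic bubble-up policy with threshold constant $c$. Then 1. with probability at least $1-C/n$, the first $\lfloor(1-\epsilon)n\rfloor$ insertions all succeed, and after each of them the table is a $d$-ary cuckoo hash table that stores exactly the keys inserted so far; 2. for every real $\delta\ge\epsilon$ with $\lfloor(1-\delta)n\rfloor\ge 1$, the expected time of the $\lfloor(1-\delta)n\rfloor$-th insertion is at most $C\,(\delta^{-1}+\log\epsilon^{-1})$. -/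

import Mathlib

open MeasureTheory ProbabilityTheory
open scoped ENNReal

namespace BubbleUp

universe u v

/-- The contents of an array with `n` slots. A slot is free (`none`), or it holds a key `x` together
with `choice(x)`, the index of the hash function that put `x` there. -/
abbrev Table (n : ℕ) (U : Type u) : Type u := Fin n → Option (U × ℕ)

/-- Put `x` into slot `s`, on account of its `i`-th hash. -/
def Table.put {n : ℕ} {U : Type u} (T : Table n U) (s : Fin n) (x : U) (i : ℕ) : Table n U :=
  Function.update T s (some (x, i))

/-- The number of slots that hold a non-core element, i.e. one with `choice < d - 1`.
(Only used to see that insertions terminate.) -/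
def Table.nonCore {n : ℕ} {U : Type u} (d : ℕ) (T : Table n U) : ℕ :=
  ∑ s, (T s).elim 0 (fun p => if p.2 < d - 1 then 1 else 0)

theorem Table.nonCore_put {n : ℕ} {U : Type u} (d : ℕ) (T : Table n U) (s : Fin n) (x : U) (i : ℕ)
    (hi : ¬ i < d - 1) (y : U) (j : ℕ) (hs : T s = some (y, j)) :
    (T.put s x i).nonCore d + (if j < d - 1 then 1 else 0) = T.nonCore d := by
  unfold Table.nonCore Table.put
  rw [← Finset.add_sum_erase Finset.univ (fun t => (T t).elim 0 _) (Finset.mem_univ s),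
    ← Finset.add_sum_erase Finset.univ (fun t => (Function.update T s _ t).elim 0 _)
      (Finset.mem_univ s),
    Finset.sum_congr rfl (fun t ht => by
      rw [Function.update_of_ne (Finset.ne_of_mem_erase ht)])]
  simp [hs, hi, add_comm]

/-- The basic bubble-up policy. `place h d L T x i r` finds a place for the homeless key `x`, where
* `h y j` is the slot `h_j(y)`, for `1 ≤ j ≤ d`;
* `T` is the current table (which does not contain `x`);
* `i` is `choice(x)`: the index of the hash that `x` used before it was evicted, and `0` if `x` is
  the key that is being inserted;
* `r` is the number of Type 1 and Type 2 moves that were made in a row just before;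
* `L` is the number of such moves in a row, without finding a free slot, after which the insertion
  is declared a failure.

The result consists of the final table (`none` for a failure) and of the time spent: one unit for
each slot that is examined, so one for every Type 1 or Type 2 move, and one for every probe of a
Type 3 or Type 4 move. -/
def place {n : ℕ} {U : Type u} (h : U → ℕ → Fin n) (d L : ℕ) (T : Table n U) (x : U) (i r : ℕ) :
    Option (Table n U) × ℕ :=
  if _hi : i < d - 1 then
    -- look for the first free slot among those of the hashes `i + 1, …, d - 2`
    match (List.range' (i + 1) (d - 2 - i)).find? (fun j => (T (h x j)).isNone) with
    | some j => (some (T.put (h x j) x j), j - i) -- Type 3 move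
    | none => -- Type 4 move
      match hT : T (h x (d - 1)) with
      | none => (some (T.put (h x (d - 1)) x (d - 1)), d - 1 - i)
      | some (y, k) =>
        let o := place h d L (T.put (h x (d - 1)) x (d - 1)) y k 0
        (o.1, (d - 1 - i) + o.2)
  else
    -- Type 2 move (from `d - 1` to `d`) or Type 1 move (from `d` to `d - 1`)
    let i' := if i = d - 1 then d else d - 1
    match hT : T (h x i') with
    | none => (some (T.put (h x i') x i'), 1)
    | some (y, k) =>
      if _hr : L ≤ r + 1 then (none, 1)
      else
        let o := place h d L (T.put (h x i') x i') y k (r + 1)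
        (o.1, 1 + o.2)
  termination_by (T.nonCore d + (if i < d - 1 then 1 else 0), L - r)
  decreasing_by
    · have := Table.nonCore_put d T (h x (d - 1)) x (d - 1) (lt_irrefl _) y k hT
      apply Prod.Lex.left
      rw [if_pos _hi]
      omega
    · have := Table.nonCore_put d T (h x i') x i' (by simp only [i']; split <;> omega) y k hT
      rw [this, if_neg _hi]
      apply Prod.Lex.right
      omega

/-- Insert the keys `x 1, x 2, …` one by one into an empty table; `tableAfter h d L x k` is the
table after `k` insertions, and `none` if one of them has failed (the process stops then). -/
def tableAfter {n : ℕ} {U : Type u} (h : U → ℕ → Fin n) (d L : ℕ) (x : ℕ → U) :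
    ℕ → Option (Table n U)
  | 0 => some (fun _ => none)
  | k + 1 => (tableAfter h d L x k).bind (fun T => (place h d L T (x (k + 1)) 0 0).1)

/-- The time of the `k`-th insertion (`k ≥ 1`), failed or not. It is `0` if the process has stopped
before, because of the failure of an earlier insertion. -/
def insertionTime {n : ℕ} {U : Type u} (h : U → ℕ → Fin n) (d L : ℕ) (x : ℕ → U) (k : ℕ) : ℕ :=
  (tableAfter h d L x (k - 1)).elim 0 (fun T => (place h d L T (x k) 0 0).2)

/-- `T` is a `d`-ary cuckoo hash table with hash functions `h` and with set of elements `S`. -/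
def IsCuckooTable {n : ℕ} {U : Type u} (h : U → ℕ → Fin n) (d : ℕ) (T : Table n U) (S : Set U) :
    Prop :=
  (∀ s y j, T s = some (y, j) → y ∈ S ∧ 1 ≤ j ∧ j ≤ d ∧ h y j = s) ∧
    ∀ y ∈ S, ∃! s, ∃ j, T s = some (y, j)

/-- The first `m` insertions all succeed, and after each of them the table is a `d`-ary cuckoo hash
table that holds precisely the keys inserted so far. -/
def Supports {n : ℕ} {U : Type u} (h : U → ℕ → Fin n) (d L : ℕ) (x : ℕ → U) (m : ℕ) : Prop :=
  ∀ k ≤ m, ∃ T, tableAfter h d L x k = some T ∧ IsCuckooTable h d T (x '' Set.Icc 1 k)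

/-- The hash functions `h_1, …, h_d : U → [n]` are independent and fully random: all the values
`h_i(y)`, for `y ∈ U` and `1 ≤ i ≤ d`, are independent and uniformly distributed over the `n`
slots. -/
structure FullyRandom {n : ℕ} {U : Type u} {Ω : Type v} [MeasurableSpace Ω]
    (h : U → ℕ → Ω → Fin n) (d : ℕ) (μ : Measure Ω) : Prop where
  measurable : ∀ y, ∀ i ∈ Set.Icc 1 d, Measurable (h y i)
  uniform : ∀ y, ∀ i ∈ Set.Icc 1 d, ∀ s, μ {ω | h y i ω = s} = (n : ℝ≥0∞)⁻¹
  indep : iIndepFun (fun (p : U × Set.Icc 1 d) => h p.1 p.2) μ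

end BubbleUp

/-! The process is random only through the hash values, and no value matters before the policy first
looks it up. An insertion is therefore cut into single probes, each reading a slot that is uniform
and independent of the past (`State.next`, `State.reveals`). A promotion, that is a Type 4 move with
the Type 1 and Type 2 moves that follow it, counts as the probe of hash `d - 1` and also reveals
hash `d`. Probabilistic estimates become supermartingale inequalities for potentials of the state
(`State.expect_last_le`). `State.last_spec` identifies this machine with `tableAfter` and
`insertionTime`.

Few core keys: a probe misses a given set of `r` slots with probability `1 - r/n`, and filled slots
stay filled. So the number of `r`-sets of free slots, divided by `(1 - r/n)` to the number of
probes, is a supermartingale (`State.expect_choose_mul_le`). A core key has used up its first `d - 1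
≥ 3 ln(1/ε)` hashes, so more than `2n/5` core keys cost at least `(6/5) n ln(1/ε)` probes. After so
many uniform probes only about `ε^(6/5) n` slots should be free, but at least `εn` are. With `r` of
order `log n` this has probability `O(1/n)` (`exists_expect_core_le`).

The cuckoo graph: each core key is an edge between its last two slots, and in the order of promotion
the edges are independent and uniform (`State.expect_edges_le`). A multigraph with at most `2n/5`
random edges is subcritical: a trail of length `ℓ` from a given vertex has probability at most
`(4/5)^ℓ`, and a bicyclic component has probability `O(1/n)`.

Runs of core moves are walks in this graph. The evictions after a promotion follow a trail from one
slot of the new edge. If the trail closes a cycle, keys go back to their previous slots until the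
promoted key moves to its other slot, and a second trail starts there. Unless there is a bicyclic
component, no further cycle can close, so the moves number at most `1 + 2ℓ₁ + ℓ₂` for trails of
lengths `ℓ₁` and `ℓ₂` from the two slots (`promote_moves`). A failure thus needs many core keys, a
bicyclic component, or a trail of length at least `L/3`, which is unlikely as `L` is a large
multiple of `log n`.

Time: the number `N` of probes in insertion `M` has second moment at most `2/p²`, where `p =
(n+1-M)/n` is the fraction of free slots. A promotion looks at two fresh uniform slots, so a probe
costs on average at most one plus three times the mean longest trail. Young's inequality separates
`N` from the trail lengths, which have bounded second moments, and the expected time is `O(1/p)`. On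
the bad event each probe costs at most `L + 1`, and `(L + 1)²/n` is bounded. -/

namespace BubbleUp

open Finset
open scoped BigOperators

/-! ### Averages over finite product spaces -/

section Averages

/-- The indicator of a proposition. -/
noncomputable def ind (p : Prop) : ℝ := open Classical in if p then 1 else 0

theorem ind_of {p : Prop} (h : p) : ind p = 1 := if_pos h
theorem ind_of_not {p : Prop} (h : ¬ p) : ind p = 0 := if_neg h
theorem ind_nonneg (p : Prop) : 0 ≤ ind p := by unfold ind; split <;> norm_num
theorem ind_le_one (p : Prop) : ind p ≤ 1 := by unfold ind; split <;> norm_num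

theorem ind_mono {p q : Prop} (h : p → q) : ind p ≤ ind q := by
  by_cases hp : p
  · rw [ind_of hp, ind_of (h hp)]
  · rw [ind_of_not hp]; exact ind_nonneg q

theorem ind_and (p q : Prop) : ind (p ∧ q) = ind p * ind q := by
  by_cases hp : p <;> by_cases hq : q <;> simp [ind, hp, hq]

theorem ind_or_le (p q : Prop) : ind (p ∨ q) ≤ ind p + ind q := by
  by_cases hp : p <;> by_cases hq : q <;> simp [ind, hp, hq]

theorem ind_exists_le {κ : Type*} (A : Finset κ) (P : κ → Prop) :
    ind (∃ k ∈ A, P k) ≤ ∑ k ∈ A, ind (P k) := by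
  by_cases h : ∃ k ∈ A, P k
  · obtain ⟨k, hk, hP⟩ := h
    calc ind (∃ k ∈ A, P k) ≤ 1 := ind_le_one _
      _ = ind (P k) := (ind_of hP).symm
      _ ≤ _ := Finset.single_le_sum (f := fun k => ind (P k)) (fun k _ => ind_nonneg _) hk
  · rw [ind_of_not h]; exact Finset.sum_nonneg fun k _ => ind_nonneg _

variable {ι α : Type*} [Fintype ι] [DecidableEq ι] [Fintype α]

/-- Replacing the coordinates in `q` by independent ones does not change an average. -/
theorem expect_piecewise (q : Finset ι) (Φ : (ι → α) → ℝ) :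
    𝔼 e, 𝔼 e', Φ (q.piecewise e' e) = 𝔼 e : ι → α, Φ e := by
  classical
  rcases isEmpty_or_nonempty (ι → α) with hE | hE
  · simp
  -- Two independent copies exchange their coordinates in `q`. This is a bijection of the pairs.
  let σ : (ι → α) × (ι → α) ≃ (ι → α) × (ι → α) :=
    { toFun := fun p => (q.piecewise p.2 p.1, q.piecewise p.1 p.2)
      invFun := fun p => (q.piecewise p.2 p.1, q.piecewise p.1 p.2)
      left_inv := fun p => by
        ext i <;> by_cases h : i ∈ q <;> simp [Finset.piecewise, h]
      right_inv := fun p => by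
        ext i <;> by_cases h : i ∈ q <;> simp [Finset.piecewise, h] }
  have h1 : 𝔼 p : (ι → α) × (ι → α), Φ (σ p).1 = 𝔼 p : (ι → α) × (ι → α), Φ p.1 :=
    Fintype.expect_equiv σ _ _ (fun p => rfl)
  have h2 := Finset.expect_product (s := (univ : Finset (ι → α))) (t := (univ : Finset (ι → α)))
    (f := fun p => Φ (σ p).1)
  have h3 := Finset.expect_product (s := (univ : Finset (ι → α))) (t := (univ : Finset (ι → α)))
    (f := fun p => Φ p.1)
  rw [Finset.univ_product_univ] at h2 h3
  rw [h2, h3] at h1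
  simpa [σ] using h1

theorem expect_apply [Nonempty α] (k : ι) (ψ : α → ℝ) : 𝔼 e : ι → α, ψ (e k) = 𝔼 a, ψ a := by
  rw [Fintype.expect_equiv (Equiv.funSplitAt k α) (fun e => ψ (e k)) (fun p => ψ p.1)
    (fun e => by simp [Equiv.funSplitAt]), ← Finset.univ_product_univ, Finset.expect_product]
  simp

theorem expect_update [Nonempty α] (k : ι) (Φ : (ι → α) → ℝ) :
    𝔼 e : ι → α, 𝔼 a, Φ (Function.update e k a) = 𝔼 e, Φ e := by
  rw [← expect_piecewise {k} Φ]
  refine Finset.expect_congr rfl fun e _ => ?_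
  rw [← expect_apply k]
  refine Finset.expect_congr rfl fun e' _ => ?_
  rw [Finset.piecewise_singleton]

theorem expect_apply_apply [Nonempty α] {k l : ι} (hkl : k ≠ l) (ψ : α → α → ℝ) :
    𝔼 e : ι → α, ψ (e k) (e l) = 𝔼 a, 𝔼 b, ψ a b := by
  rw [← expect_update l]
  simp only [Function.update_self, Function.update_of_ne hkl]
  exact expect_apply k fun a => 𝔼 b, ψ a b

theorem expect_mul_of_update [Nonempty α] (k : ι) (g : α → ℝ) (f : (ι → α) → ℝ)
    (hf : ∀ e a, f (Function.update e k a) = f e) :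
    𝔼 e : ι → α, g (e k) * f e = (𝔼 a, g a) * 𝔼 e, f e := by
  rw [← expect_update k]
  simp only [Function.update_self, hf, ← Finset.expect_mul, Finset.mul_expect]

end Averages

/-! ### Trails and bicyclic configurations in random multigraphs -/

section Graphs

variable {ι κ V : Type*} [DecidableEq ι] [DecidableEq κ]

/-- The edge `k` of the multigraph `e` joins `u` and `w`. -/
def Joins (e : ι → V × V) (k : ι) (u w : V) : Prop := e k = (u, w) ∨ e k = (w, u)

/-- There is a trail of `ℓ` distinct edges from the set `A` that starts at `v`. -/
def Trail (e : ι → V × V) : ℕ → Finset ι → V → Prop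
  | 0, _, _ => True
  | ℓ + 1, A, v => ∃ k ∈ A, ∃ w, Joins e k v w ∧ Trail e ℓ (A.erase k) w

/-- A trail that started at `v₀`, has visited the vertices in `vs` and is now at `v` can be continued
by `ℓ` edges from `A` in such a way that two further edges from `A` join its first and its last
vertex to vertices of the trail. -/
def Closes (e : ι → V × V) (v₀ : V) : ℕ → Finset ι → V → List V → Prop
  | 0, A, v, vs => ∃ k ∈ A, ∃ k' ∈ A.erase k, (∃ w ∈ vs, Joins e k v w) ∧ ∃ w ∈ vs, Joins e k' v₀ w
  | ℓ + 1, A, v, vs => ∃ k ∈ A, ∃ w, Joins e k v w ∧ Closes e v₀ ℓ (A.erase k) w (w :: vs)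

/-- The edges in `A` contain a trail both ends of which are joined to the trail by further edges. -/
def Bicyclic (e : ι → V × V) (A : Finset ι) : Prop := ∃ v ℓ, Closes e v ℓ A v [v]

/-- Injectivity keeps the edges of the trail distinct. This one transport serves for larger edge
sets, for changes of unused edges, and for replacing keys by their positions in the order of
promotion. -/
theorem Trail.map {e : ι → V × V} {e' : κ → V × V} (φ : ι → κ) {ℓ : ℕ} :
    ∀ {A : Finset ι} {B : Finset κ} {v : V}, Set.InjOn φ A → (∀ k ∈ A, φ k ∈ B) →
      (∀ k ∈ A, e k = e' (φ k)) → Trail e ℓ A v → Trail e' ℓ B v := by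
  induction ℓ with
  | zero => intros; trivial
  | succ ℓ ih =>
    rintro A B v hφ hB he ⟨k, hk, w, hj, ht⟩
    refine ⟨φ k, hB k hk, w, by unfold Joins at *; rwa [← he k hk], ih
      (hφ.mono (by simp)) (fun l hl => ?_)
      (fun l hl => he l (Finset.mem_of_mem_erase hl)) ht⟩
    exact Finset.mem_erase.2 ⟨fun h => Finset.ne_of_mem_erase hl
      (hφ (Finset.mem_of_mem_erase hl) hk h), hB l (Finset.mem_of_mem_erase hl)⟩

theorem Closes.map {e : ι → V × V} {e' : κ → V × V} (φ : ι → κ) {v₀ : V} {ℓ : ℕ} :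
    ∀ {A : Finset ι} {B : Finset κ} {v : V} {vs : List V}, Set.InjOn φ A → (∀ k ∈ A, φ k ∈ B) →
      (∀ k ∈ A, e k = e' (φ k)) → Closes e v₀ ℓ A v vs → Closes e' v₀ ℓ B v vs := by
  induction ℓ with
  | zero =>
    rintro A B v vs hφ hB he ⟨k, hk, k', hk', ⟨w, hw, hj⟩, w', hw', hj'⟩
    have hkA := Finset.mem_of_mem_erase hk'
    refine ⟨φ k, hB k hk, φ k', Finset.mem_erase.2 ⟨fun h => Finset.ne_of_mem_erase hk'
      (hφ hkA hk h), hB k' hkA⟩, ⟨w, hw, ?_⟩, w', hw', ?_⟩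
    · unfold Joins at *; rwa [← he k hk]
    · unfold Joins at *; rwa [← he k' hkA]
  | succ ℓ ih =>
    rintro A B v vs hφ hB he ⟨k, hk, w, hj, ht⟩
    refine ⟨φ k, hB k hk, w, by unfold Joins at *; rwa [← he k hk], ih
      (hφ.mono (by simp)) (fun l hl => ?_)
      (fun l hl => he l (Finset.mem_of_mem_erase hl)) ht⟩
    exact Finset.mem_erase.2 ⟨fun h => Finset.ne_of_mem_erase hl
      (hφ (Finset.mem_of_mem_erase hl) hk h), hB l (Finset.mem_of_mem_erase hl)⟩

theorem Bicyclic.map {e : ι → V × V} {e' : κ → V × V} (φ : ι → κ) {A : Finset ι} {B : Finset κ}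
    (hφ : Set.InjOn φ A) (hB : ∀ k ∈ A, φ k ∈ B) (he : ∀ k ∈ A, e k = e' (φ k))
    (h : Bicyclic e A) : Bicyclic e' B := by
  obtain ⟨v, ℓ, h⟩ := h
  exact ⟨v, ℓ, h.map φ hφ hB he⟩

theorem Trail.mono {e : ι → V × V} {ℓ : ℕ} {A B : Finset ι} {v : V} (hAB : A ⊆ B)
    (h : Trail e ℓ A v) : Trail e ℓ B v :=
  h.map id (Set.injOn_id _) (fun _ hk => hAB hk) (fun _ _ => rfl)

theorem Trail.le_card {e : ι → V × V} {ℓ : ℕ} : ∀ {A : Finset ι} {v : V}, Trail e ℓ A v →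
    ℓ ≤ A.card := by
  induction ℓ with
  | zero => intros; omega
  | succ ℓ ih =>
    rintro A v ⟨k, hk, w, -, ht⟩
    have := ih ht
    rw [Finset.card_erase_of_mem hk] at this
    have := Finset.card_pos.2 ⟨k, hk⟩
    omega

theorem Closes.le_card {e : ι → V × V} {v₀ : V} {ℓ : ℕ} : ∀ {A : Finset ι} {v : V} {vs : List V},
    Closes e v₀ ℓ A v vs → ℓ ≤ A.card := by
  induction ℓ with
  | zero => intros; omega
  | succ ℓ ih =>
    rintro A v vs ⟨k, hk, w, -, ht⟩
    have := ih ht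
    rw [Finset.card_erase_of_mem hk] at this
    have := Finset.card_pos.2 ⟨k, hk⟩
    omega

theorem Trail.update {e : ι → V × V} {ℓ : ℕ} {A : Finset ι} {v : V} {k : ι} (hk : k ∉ A)
    (a : V × V) : Trail (Function.update e k a) ℓ A v ↔ Trail e ℓ A v := by
  have h : ∀ l ∈ A, Function.update e k a l = e l := fun l hl =>
    Function.update_of_ne (fun h : l = k => hk (h ▸ hl)) _ _
  exact ⟨fun ht => ht.map id (Set.injOn_id _) (fun _ h => h) h,
    fun ht => ht.map id (Set.injOn_id _) (fun _ h => h) fun l hl => (h l hl).symm⟩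

theorem Closes.update {e : ι → V × V} {v₀ : V} {ℓ : ℕ} {A : Finset ι} {v : V} {vs : List V} {k : ι}
    (hk : k ∉ A) (a : V × V) :
    Closes (Function.update e k a) v₀ ℓ A v vs ↔ Closes e v₀ ℓ A v vs := by
  have h : ∀ l ∈ A, Function.update e k a l = e l := fun l hl =>
    Function.update_of_ne (fun h : l = k => hk (h ▸ hl)) _ _
  exact ⟨fun ht => ht.map id (Set.injOn_id _) (fun _ h => h) h,
    fun ht => ht.map id (Set.injOn_id _) (fun _ h => h) fun l hl => (h l hl).symm⟩

variable [Fintype ι] [Fintype V] [Nonempty V]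

/-- Edge `k` is independent of `f`, and only two of the equally likely ordered pairs are favourable.
-/
theorem expect_ind_joins_mul_le (k : ι) (u w : V) (f : (ι → V × V) → ℝ) (hf0 : ∀ e, 0 ≤ f e)
    (hf : ∀ e a, f (Function.update e k a) = f e) :
    𝔼 e : ι → V × V, ind (Joins e k u w) * f e
      ≤ 2 / (Fintype.card V : ℝ) ^ 2 * 𝔼 e, f e := by
  have h := expect_mul_of_update k (fun a : V × V => ind (a = (u, w) ∨ a = (w, u))) f hf
  unfold Joins
  rw [h]
  refine mul_le_mul_of_nonneg_right ?_ (Finset.expect_nonneg fun e _ => hf0 e)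
  classical
  have h1 : ∀ b : V × V, 𝔼 a : V × V, ind (a = b) = 1 / (Fintype.card V : ℝ) ^ 2 := by
    intro b
    rw [Fintype.expect_eq_sum_div_card, Finset.sum_eq_single b (fun a _ h => ind_of_not h) (by simp),
      ind_of rfl, Fintype.card_prod, Nat.cast_mul, sq]
  calc 𝔼 a : V × V, ind (a = (u, w) ∨ a = (w, u))
      ≤ 𝔼 a : V × V, (ind (a = (u, w)) + ind (a = (w, u))) :=
        Finset.expect_le_expect fun a _ => ind_or_le _ _
    _ = 2 / (Fintype.card V : ℝ) ^ 2 := by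
        rw [Finset.expect_add_distrib, h1, h1]; ring

/-- Union bound over the first edge (at most `K` choices) and its other end (`n` choices), each of
probability at most `2/n²`. The rest of the trail avoids this edge, hence is independent of it. -/
theorem expect_trail_le (K : ℕ) (ℓ : ℕ) : ∀ (A : Finset ι) (v : V), A.card ≤ K →
    𝔼 e : ι → V × V, ind (Trail e ℓ A v) ≤ (2 * K / Fintype.card V : ℝ) ^ ℓ := by
  induction ℓ with
  | zero =>
    intro A v _
    rw [pow_zero]
    exact Finset.expect_le univ_nonempty fun e _ => ind_le_one _
  | succ ℓ ih =>
    intro A v hA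
    have hn : (0 : ℝ) < Fintype.card V := by exact_mod_cast Fintype.card_pos
    calc 𝔼 e : ι → V × V, ind (Trail e (ℓ + 1) A v)
        ≤ 𝔼 e : ι → V × V, ∑ k ∈ A, ∑ w, ind (Joins e k v w) * ind (Trail e ℓ (A.erase k) w) := by
          refine Finset.expect_le_expect fun e _ => (ind_exists_le A _).trans ?_
          refine Finset.sum_le_sum fun k _ => ?_
          have := ind_exists_le univ fun w => Joins e k v w ∧ Trail e ℓ (A.erase k) w
          simpa [ind_and] using this
      _ = ∑ k ∈ A, ∑ w, 𝔼 e : ι → V × V, ind (Joins e k v w) * ind (Trail e ℓ (A.erase k) w) := by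
          rw [Finset.expect_sum_comm]
          exact Finset.sum_congr rfl fun k _ => Finset.expect_sum_comm _ _ _
      _ ≤ ∑ k ∈ A, ∑ w : V, 2 / (Fintype.card V : ℝ) ^ 2 * (2 * K / Fintype.card V : ℝ) ^ ℓ := by
          refine Finset.sum_le_sum fun k _ => Finset.sum_le_sum fun w _ => ?_
          refine (expect_ind_joins_mul_le k v w _ (fun e => ind_nonneg _) fun e a => ?_).trans ?_
          · rw [Trail.update (Finset.notMem_erase k A)]
          · gcongr
            exact ih _ _ ((Finset.card_erase_le).trans hA)
      _ = (2 * A.card / Fintype.card V : ℝ) * (2 * K / Fintype.card V : ℝ) ^ ℓ := by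
          simp only [Finset.sum_const, nsmul_eq_mul, Finset.card_univ]
          field_simp
      _ ≤ (2 * K / Fintype.card V : ℝ) * (2 * K / Fintype.card V : ℝ) ^ ℓ := by
          gcongr
      _ = _ := by rw [pow_succ]; ring

/-- Each step of the trail costs a factor `2K/n`, as for trails. Each of the two closing edges has
at most `K` choices and must hit one of the `vs.length + ℓ` listed vertices, with probability at
most `2/n²` for each. -/
theorem expect_closes_le (K : ℕ) (v₀ : V) (ℓ : ℕ) : ∀ (A : Finset ι) (v : V) (vs : List V),
    A.card ≤ K → 𝔼 e : ι → V × V, ind (Closes e v₀ ℓ A v vs)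
      ≤ (2 * K / Fintype.card V : ℝ) ^ ℓ *
        (2 * K * (vs.length + ℓ) / (Fintype.card V : ℝ) ^ 2) ^ 2 := by
  have hn : (0 : ℝ) < Fintype.card V := by exact_mod_cast Fintype.card_pos
  classical
  induction ℓ with
  | zero =>
    intro A v vs hA
    have hvs : (vs.toFinset.card : ℝ) ≤ vs.length := by exact_mod_cast vs.toFinset_card_le
    calc 𝔼 e : ι → V × V, ind (Closes e v₀ 0 A v vs)
        ≤ 𝔼 e : ι → V × V, ∑ k ∈ A, ∑ k' ∈ A.erase k, ∑ w ∈ vs.toFinset, ∑ w' ∈ vs.toFinset,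
            ind (Joins e k v w) * ind (Joins e k' v₀ w') := by
          refine Finset.expect_le_expect fun e _ => (ind_exists_le A _).trans ?_
          refine Finset.sum_le_sum fun k _ => (ind_exists_le _ _).trans ?_
          refine Finset.sum_le_sum fun k' _ => ?_
          rw [ind_and]
          have h1 := ind_exists_le vs.toFinset fun w => Joins e k v w
          have h2 := ind_exists_le vs.toFinset fun w => Joins e k' v₀ w
          simp only [List.mem_toFinset] at h1 h2
          refine (mul_le_mul h1 h2 (ind_nonneg _)
            (Finset.sum_nonneg fun _ _ => ind_nonneg _)).trans ?_
          rw [Finset.sum_mul_sum]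
      _ = ∑ k ∈ A, ∑ k' ∈ A.erase k, ∑ w ∈ vs.toFinset, ∑ w' ∈ vs.toFinset,
            𝔼 e : ι → V × V, ind (Joins e k v w) * ind (Joins e k' v₀ w') := by
          simp only [Finset.expect_sum_comm]
      _ ≤ ∑ k ∈ A, ∑ k' ∈ A.erase k, ∑ w ∈ vs.toFinset, ∑ w' ∈ vs.toFinset,
            (2 / (Fintype.card V : ℝ) ^ 2) ^ 2 := by
          refine Finset.sum_le_sum fun k _ => Finset.sum_le_sum fun k' hk' =>
            Finset.sum_le_sum fun w _ => Finset.sum_le_sum fun w' _ => ?_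
          have hne := Finset.ne_of_mem_erase hk'
          refine (expect_ind_joins_mul_le k v w _ (fun e => ind_nonneg _) fun e a => ?_).trans ?_
          · unfold Joins; rw [Function.update_of_ne hne]
          · rw [sq (2 / (Fintype.card V : ℝ) ^ 2)]
            gcongr
            have := expect_ind_joins_mul_le (ι := ι) k' v₀ w' (fun _ => 1) (fun _ => zero_le_one)
              fun _ _ => rfl
            simpa using this
      _ ≤ ∑ k ∈ A, ∑ k' ∈ A, ∑ w ∈ vs.toFinset, ∑ w' ∈ vs.toFinset,
            (2 / (Fintype.card V : ℝ) ^ 2) ^ 2 := by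
          refine Finset.sum_le_sum fun k _ =>
            Finset.sum_le_sum_of_subset_of_nonneg (Finset.erase_subset _ _) fun _ _ _ => ?_
          positivity
      _ = (2 * A.card * vs.toFinset.card / (Fintype.card V : ℝ) ^ 2) ^ 2 := by
          simp only [Finset.sum_const, nsmul_eq_mul]
          ring
      _ ≤ _ := by
          rw [pow_zero, one_mul, Nat.cast_zero, add_zero]
          gcongr
  | succ ℓ ih =>
    intro A v vs hA
    set B : ℝ := (2 * K / Fintype.card V : ℝ) ^ ℓ *
        (2 * K * (vs.length + (ℓ + 1 : ℕ)) / (Fintype.card V : ℝ) ^ 2) ^ 2 with hB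
    have hB0 : 0 ≤ B := by positivity
    calc 𝔼 e : ι → V × V, ind (Closes e v₀ (ℓ + 1) A v vs)
        ≤ 𝔼 e : ι → V × V, ∑ k ∈ A, ∑ w,
            ind (Joins e k v w) * ind (Closes e v₀ ℓ (A.erase k) w (w :: vs)) := by
          refine Finset.expect_le_expect fun e _ => (ind_exists_le A _).trans ?_
          refine Finset.sum_le_sum fun k _ => ?_
          have := ind_exists_le univ fun w =>
            Joins e k v w ∧ Closes e v₀ ℓ (A.erase k) w (w :: vs)
          simpa [ind_and] using this
      _ = ∑ k ∈ A, ∑ w, 𝔼 e : ι → V × V,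
            ind (Joins e k v w) * ind (Closes e v₀ ℓ (A.erase k) w (w :: vs)) := by
          rw [Finset.expect_sum_comm]
          exact Finset.sum_congr rfl fun k _ => Finset.expect_sum_comm _ _ _
      _ ≤ ∑ k ∈ A, ∑ w : V, 2 / (Fintype.card V : ℝ) ^ 2 * B := by
          refine Finset.sum_le_sum fun k _ => Finset.sum_le_sum fun w _ => ?_
          refine (expect_ind_joins_mul_le k v w _ (fun e => ind_nonneg _) fun e a => ?_).trans ?_
          · rw [Closes.update (Finset.notMem_erase k A)]
          · gcongr
            refine (ih _ _ _ ((Finset.card_erase_le).trans hA)).trans (le_of_eq ?_)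
            rw [hB, List.length_cons]
            push_cast
            ring
      _ = (2 * A.card / Fintype.card V : ℝ) * B := by
          simp only [Finset.sum_const, nsmul_eq_mul, Finset.card_univ]
          field_simp
      _ ≤ (2 * K / Fintype.card V : ℝ) * B := by
          gcongr
      _ = _ := by rw [hB, pow_succ]; ring

end Graphs

end BubbleUp

/-! ### Splitting `place` into single probes and runs of core moves -/

namespace BubbleUp

universe u v

open Finset

set_option linter.unusedSectionVars false

variable {n : ℕ} {U : Type u}

/-- The one of the last two hash indices that is not `i`. -/
def other (d i : ℕ) : ℕ := if i = d - 1 then d else d - 1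

/-- A maximal run of Type 1 and Type 2 moves, at most `f + 1` of them, that starts with the homeless
core key `x`. The result is `none` for a failure, and otherwise the resulting table together with
the evicted non-core key, if any; the second component is the number of moves. -/
def coreRun (h : U → ℕ → Fin n) (d : ℕ) :
    ℕ → Table n U → U → ℕ → Option (Table n U × Option (U × ℕ)) × ℕ
  | 0, T, x, i =>
    match T (h x (other d i)) with
    | none => (some (T.put (h x (other d i)) x (other d i), none), 1)
    | some _ => (none, 1)
  | f + 1, T, x, i =>
    match T (h x (other d i)) with
    | none => (some (T.put (h x (other d i)) x (other d i), none), 1)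
    | some (y, k) =>
      if k < d - 1 then (some (T.put (h x (other d i)) x (other d i), some (y, k)), 1)
      else
        ((coreRun h d f (T.put (h x (other d i)) x (other d i)) y k).1,
          1 + (coreRun h d f (T.put (h x (other d i)) x (other d i)) y k).2)

/-- A Type 4 move and the run of Type 1 and Type 2 moves that follows it. -/
def promote (h : U → ℕ → Fin n) (d L : ℕ) (T : Table n U) (x : U) :
    Option (Table n U × Option (U × ℕ)) × ℕ :=
  match T (h x (d - 1)) with
  | none => (some (T.put (h x (d - 1)) x (d - 1), none), 1)
  | some (y, k) =>
    if k < d - 1 then (some (T.put (h x (d - 1)) x (d - 1), some (y, k)), 1)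
    else ((coreRun h d (L - 1) (T.put (h x (d - 1)) x (d - 1)) y k).1,
      1 + (coreRun h d (L - 1) (T.put (h x (d - 1)) x (d - 1)) y k).2)

/-- What becomes of an insertion after a run of core moves. -/
def resume (h : U → ℕ → Fin n) (d L : ℕ) (o : Option (Table n U × Option (U × ℕ)) × ℕ) :
    Option (Table n U) × ℕ :=
  match o.1 with
  | none => (none, o.2)
  | some (T, none) => (some T, o.2)
  | some (T, some (y, k)) => ((place h d L T y k 0).1, o.2 + (place h d L T y k 0).2)

theorem resume_one_add (h : U → ℕ → Fin n) (d L : ℕ)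
    (o : Option (Table n U × Option (U × ℕ)) × ℕ) :
    resume h d L (o.1, 1 + o.2) = ((resume h d L o).1, 1 + (resume h d L o).2) := by
  obtain ⟨o1, o2⟩ := o
  unfold resume
  rcases o1 with _ | ⟨T, _ | ⟨y, k⟩⟩ <;> simp [add_assoc]

theorem place_congr_run (h : U → ℕ → Fin n) (d L : ℕ) (T : Table n U) (x : U) {i : ℕ}
    (hi : i < d - 1) (r r' : ℕ) : place h d L T x i r = place h d L T x i r' := by
  rw [place, place, dif_pos hi, dif_pos hi]

/-- After `r` moves in a row the fuel is `L - 1 - r`: with fuel `0`, the next move must find a free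
slot or the insertion fails. -/
theorem place_of_core (h : U → ℕ → Fin n) (d L : ℕ) (f : ℕ) : ∀ (T : Table n U) (x : U) (i r : ℕ),
    ¬ i < d - 1 → L - 1 - r = f → place h d L T x i r = resume h d L (coreRun h d f T x i) := by
  induction f with
  | zero =>
    intro T x i r hi hf
    rw [place, dif_neg hi, coreRun]
    simp only [other]
    split
    · next hT => simp only [hT]; rfl
    · next y k hT => simp only [hT]; rw [dif_pos (by omega)]; rfl
  | succ f ih =>
    intro T x i r hi hf
    rw [place, dif_neg hi, coreRun]
    simp only [other]
    split
    · next hT => simp only [hT]; rfl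
    · next y k hT =>
      simp only [hT]
      rw [dif_neg (by omega)]
      by_cases hk : k < d - 1
      · rw [if_pos hk, place_congr_run h d L _ y hk (r + 1) 0]
        rfl
      · rw [if_neg hk, ih _ y k (r + 1) hk (by omega), resume_one_add]

theorem place_of_last (h : U → ℕ → Fin n) (d L : ℕ) (T : Table n U) (x : U) {i : ℕ} (r : ℕ)
    (hi : i + 1 = d - 1) : place h d L T x i r = resume h d L (promote h d L T x) := by
  rw [place, dif_pos (by omega), promote]
  have h1 : d - 2 - i = 0 := by omega
  have h2 : d - 1 - i = 1 := by omega
  simp only [h1, h2, List.range'_zero, List.find?_nil]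
  split
  · next hT => simp only [hT]; rfl
  · next y k hT =>
    simp only [hT]
    by_cases hk : k < d - 1
    · rw [if_pos hk]
      rfl
    · rw [if_neg hk, place_of_core h d L (L - 1) _ y k 0 hk (by omega), resume_one_add]

/-- After an unsuccessful probe the search goes on as if the key had been evicted from hash `i + 1`.
So a Type 3 or Type 4 move can be cut into steps that read one slot each. -/
theorem place_of_probe (h : U → ℕ → Fin n) (d L : ℕ) (T : Table n U) (x : U) {i : ℕ} (r : ℕ)
    (hi : i + 1 < d - 1) : place h d L T x i r =
      if T (h x (i + 1)) = none then (some (T.put (h x (i + 1)) x (i + 1)), 1)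
      else ((place h d L T x (i + 1) 0).1, 1 + (place h d L T x (i + 1) 0).2) := by
  rw [place, dif_pos (by omega), place, dif_pos (by omega)]
  have h1 : d - 2 - i = (d - 2 - (i + 1)) + 1 := by omega
  have h2 : d - 1 - i = 1 + (d - 1 - (i + 1)) := by omega
  rw [h1, h2, List.range'_succ, List.find?_cons]
  rcases hT : T (h x (i + 1)) with _ | p
  · simp
  · simp only [Option.isNone_some, reduceCtorEq, if_false]
    rcases hfd : List.find? (fun j => (T (h x j)).isNone)
      (List.range' (i + 1 + 1) (d - 2 - (i + 1))) with _ | j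
    · simp only
      split
      · next hT' => rfl
      · next y k hT' => simp only [add_assoc]
    · have hj := List.mem_of_find?_eq_some hfd
      rw [List.mem_range'_1] at hj
      simp only [Prod.mk.injEq, true_and]
      omega

theorem Table.put_self (T : Table n U) (s : Fin n) (x : U) (i : ℕ) : T.put s x i s = some (x, i) :=
  Function.update_self _ _ _

theorem Table.put_of_ne (T : Table n U) {s t : Fin n} (x : U) (i : ℕ) (ht : t ≠ s) :
    T.put s x i t = T t :=
  Function.update_of_ne ht _ _

section Further

variable (d L : ℕ) (x : ℕ → U) (g : U → ℕ → Fin n)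

/-- The result of `j` further insertions after the first `k`. -/
def further : ℕ → ℕ → Table n U → Option (Table n U)
  | 0, _, T => some T
  | j + 1, k, T => (place g d L T (x (k + 1)) 0 0).1.bind (further j (k + 1))

theorem tableAfter_add (j : ℕ) : ∀ k,
    tableAfter g d L x (k + j) = (tableAfter g d L x k).bind (further d L x g j k) := by
  induction j with
  | zero => intro k; simp [further]
  | succ j ih =>
    intro k
    rw [show k + (j + 1) = (k + 1) + j by ring, ih, tableAfter, Option.bind_assoc]
    rfl

end Further

/-! ### Runs of core moves as walks in the cuckoo graph -/

section Run

variable [DecidableEq U]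

/-- The core keys in the table `T` belong to `A` and stand where they should, and no key stands in
two places. -/
structure CoreWF (h : U → ℕ → Fin n) (d : ℕ) (A : Finset U) (T : Table n U) : Prop where
  inj : ∀ {t t' z c c'}, T t = some (z, c) → T t' = some (z, c') → t = t'
  core : ∀ {t z c}, T t = some (z, c) → ¬ c < d - 1 → c ≤ d ∧ h z c = t ∧ z ∈ A

/-- The edge of a key in the cuckoo graph of the last two hashes. -/
def coreEdge (h : U → ℕ → Fin n) (d : ℕ) (z : U) : Fin n × Fin n := (h z (d - 1), h z d)

theorem joins_coreEdge {h : U → ℕ → Fin n} {d : ℕ} {z : U} {c : ℕ} (hc : ¬ c < d - 1) (hcd : c ≤ d) :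
    Joins (coreEdge h d) z (h z c) (h z (other d c)) := by
  unfold Joins coreEdge other
  by_cases h1 : c = d - 1
  · left; simp [h1]
  · right
    rw [if_neg h1]
    have : c = d := by omega
    rw [this]

theorem not_other_lt (d i : ℕ) : ¬ other d i < d - 1 := by unfold other; split <;> omega
theorem other_le (d i : ℕ) : other d i ≤ d := by unfold other; split <;> omega

theorem CoreWF.put {h : U → ℕ → Fin n} {d : ℕ} {A : Finset U} {T : Table n U}
    (hT : CoreWF h d A T) {y : U} (hy : ∀ t c, T t ≠ some (y, c)) {i : ℕ}
    (hi : i ≤ d) (hyA : y ∈ A) : CoreWF h d A (T.put (h y i) y i) where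
  inj := by
    intro t t' z c c' h1 h2
    by_cases ht : t = h y i <;> by_cases ht' : t' = h y i
    · rw [ht, ht']
    · subst ht
      rw [Table.put_self] at h1
      rw [Table.put_of_ne _ _ _ ht'] at h2
      simp only [Option.some.injEq, Prod.mk.injEq] at h1
      exact absurd (h1.1 ▸ h2) (hy _ _)
    · subst ht'
      rw [Table.put_self] at h2
      rw [Table.put_of_ne _ _ _ ht] at h1
      simp only [Option.some.injEq, Prod.mk.injEq] at h2
      exact absurd (h2.1 ▸ h1) (hy _ _)
    · rw [Table.put_of_ne _ _ _ ht] at h1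
      rw [Table.put_of_ne _ _ _ ht'] at h2
      exact hT.inj h1 h2
  core := by
    intro t z c h1 hc
    by_cases ht : t = h y i
    · subst ht
      rw [Table.put_self] at h1
      simp only [Option.some.injEq, Prod.mk.injEq] at h1
      obtain ⟨rfl, rfl⟩ := h1
      exact ⟨hi, rfl, hyA⟩
    · rw [Table.put_of_ne _ _ _ ht] at h1
      exact hT.core h1 hc

theorem CoreWF.absent_put {h : U → ℕ → Fin n} {d : ℕ} {A : Finset U} {T : Table n U}
    (hT : CoreWF h d A T) {y : U} (hy : ∀ t c, T t ≠ some (y, c)) {w : Fin n} {z : U} {c : ℕ}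
    (hw : T w = some (z, c)) (i : ℕ) : ∀ t c', T.put w y i t ≠ some (z, c') := by
  intro t c' h1
  by_cases ht : t = w
  · subst ht
    rw [Table.put_self] at h1
    simp only [Option.some.injEq, Prod.mk.injEq] at h1
    exact hy _ _ (h1.1 ▸ hw)
  · rw [Table.put_of_ne _ _ _ ht] at h1
    exact ht (hT.inj h1 hw)

variable {h : U → ℕ → Fin n} {d : ℕ} {A : Finset U}

/-- The induction step for run lengths. How a run ends is irrelevant here: its last move counts as
one edge, that of the homeless key. -/
theorem coreRun_snd_eq_one_or (f : ℕ) (T : Table n U) (y : U) (c : ℕ) :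
    (coreRun h d f T y c).2 = 1 ∨ ∃ f' y' c', f = f' + 1 ∧ T (h y (other d c)) = some (y', c') ∧
      ¬ c' < d - 1 ∧ (coreRun h d f T y c).2 =
        1 + (coreRun h d f' (T.put (h y (other d c)) y (other d c)) y' c').2 := by
  rcases f with _ | f
  · left
    rw [coreRun]
    split <;> rfl
  · rw [coreRun]
    split
    · left; rfl
    · next y' c' hw =>
      by_cases hc : c' < d - 1
      · left; rw [if_pos hc]
      · right; rw [if_neg hc]; exact ⟨f, y', c', rfl, hw, hc, rfl⟩

/-- A run of core moves that follows a path which is already closed at its other end: as long as no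
second cycle is closed, it is a trail of unused edges. -/
theorem coreRun_of_closed {v₀ : Fin n} {x₀ : U} (f : ℕ) :
    ∀ (T : Table n U) (y : U) (c : ℕ) (Z : Finset U) (vs : List (Fin n)),
      CoreWF h d A T → (∀ t c, T t ≠ some (y, c)) → y ∈ A → y ∉ Z → y ≠ x₀ → ¬ c < d - 1 → c ≤ d →
      x₀ ∈ A → x₀ ∉ Z → (∃ w ∈ vs, Joins (coreEdge h d) x₀ v₀ w) →
      (∀ t z c, t ∉ vs → T t = some (z, c) → z ∉ Z ∧ z ≠ x₀) →
      (∀ ℓ, Closes (coreEdge h d) v₀ ℓ (A \ Z) (h y c) vs → Bicyclic (coreEdge h d) A) →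
      Bicyclic (coreEdge h d) A ∨
        Trail (coreEdge h d) (coreRun h d f T y c).2 ((A \ Z).erase x₀) (h y c) := by
  induction f with
  | zero =>
    intro T y c Z vs hT hy hyA hyZ hyx hc hcd hxA hxZ hx hvs hcl
    right
    rcases coreRun_snd_eq_one_or (h := h) (d := d) 0 T y c with h1 | ⟨f', -, -, hf, -⟩
    · rw [h1]
      exact ⟨y, by simp [*], _, joins_coreEdge hc hcd, trivial⟩
    · omega
  | succ f ih =>
    intro T y c Z vs hT hy hyA hyZ hyx hc hcd hxA hxZ hx hvs hcl
    rcases coreRun_snd_eq_one_or (h := h) (d := d) (f + 1) T y c with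
      h1 | ⟨f', y', c', hf, hw, hc', h1⟩
    · right
      rw [h1]
      exact ⟨y, by simp [*], _, joins_coreEdge hc hcd, trivial⟩
    · obtain rfl : f = f' := by omega
      set w := h y (other d c) with hwdef
      by_cases hwvs : w ∈ vs
      · left
        -- The run returns to a visited slot: `y` joins the last vertex to the trail, and the
        -- reserved edge `x₀` joins the first one, so the configuration is bicyclic.
        refine hcl 0 ⟨y, by simp [*], x₀, by simp [*, Ne.symm hyx], ⟨w, hwvs, ?_⟩, hx⟩
        exact joins_coreEdge hc hcd
      · obtain ⟨hyZ', hyx'⟩ := hvs _ _ _ hwvs hw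
        have hy'y : y' ≠ y := fun h0 => hy w c' (h0 ▸ hw)
        obtain ⟨hcd', hwc', hyA'⟩ := hT.core hw hc'
        have hsd : A \ insert y Z = (A \ Z).erase y := by
          ext z; simp only [Finset.mem_sdiff, Finset.mem_insert, Finset.mem_erase]; tauto
        have := ih (T.put w y (other d c)) y' c' (insert y Z) (w :: vs)
          (hT.put hy (other_le d c) hyA) (hT.absent_put hy hw _) hyA' (by simp [*]) hyx' hc'
          hcd' hxA (by simp [hxZ, Ne.symm hyx]) (by
            obtain ⟨w', hw', hj⟩ := hx
            exact ⟨w', List.mem_cons_of_mem _ hw', hj⟩) (by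
            intro t z c'' ht hz
            simp only [List.mem_cons, not_or] at ht
            rw [Table.put_of_ne _ _ _ ht.1] at hz
            have hzy : z ≠ y := fun h0 => hy t c'' (h0 ▸ hz)
            have := hvs t z c'' ht.2 hz
            simp [hzy, this]) (by
            intro ℓ hℓ
            refine hcl (ℓ + 1) ⟨y, by simp [*], w, joins_coreEdge hc hcd, ?_⟩
            rwa [hsd, hwc'] at hℓ)
        rcases this with hb | ht
        · exact Or.inl hb
        · right
          rw [h1, add_comm]
          refine ⟨y, by simp [*], w, joins_coreEdge hc hcd, ?_⟩
          rw [hwc', hsd, Finset.erase_right_comm] at ht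
          exact ht

/-- The slot on top of a stack, or `s₀` if the stack is empty. -/
def stackTop (s₀ : Fin n) : List (Fin n × U) → Fin n
  | [] => s₀
  | p :: _ => p.1

/-- The keys on the stack stand in the slots with which they are listed, each has the slot below as
its other slot, and the key at the bottom is `x₁`, the other slot of which is `s₀`. -/
def Stacked (h : U → ℕ → Fin n) (d : ℕ) (x₁ : U) (s₀ : Fin n) (T : Table n U) :
    List (Fin n × U) → Prop
  | [] => True
  | p :: st => (∃ c, T p.1 = some (p.2, c) ∧ ¬ c < d - 1 ∧ h p.2 (other d c) = stackTop s₀ st) ∧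
      (st = [] → p.2 = x₁) ∧ Stacked h d x₁ s₀ T st

theorem Stacked.congr {x₁ : U} {s₀ : Fin n} {T T' : Table n U} : ∀ {st : List (Fin n × U)},
    (∀ p ∈ st, T p.1 = T' p.1) → Stacked h d x₁ s₀ T st → Stacked h d x₁ s₀ T' st
  | [], _, _ => trivial
  | p :: _, hTT, ⟨⟨c, h1, h2⟩, h3, h4⟩ =>
    ⟨⟨c, (hTT p List.mem_cons_self) ▸ h1, h2⟩, h3,
      Stacked.congr (fun q hq => hTT q (List.mem_cons_of_mem _ hq)) h4⟩

theorem Stacked.exists_of_mem {x₁ : U} {s₀ : Fin n} {T : Table n U} : ∀ {st : List (Fin n × U)},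
    Stacked h d x₁ s₀ T st → ∀ p ∈ st, ∃ c, T p.1 = some (p.2, c)
  | [], _, _, hp => absurd hp List.not_mem_nil
  | q :: st, ⟨⟨c, h1, _⟩, _, h4⟩, p, hp => by
    rcases List.mem_cons.1 hp with rfl | hp
    · exact ⟨c, h1⟩
    · exact h4.exists_of_mem p hp

/-- The vertices seen on the way down a stack. -/
def downList (s₀ : Fin n) : List (Fin n × U) → List (Fin n) → List (Fin n)
  | [], vs => vs
  | _ :: st, vs => downList s₀ st (stackTop s₀ st :: vs)

theorem subset_downList (s₀ : Fin n) : ∀ (st : List (Fin n × U)) (vs : List (Fin n)),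
    vs ⊆ downList s₀ st vs ∧ (∀ p ∈ st.tail, p.1 ∈ downList s₀ st vs) ∧
      (st ≠ [] → s₀ ∈ downList s₀ st vs)
  | [], vs => ⟨fun _ h => h, by simp, by simp⟩
  | q :: [], vs => ⟨fun _ h => List.mem_cons_of_mem _ h, by simp, fun _ => List.mem_cons_self⟩
  | q :: p :: st, vs => by
    obtain ⟨h1, h2, h3⟩ := subset_downList s₀ (p :: st) (p.1 :: vs)
    refine ⟨fun w hw => h1 (List.mem_cons_of_mem _ hw), fun p' hp' => ?_, fun _ => h3 (by simp)⟩
    rcases List.mem_cons.1 hp' with rfl | hp'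
    · exact h1 List.mem_cons_self
    · exact h2 p' hp'

/-- Each stacked key is an edge from its slot to the slot below. Walking down the stack therefore
prolongs a configuration that starts at `s₀` to one that starts at the top. -/
theorem closes_of_stacked {x₁ : U} {s₀ v₀ : Fin n} {T : Table n U} (hT : CoreWF h d A T) {ℓ : ℕ} :
    ∀ (st : List (Fin n × U)) (Z : Finset U) (vs : List (Fin n)), Stacked h d x₁ s₀ T st →
      (st.map Prod.snd).Nodup → (∀ p ∈ st, p.2 ∉ Z) →
      Closes (coreEdge h d) v₀ ℓ (A \ (Z ∪ (st.map Prod.snd).toFinset)) s₀ (downList s₀ st vs) →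
      ∃ ℓ', Closes (coreEdge h d) v₀ ℓ' (A \ Z) (stackTop s₀ st) vs
  | [], Z, vs, _, _, _, hcl => ⟨ℓ, by simpa [downList, stackTop] using hcl⟩
  | p :: st, Z, vs, ⟨⟨c, h1, h2, h3⟩, _, hst⟩, hnd, hZ, hcl => by
    rw [List.map_cons, List.nodup_cons] at hnd
    obtain ⟨hcd, hs, hpA⟩ := hT.core h1 h2
    obtain ⟨ℓ', hℓ'⟩ := closes_of_stacked hT st (insert p.2 Z) (stackTop s₀ st :: vs) hst hnd.2
      (fun q hq => by
        rw [Finset.mem_insert, not_or]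
        refine ⟨fun h0 => hnd.1 (h0 ▸ List.mem_map_of_mem hq), hZ q (List.mem_cons_of_mem _ hq)⟩)
      (by
        rw [downList] at hcl
        convert hcl using 2
        simp)
    refine ⟨ℓ' + 1, p.2, ?_, stackTop s₀ st, ?_, ?_⟩
    · simp [hpA, hZ p List.mem_cons_self]
    · have := joins_coreEdge (h := h) (z := p.2) h2 hcd
      rwa [hs, h3] at this
    · convert hℓ' using 1
      ext z; simp only [Finset.mem_sdiff, Finset.mem_insert, Finset.mem_erase]; tauto

/-- The keys on the stack return one after the other to their previous slots; then the first of them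
tries its other slot. -/
theorem coreRun_retrace {x₁ : U} {s₀ v₀ : Fin n} {x₀ : U} {Z : Finset U} {vs : List (Fin n)}
    (hx₁ : x₁ ∈ Z) (hxA : x₀ ∈ A) (hxZ : x₀ ∉ Z)
    (hx : ∃ w ∈ vs, Joins (coreEdge h d) x₀ v₀ w)
    (hcl : ∀ ℓ, Closes (coreEdge h d) v₀ ℓ (A \ Z) s₀ vs → Bicyclic (coreEdge h d) A) :
    ∀ (st : List (Fin n × U)) (f : ℕ) (T : Table n U) (y : U) (c : ℕ),
      CoreWF h d A T → (∀ t c, T t ≠ some (y, c)) → y ∈ A → ¬ c < d - 1 → c ≤ d →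
      h y (other d c) = stackTop s₀ st → (st = [] → y = x₁) → Stacked h d x₁ s₀ T st →
      (st.map Prod.fst).Nodup → (∀ p ∈ st, p.1 ∈ vs ∧ p.1 ≠ s₀) → s₀ ∈ vs →
      (∀ z c, T s₀ = some (z, c) → z ∉ Z ∧ z ≠ x₀) →
      (∀ t z c, t ∉ vs → T t = some (z, c) → z ∉ Z ∧ z ≠ x₀) →
      Bicyclic (coreEdge h d) A ∨ ∃ m, Trail (coreEdge h d) m (A.erase x₁) s₀ ∧
        (coreRun h d f T y c).2 ≤ (st.length + 1) + m
  | [], f, T, y, c, hT, hy, hyA, hc, hcd, htop, hbot, _, _, _, hs₀, hs₀T, hvs => by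
    -- With the stack exhausted, the homeless key is `x₁` and its other slot is `s₀`. From there on
    -- one cycle is closed already, by `x₀`, and `coreRun_of_closed` applies.
    obtain rfl := hbot rfl
    rcases coreRun_snd_eq_one_or (h := h) (d := d) f T y c with
      h1 | ⟨f', y', c', hf, hw, hc', h1⟩
    · exact Or.inr ⟨0, trivial, by rw [h1]; simp⟩
    · rw [htop, stackTop] at hw h1
      obtain ⟨hcd', hwc', hyA'⟩ := hT.core hw hc'
      have hput := hT.put hy (other_le d c) hyA
      rw [htop, stackTop] at hput
      rcases coreRun_of_closed (v₀ := v₀) (x₀ := x₀) f' _ y' c' Z vs hput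
        (hT.absent_put hy hw _) hyA' (hs₀T _ _ hw).1 (hs₀T _ _ hw).2 hc' hcd' hxA hxZ hx
        (fun t z c'' ht hz => by
          rw [Table.put_of_ne _ _ _ (fun h0 => ht (by rw [h0]; exact hs₀))] at hz
          exact hvs t z c'' ht hz)
        (by rwa [hwc']) with hb | ht
      · exact Or.inl hb
      · refine Or.inr ⟨_, ?_, h1.le.trans (le_of_eq (by rw [List.length_nil, zero_add]))⟩
        rw [hwc'] at ht
        refine ht.mono fun z hz => ?_
        simp only [Finset.mem_erase, Finset.mem_sdiff] at hz ⊢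
        exact ⟨fun h0 => hz.2.2 (h0 ▸ hx₁), hz.2.1⟩
  | p :: st, f, T, y, c, hT, hy, hyA, hc, hcd, htop, _, ⟨⟨c₁, hp1, hp2, hp3⟩, hp4, hst⟩, hnd, hmem,
      hs₀, hs₀T, hvs => by
    rw [List.map_cons, List.nodup_cons] at hnd
    rcases coreRun_snd_eq_one_or (h := h) (d := d) f T y c with
      h1 | ⟨f', y', c', hf, hw, hc', h1⟩
    · exact Or.inr ⟨0, trivial, by rw [h1]; omega⟩
    · rw [htop, stackTop] at hw h1
      rw [hp1] at hw
      simp only [Option.some.injEq, Prod.mk.injEq] at hw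
      obtain ⟨rfl, rfl⟩ := hw
      obtain ⟨hcd', hwc', hyA'⟩ := hT.core hp1 hp2
      have hput := hT.put hy (other_le d c) hyA
      rw [htop, stackTop] at hput
      have hne : s₀ ≠ p.1 := (hmem p List.mem_cons_self).2.symm
      rcases coreRun_retrace hx₁ hxA hxZ hx hcl st f' _ p.2 c₁ hput (hT.absent_put hy hp1 _) hyA' hp2
        hcd' hp3 hp4 (hst.congr fun q hq => by
          rw [Table.put_of_ne]
          exact fun h0 => hnd.1 (h0 ▸ List.mem_map_of_mem hq)) hnd.2
        (fun q hq => hmem q (List.mem_cons_of_mem _ hq)) hs₀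
        (fun z c'' hz => by
          rw [Table.put_of_ne _ _ _ hne] at hz
          exact hs₀T z c'' hz)
        (fun t z c'' ht hz => by
          rw [Table.put_of_ne _ _ _ (fun h0 => ht (by rw [h0]; exact (hmem p List.mem_cons_self).1))] at hz
          exact hvs t z c'' ht hz) with hb | ⟨m, hm, hle⟩
      · exact Or.inl hb
      · exact Or.inr ⟨m, hm, by rw [h1, List.length_cons]; omega⟩

theorem other_other {i : ℕ} (hi : ¬ i < d - 1) (hid : i ≤ d) : other d (other d i) = i := by
  unfold other; split_ifs <;> omega

theorem Stacked.of_append {x₁ : U} {s₀ : Fin n} {T : Table n U} {st : List (Fin n × U)} :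
    ∀ {pre : List (Fin n × U)}, Stacked h d x₁ s₀ T (pre ++ st) → Stacked h d x₁ s₀ T st
  | [], hst => hst
  | _ :: _, hst => hst.2.2.of_append

/-- A run of core moves that has made a path, with the new key `x₁` at its bottom. -/
theorem coreRun_of_stacked {x₁ : U} {s₀ s₁ : Fin n} (hx₁A : x₁ ∈ A)
    (hjoin : Joins (coreEdge h d) x₁ s₁ s₀) (f : ℕ) :
    ∀ (p : Fin n × U) (st : List (Fin n × U)) (T : Table n U) (y : U) (c : ℕ),
      CoreWF h d A T → (∀ t c, T t ≠ some (y, c)) → y ∈ A → ¬ c < d - 1 → c ≤ d →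
      h y c = p.1 → Stacked h d x₁ s₀ T (p :: st) → ((p :: st).map Prod.fst).Nodup →
      ((p :: st).map Prod.snd).Nodup → s₀ ∉ (p :: st).map Prod.fst → x₁ ∈ (p :: st).map Prod.snd →
      (∀ ℓ, Closes (coreEdge h d) s₁ ℓ (A \ ((p :: st).map Prod.snd).toFinset.erase x₁) p.1
        ((p :: st).map Prod.fst) → Bicyclic (coreEdge h d) A) →
      (∀ ℓ, Trail (coreEdge h d) ℓ (A \ ((p :: st).map Prod.snd).toFinset) p.1 →
        Trail (coreEdge h d) (ℓ + st.length) (A.erase x₁) s₁) →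
      Bicyclic (coreEdge h d) A ∨ ∃ ℓ₁ ℓ₂, Trail (coreEdge h d) ℓ₁ (A.erase x₁) s₁ ∧
        Trail (coreEdge h d) ℓ₂ (A.erase x₁) s₀ ∧
        st.length + (coreRun h d f T y c).2 ≤ 2 * ℓ₁ + ℓ₂ := by
  -- The last two hypotheses carry the path walked so far: they turn a configuration, or a trail,
  -- that starts at the top slot into one that starts at `s₁`. The configuration may still use the
  -- edge `x₁`, which the path has not traversed.
  induction f with
  | zero =>
    intro p st T y c hT hy hyA hc hcd htop hst hnd hndk hs₀ hx₁ hF hTr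
    rcases coreRun_snd_eq_one_or (h := h) (d := d) 0 T y c with h1 | ⟨f', -, -, hf, -⟩
    · have hyk : y ∉ (p :: st).map Prod.snd := by
        intro hk
        obtain ⟨q, hq, rfl⟩ := List.mem_map.1 hk
        obtain ⟨c', hc'⟩ := hst.exists_of_mem q hq
        exact hy _ _ hc'
      refine Or.inr ⟨1 + st.length, 0, hTr 1 ⟨y, ?_, _, by
        have := joins_coreEdge (h := h) (z := y) hc hcd
        rwa [htop] at this, trivial⟩,
        trivial, by omega⟩
      rw [Finset.mem_sdiff, List.mem_toFinset]
      exact ⟨hyA, hyk⟩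
    · omega
  | succ f ih =>
    intro p st T y c hT hy hyA hc hcd htop hst hnd hndk hs₀ hx₁ hF hTr
    have hkeys : ∀ t z c, T t = some (z, c) → z ∈ (p :: st).map Prod.snd →
        t ∈ (p :: st).map Prod.fst := by
      intro t z c' ht hk
      obtain ⟨q, hq, rfl⟩ := List.mem_map.1 hk
      obtain ⟨c'', hc''⟩ := hst.exists_of_mem q hq
      rw [hT.inj ht hc'']
      exact List.mem_map_of_mem hq
    have hyk : y ∉ (p :: st).map Prod.snd := by
      intro hk
      obtain ⟨q, hq, rfl⟩ := List.mem_map.1 hk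
      obtain ⟨c', hc'⟩ := hst.exists_of_mem q hq
      exact hy _ _ hc'
    have hyx₁ : y ≠ x₁ := fun h0 => hyk (h0 ▸ hx₁)
    have hyA' : y ∈ A \ ((p :: st).map Prod.snd).toFinset := by
      rw [Finset.mem_sdiff, List.mem_toFinset]
      exact ⟨hyA, hyk⟩
    have hjy : Joins (coreEdge h d) y p.1 (h y (other d c)) := by
      have := joins_coreEdge (h := h) (z := y) hc hcd
      rwa [htop] at this
    have htr : Trail (coreEdge h d) (1 + st.length) (A.erase x₁) s₁ :=
      hTr 1 ⟨y, hyA', _, hjy, trivial⟩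
    rcases coreRun_snd_eq_one_or (h := h) (d := d) (f + 1) T y c with
      h1 | ⟨f', y', c', hf, hw, hc', h1⟩
    · exact Or.inr ⟨1 + st.length, 0, htr, trivial, by omega⟩
    obtain rfl : f = f' := by omega
    obtain ⟨hcd', hwc', hy'A⟩ := hT.core hw hc'
    have hput := hT.put hy (other_le d c) hyA
    have habs := hT.absent_put hy hw (other d c)
    rw [h1]
    set w := h y (other d c) with hwdef
    -- If `w` lies on the path, `y` closes a cycle and the keys from `w` downwards go back to their
    -- previous slots. The path is walked at most twice, whence the factor `2` of `ℓ₁`; the walk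
    -- then continues from `s₀`. For the bicyclic configuration the trail is read from the top of
    -- the path down to `s₀`, with `y` as the closing edge at its start.
    by_cases hwst : w ∈ (p :: st).map Prod.fst
    · obtain ⟨q, hq, hqw⟩ := List.mem_map.1 hwst
      obtain ⟨pre, post, hsplit⟩ := List.append_of_mem hq
      have hst' := hst
      rw [hsplit] at hst'
      obtain ⟨⟨cq, hq1, hq2, hq3⟩, hq4, hpost⟩ := hst'.of_append
      rw [hqw, hw] at hq1
      simp only [Option.some.injEq, Prod.mk.injEq] at hq1
      obtain ⟨hq1, rfl⟩ := hq1
      rw [← hq1] at hq3 hq4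
      have hnd' := hnd
      rw [hsplit, List.map_append, List.map_cons] at hnd'
      have hnd2 := (List.nodup_append.1 hnd').2.1
      rw [List.nodup_cons] at hnd2
      obtain ⟨hd1, hd2, hd3⟩ := subset_downList s₀ (p :: st) [p.1]
      have hslots : ∀ t ∈ (p :: st).map Prod.fst, t ∈ downList s₀ (p :: st) [p.1] := by
        intro t ht
        obtain ⟨r, hr, rfl⟩ := List.mem_map.1 ht
        rcases List.mem_cons.1 hr with rfl | hr
        · exact hd1 (by simp)
        · exact hd2 r hr
      have hocc : ∀ t z c'', t ∉ (p :: st).map Prod.fst →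
          T.put w y (other d c) t = some (z, c'') →
          z ∉ ((p :: st).map Prod.snd).toFinset ∧ z ≠ y := by
        intro t z c'' ht hz
        rw [Table.put_of_ne _ _ _ (fun h0 : t = w => ht (h0 ▸ hwst))] at hz
        exact ⟨fun hk => ht (hkeys t z c'' hz (List.mem_toFinset.1 hk)),
          fun h0 => hy t c'' (h0 ▸ hz)⟩
      rcases coreRun_retrace (h := h) (d := d) (A := A) (x₁ := x₁) (s₀ := s₀) (v₀ := p.1) (x₀ := y)
        (Z := ((p :: st).map Prod.snd).toFinset) (vs := downList s₀ (p :: st) [p.1])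
        (List.mem_toFinset.2 hx₁) hyA (fun hk => hyk (List.mem_toFinset.1 hk))
        ⟨w, hslots w hwst, hjy⟩ (fun ℓ hℓ => by
          obtain ⟨ℓ', hℓ'⟩ := closes_of_stacked (v₀ := p.1) hT (p :: st) ∅ [p.1] hst hndk (by simp)
            (by rwa [Finset.empty_union])
          exact ⟨p.1, ℓ', by rwa [Finset.sdiff_empty] at hℓ'⟩)
        post f _ y' c' hput habs hy'A hc' hcd' hq3 hq4
        (hpost.congr fun r hr => by
          rw [Table.put_of_ne]
          intro h0
          exact hnd2.1 (by rw [hqw, ← h0]; exact List.mem_map_of_mem hr))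
        hnd2.2
        (fun r hr => by
          have hr' : r ∈ p :: st := by rw [hsplit]; simp [hr]
          exact ⟨hslots _ (List.mem_map_of_mem hr'),
            fun h0 => hs₀ (h0 ▸ List.mem_map_of_mem hr')⟩)
        (hd3 (by simp)) (fun z c'' hz => hocc s₀ z c'' hs₀ hz)
        (fun t z c'' ht hz => hocc t z c'' (fun h0 => ht (hslots t h0)) hz) with hb | ⟨m, hm, hle⟩
      · exact Or.inl hb
      · refine Or.inr ⟨1 + st.length, m, htr, hm, ?_⟩
        have := congrArg List.length hsplit
        simp only [List.length_cons, List.length_append] at this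
        omega
    · have hy'k : y' ∉ (p :: st).map Prod.snd := fun hk => hwst (hkeys w y' c' hw hk)
      have hy'y : y' ≠ y := fun h0 => hy w c' (h0 ▸ hw)
      have hyF : y ∈ A \ ((p :: st).map Prod.snd).toFinset.erase x₁ := by
        simp only [Finset.mem_sdiff, Finset.mem_erase, List.mem_toFinset]
        exact ⟨hyA, fun h0 => hyk h0.2⟩
      have hsd : A \ insert y (((p :: st).map Prod.snd).toFinset.erase x₁) =
          (A \ ((p :: st).map Prod.snd).toFinset.erase x₁).erase y := by
        ext z; simp only [Finset.mem_sdiff, Finset.mem_insert, Finset.mem_erase]; tauto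
      -- At `s₀` the path closes a cycle through `x₁`, which joins `s₀` to the starting slot `s₁`.
      -- Here `x₁` is the reserved edge, so it is left out of the set of used keys.
      by_cases hws : w = s₀
      · rcases coreRun_of_closed (v₀ := s₁) (x₀ := x₁) f _ y' c'
          (insert y (((p :: st).map Prod.snd).toFinset.erase x₁)) (s₀ :: (p :: st).map Prod.fst)
          hput habs hy'A
          (by
            simp only [Finset.mem_insert, Finset.mem_erase, List.mem_toFinset, not_or]
            exact ⟨hy'y, fun h0 => hy'k h0.2⟩)
          (fun h0 => hy'k (h0 ▸ hx₁)) hc' hcd' hx₁A (by simp [Ne.symm hyx₁])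
          ⟨s₀, List.mem_cons_self, hjoin⟩
          (fun t z c'' ht hz => by
            simp only [List.mem_cons, not_or] at ht
            rw [Table.put_of_ne _ _ _ (fun h0 => ht.1 (h0.trans hws))] at hz
            have hz1 : z ∉ (p :: st).map Prod.snd := fun hk => by
              have := hkeys t z c'' hz hk
              simp only [List.map_cons, List.mem_cons] at this
              tauto
            simp only [Finset.mem_insert, Finset.mem_erase, List.mem_toFinset, not_or]
            exact ⟨⟨fun h0 => hy t c'' (h0 ▸ hz), fun h0 => hz1 h0.2⟩, fun h0 => hz1 (h0 ▸ hx₁)⟩)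
          (fun ℓ hℓ => hF (ℓ + 1) ⟨y, hyF, s₀, hws ▸ hjy, by rwa [hsd, hwc', hws] at hℓ⟩)
          with hb | ht
        · exact Or.inl hb
        · rw [hwc', hws] at ht
          exact Or.inr ⟨1 + st.length, _, htr, ht.mono fun z hz => by
            simp only [Finset.mem_erase, Finset.mem_sdiff] at hz ⊢
            exact ⟨hz.1, hz.2.1⟩, by rw [hws]; omega⟩
      · rcases ih (w, y) (p :: st) _ y' c' hput habs hy'A hc' hcd' hwc'
          ⟨⟨other d c, Table.put_self _ _ _ _, not_other_lt d c, by
            rw [other_other hc hcd]; exact htop⟩, by simp, hst.congr fun r hr => by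
              rw [Table.put_of_ne]
              exact fun h0 => hwst (h0 ▸ List.mem_map_of_mem hr)⟩
          (by rw [List.map_cons]; exact List.nodup_cons.2 ⟨hwst, hnd⟩)
          (by rw [List.map_cons]; exact List.nodup_cons.2 ⟨hyk, hndk⟩)
          (by
            rw [List.map_cons, List.mem_cons, not_or]
            exact ⟨Ne.symm hws, hs₀⟩)
          (by rw [List.map_cons]; exact List.mem_cons_of_mem _ hx₁)
          (fun ℓ hℓ => hF (ℓ + 1) ⟨y, hyF, w, hjy, by
            rw [List.map_cons, List.toFinset_cons, Finset.erase_insert_of_ne hyx₁, hsd] at hℓ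
            exact hℓ⟩)
          (fun ℓ hℓ => by
            have := hTr (ℓ + 1) ⟨y, hyA', w, hjy, by
              rw [List.map_cons, List.toFinset_cons] at hℓ
              convert hℓ using 1
              ext z; simp only [Finset.mem_sdiff, Finset.mem_insert, Finset.mem_erase]; tauto⟩
            rw [List.length_cons]
            convert this using 1
            omega) with hb | ⟨ℓ₁, ℓ₂, h2, h3, h4⟩
        · exact Or.inl hb
        · refine Or.inr ⟨ℓ₁, ℓ₂, h2, h3, ?_⟩
          rw [List.length_cons] at h4
          omega

/-- The number of moves of a promotion is bounded by lengths of trails from the two slots of the new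
core key, unless its edge completes a bicyclic component. -/
theorem promote_moves (L : ℕ) {T : Table n U} {x : U} (hT : CoreWF h d A T)
    (hx : ∀ t c, T t ≠ some (x, c)) (hxA : x ∈ A) :
    Bicyclic (coreEdge h d) A ∨ ∃ ℓ₁ ℓ₂, Trail (coreEdge h d) ℓ₁ (A.erase x) (h x (d - 1)) ∧
      Trail (coreEdge h d) ℓ₂ (A.erase x) (h x d) ∧
      (promote h d L T x).2 ≤ 1 + 2 * ℓ₁ + ℓ₂ := by
  unfold promote
  split
  · exact Or.inr ⟨0, 0, trivial, trivial, le_rfl⟩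
  next y c hw =>
  by_cases hc : c < d - 1
  · rw [if_pos hc]
    exact Or.inr ⟨0, 0, trivial, trivial, le_rfl⟩
  rw [if_neg hc]
  obtain ⟨hcd, hwc, hyA⟩ := hT.core hw hc
  have hput := hT.put hx (Nat.sub_le d 1) hxA
  have habs := hT.absent_put hx hw (d - 1)
  have hyx : y ≠ x := fun h0 => hx _ _ (h0 ▸ hw)
  have hjoin : Joins (coreEdge h d) x (h x (d - 1)) (h x d) := Or.inl rfl
  -- If the new edge is a loop, it is a closed cycle by itself, with `x` as the reserved edge.
  -- Otherwise the path starts with `x` as the only key on the stack.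
  by_cases hs : h x d = h x (d - 1)
  · rcases coreRun_of_closed (v₀ := h x (d - 1)) (x₀ := x) (L - 1) _ y c ∅ [h x (d - 1)] hput habs hyA
      (by simp) hyx hc hcd hxA (by simp) ⟨h x (d - 1), by simp, by rwa [hs] at hjoin⟩
      (fun t z c' ht hz => by
        simp only [List.mem_singleton] at ht
        rw [Table.put_of_ne _ _ _ ht] at hz
        exact ⟨by simp, fun h0 => hx t c' (h0 ▸ hz)⟩)
      (fun ℓ hℓ => ⟨h x (d - 1), ℓ, by rwa [hwc, Finset.sdiff_empty] at hℓ⟩) with hb | ht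
    · exact Or.inl hb
    · rw [hwc, Finset.sdiff_empty] at ht
      exact Or.inr ⟨_, 0, ht, trivial, by simp only; omega⟩
  · rcases coreRun_of_stacked hxA hjoin (L - 1) (h x (d - 1), x) [] _ y c hput habs hyA hc hcd hwc
      ⟨⟨d - 1, Table.put_self _ _ _ _, lt_irrefl _, by simp [other, stackTop]⟩, fun _ => rfl, trivial⟩
      (by simp) (by simp) (by simpa using hs) (by simp)
      (fun ℓ hℓ => ⟨h x (d - 1), ℓ, by simpa using hℓ⟩)
      (fun ℓ hℓ => by simpa [Finset.sdiff_singleton_eq_erase] using hℓ)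
      with hb | ⟨ℓ₁, ℓ₂, h2, h3, h4⟩
    · exact Or.inl hb
    · exact Or.inr ⟨ℓ₁, ℓ₂, h2, h3, by simp only [List.length_nil] at h4; simp only; omega⟩

/-- A failing run spends its whole allowance. This is what makes a failure imply a long walk. -/
theorem coreRun_snd_le (f : ℕ) : ∀ (T : Table n U) (y : U) (c : ℕ),
    (coreRun h d f T y c).2 ≤ f + 1 ∧
      ((coreRun h d f T y c).1 = none → (coreRun h d f T y c).2 = f + 1) := by
  induction f with
  | zero =>
    intro T y c
    rw [coreRun]
    split <;> simp
  | succ f ih =>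
    intro T y c
    rw [coreRun]
    split
    · simp
    · next y' c' _ =>
      by_cases hc : c' < d - 1
      · simp [hc]
      · obtain ⟨h1, h2⟩ := ih (T.put (h y (other d c)) y (other d c)) y' c'
        rw [if_neg hc]
        refine ⟨by simp only; omega, fun h0 => ?_⟩
        have := h2 h0
        simp only
        omega

theorem promote_snd_le {L : ℕ} (hL : 1 ≤ L) (T : Table n U) (x : U) :
    (promote h d L T x).2 ≤ L + 1 ∧
      ((promote h d L T x).1 = none → (promote h d L T x).2 = L + 1) := by
  unfold promote
  split
  · simp
  · next y c _ =>
    by_cases hc : c < d - 1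
    · simp [hc]
    · obtain ⟨h1, h2⟩ := coreRun_snd_le (h := h) (d := d) (L - 1) (T.put (h x (d - 1)) x (d - 1)) y c
      rw [if_neg hc]
      refine ⟨by simp only; omega, fun h0 => ?_⟩
      have := h2 h0
      simp only
      omega

/-- What a run of core moves does to the table `T`: it ends with a table `T'`, and either one more
slot is used, or a non-core key is evicted. -/
structure RunSpec (h : U → ℕ → Fin n) (d : ℕ) (A : Finset U) (T T' : Table n U)
    (o : Option (U × ℕ)) : Prop where
  wf : CoreWF h d A T'
  nonCore : ∀ {t z k}, k < d - 1 → T' t = some (z, k) → T t = some (z, k)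
  outcome : (o = none ∧ ∃ w, T w = none ∧ ∀ t, T' t = none ↔ T t = none ∧ t ≠ w) ∨
    ∃ y k, o = some (y, k) ∧ k < d - 1 ∧ (∃ t, T t = some (y, k)) ∧
      (∀ t c, T' t ≠ some (y, c)) ∧ ∀ t, T' t = none ↔ T t = none

theorem Table.put_eq_none {T : Table n U} {s t : Fin n} {x : U} {i : ℕ} :
    T.put s x i t = none ↔ T t = none ∧ t ≠ s := by
  by_cases ht : t = s
  · subst ht; simp [Table.put_self]
  · simp [Table.put_of_ne _ _ _ ht, ht]

theorem Table.put_nonCore {T : Table n U} {s t : Fin n} {x : U} {i : ℕ} {z : U} {k : ℕ}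
    (hi : ¬ i < d - 1) (hk : k < d - 1) (hz : T.put s x i t = some (z, k)) : T t = some (z, k) := by
  by_cases ht : t = s
  · subst ht
    rw [Table.put_self] at hz
    simp only [Option.some.injEq, Prod.mk.injEq] at hz
    omega
  · rwa [Table.put_of_ne _ _ _ ht] at hz

theorem runSpec_of_none {T : Table n U} (hT : CoreWF h d A T) {y : U}
    (hy : ∀ t c, T t ≠ some (y, c)) (hyA : y ∈ A) {i : ℕ} (hi : ¬ i < d - 1) (hid : i ≤ d)
    (hw : T (h y i) = none) : RunSpec h d A T (T.put (h y i) y i) none where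
  wf := hT.put hy hid hyA
  nonCore := Table.put_nonCore hi
  outcome := Or.inl ⟨rfl, _, hw, fun _ => Table.put_eq_none⟩

theorem runSpec_of_evict {T : Table n U} (hT : CoreWF h d A T) {y : U}
    (hy : ∀ t c, T t ≠ some (y, c)) (hyA : y ∈ A) {i : ℕ} (hi : ¬ i < d - 1) (hid : i ≤ d) {z : U}
    {k : ℕ} (hk : k < d - 1) (hw : T (h y i) = some (z, k)) :
    RunSpec h d A T (T.put (h y i) y i) (some (z, k)) where
  wf := hT.put hy hid hyA
  nonCore := Table.put_nonCore hi
  outcome := Or.inr ⟨z, k, rfl, hk, ⟨_, hw⟩, hT.absent_put hy hw _, fun t => by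
    rw [Table.put_eq_none]
    exact ⟨fun h0 => h0.1, fun h0 => ⟨h0, fun h1 => by rw [h1, hw] at h0; simp at h0⟩⟩⟩

/-- Replacing the key in an occupied slot leaves the set of free slots unchanged and, with a core
index, creates no new non-core entry. So the specification passes through each move of a run. -/
theorem RunSpec.of_put {T T' : Table n U} {y : U} {i : ℕ} (hi : ¬ i < d - 1) {z : U} {c : ℕ}
    (hw : T (h y i) = some (z, c)) {o : Option (U × ℕ)}
    (hs : RunSpec h d A (T.put (h y i) y i) T' o) : RunSpec h d A T T' o := by
  have hnone : ∀ t, T.put (h y i) y i t = none ↔ T t = none := fun t => by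
    rw [Table.put_eq_none]
    exact ⟨fun h0 => h0.1, fun h0 => ⟨h0, fun h1 => by rw [h1, hw] at h0; simp at h0⟩⟩
  refine ⟨hs.wf, fun hk hz => Table.put_nonCore hi hk (hs.nonCore hk hz), ?_⟩
  rcases hs.outcome with ⟨h1, w, h2, h3⟩ | ⟨z', k, h1, h2, ⟨t, h3⟩, h4, h5⟩
  · exact Or.inl ⟨h1, w, (hnone w).1 h2, fun t => by rw [h3, hnone]⟩
  · exact Or.inr ⟨z', k, h1, h2, ⟨t, Table.put_nonCore hi h2 h3⟩, h4, fun t => by rw [h5, hnone]⟩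

theorem coreRun_spec (f : ℕ) : ∀ {T : Table n U} {y : U} {c : ℕ} {T' : Table n U}
    {o : Option (U × ℕ)}, CoreWF h d A T → (∀ t c, T t ≠ some (y, c)) → y ∈ A →
    (coreRun h d f T y c).1 = some (T', o) → RunSpec h d A T T' o := by
  induction f with
  | zero =>
    intro T y c T' o hT hy hyA
    rw [coreRun]
    split
    · next hw =>
      rintro ⟨⟩
      exact runSpec_of_none hT hy hyA (not_other_lt d c) (other_le d c) hw
    · simp
  | succ f ih =>
    intro T y c T' o hT hy hyA
    rw [coreRun]
    split
    · next hw =>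
      rintro ⟨⟩
      exact runSpec_of_none hT hy hyA (not_other_lt d c) (other_le d c) hw
    · next z k hw =>
      by_cases hk : k < d - 1
      · rw [if_pos hk]
        rintro ⟨⟩
        exact runSpec_of_evict hT hy hyA (not_other_lt d c) (other_le d c) hk hw
      · rw [if_neg hk]
        intro h0
        exact (ih (hT.put hy (other_le d c) hyA) (hT.absent_put hy hw _) (hT.core hw hk).2.2 h0).of_put
          (not_other_lt d c) hw

theorem promote_spec {L : ℕ} {T : Table n U} {x : U} {T' : Table n U} {o : Option (U × ℕ)}
    (hT : CoreWF h d A T) (hx : ∀ t c, T t ≠ some (x, c)) (hxA : x ∈ A)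
    (hp : (promote h d L T x).1 = some (T', o)) : RunSpec h d A T T' o := by
  revert hp
  unfold promote
  split
  · next hw =>
    rintro ⟨⟩
    exact runSpec_of_none hT hx hxA (lt_irrefl _) (Nat.sub_le _ _) hw
  · next z k hw =>
    by_cases hk : k < d - 1
    · rw [if_pos hk]
      rintro ⟨⟩
      exact runSpec_of_evict hT hx hxA (lt_irrefl _) (Nat.sub_le _ _) hk hw
    · rw [if_neg hk]
      intro h0
      exact (coreRun_spec (L - 1) (hT.put hx (Nat.sub_le _ _) hxA) (hT.absent_put hx hw _)
        (hT.core hw hk).2.2 h0).of_put (lt_irrefl _) hw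

/-- Runs of core moves only look at the last two hashes of core keys. -/
theorem coreRun_congr {h' : U → ℕ → Fin n} (hh : ∀ z ∈ A, h z (d - 1) = h' z (d - 1) ∧ h z d = h' z d)
    (f : ℕ) : ∀ {T : Table n U} {y : U} {c : ℕ}, CoreWF h d A T → (∀ t c, T t ≠ some (y, c)) →
    y ∈ A → coreRun h d f T y c = coreRun h' d f T y c := by
  have hother : ∀ {z}, z ∈ A → ∀ c, h z (other d c) = h' z (other d c) := by
    intro z hz c
    unfold other
    split
    · exact (hh z hz).2
    · exact (hh z hz).1
  induction f with
  | zero =>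
    intro T y c hT hy hyA
    rw [coreRun, coreRun, hother hyA]
  | succ f ih =>
    intro T y c hT hy hyA
    rw [coreRun, coreRun, ← hother hyA]
    split
    · rfl
    · next z k hw =>
      by_cases hk : k < d - 1
      · rw [if_pos hk, if_pos hk]
      · rw [if_neg hk, if_neg hk, ih (hT.put hy (other_le d c) hyA) (hT.absent_put hy hw _)
          (hT.core hw hk).2.2]

theorem promote_congr {h' : U → ℕ → Fin n} (hh : ∀ z ∈ A, h z (d - 1) = h' z (d - 1) ∧ h z d = h' z d)
    (L : ℕ) {T : Table n U} {x : U} (hT : CoreWF h d A T) (hx : ∀ t c, T t ≠ some (x, c))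
    (hxA : x ∈ A) : promote h d L T x = promote h' d L T x := by
  unfold promote
  rw [← (hh x hxA).1]
  split
  · rfl
  · next z k hw =>
    by_cases hk : k < d - 1
    · rw [if_pos hk, if_pos hk]
    · rw [if_neg hk, if_neg hk, coreRun_congr hh (L - 1) (hT.put hx (Nat.sub_le _ _) hxA)
        (hT.absent_put hx hw _) (hT.core hw hk).2.2]

end Run

end BubbleUp

/-! ### Deferred decisions for processes that query a random function -/

namespace BubbleUp

open Finset
open scoped BigOperators

set_option linter.unusedSectionVars false

section Machine

variable {σ ι V : Type*} [Fintype ι] [DecidableEq ι] [Fintype V] [Nonempty V]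

/-- The state after `t` steps. -/
def iter (step : σ → (ι → V) → σ) (H : ι → V) : ℕ → σ → σ
  | 0, s => s
  | t + 1, s => iter step H t (step s H)

theorem iter_succ' (step : σ → (ι → V) → σ) (H : ι → V) (t : ℕ) : ∀ s,
    iter step H (t + 1) s = step (iter step H t s) H := by
  induction t with
  | zero => intro s; rfl
  | succ t ih => intro s; exact ih (step s H)

/-- A process that reveals coordinates of `H` step by step, and never the same coordinate twice: in
state `s`, the coordinates in `q s` are revealed, and `D s` contains the revealed ones. -/
structure Reveals (step : σ → (ι → V) → σ) (Inv : σ → Prop) (q D : σ → Finset ι) : Prop where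
  inv : ∀ {s} H, Inv s → Inv (step s H)
  congr : ∀ {s H H'}, Inv s → (∀ i ∈ q s, H i = H' i) → step s H = step s H'
  fresh : ∀ {s}, Inv s → Disjoint (q s) (D s)
  sub : ∀ {s} H, Inv s → D s ∪ q s ⊆ D (step s H)

variable {step : σ → (ι → V) → σ} {Inv : σ → Prop} {q D : σ → Finset ι}

theorem Reveals.inv_iter (hR : Reveals step Inv q D) (H : ι → V) (t : ℕ) {s : σ} (hs : Inv s) :
    Inv (iter step H t s) := by
  induction t generalizing s with
  | zero => exact hs
  | succ t ih => exact ih (hR.inv H hs)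

/-- Revealed coordinates are never read again, so the future depends on the unrevealed ones only. -/
theorem Reveals.iter_congr (hR : Reveals step Inv q D) {H H' : ι → V} (t : ℕ) : ∀ {s : σ}, Inv s →
    (∀ i ∉ D s, H i = H' i) → iter step H t s = iter step H' t s := by
  induction t with
  | zero => intro s _ _; rfl
  | succ t ih =>
    intro s hs hH
    have h1 : step s H = step s H' := hR.congr hs fun i hi =>
      hH i (Finset.disjoint_left.1 (hR.fresh hs) hi)
    rw [iter, iter, ← h1]
    exact ih (hR.inv H hs) fun i hi => hH i fun hi' => hi (hR.sub H hs (Finset.mem_union_left _ hi'))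

/-- Deferred decisions: every step may use a fresh copy of the random function. -/
theorem Reveals.expect_iter_succ (hR : Reveals step Inv q D) (t : ℕ) {s : σ} (hs : Inv s)
    (f : σ → ℝ) : 𝔼 H : ι → V, f (iter step H (t + 1) s) =
      𝔼 H' : ι → V, 𝔼 H : ι → V, f (iter step H t (step s H')) := by
  -- The queried coordinates are resampled: the first step reads only `H'`, and all later ones only
  -- `H`.
  rw [← expect_piecewise (q s), Finset.expect_comm]
  refine Finset.expect_congr rfl fun H' _ => Finset.expect_congr rfl fun H _ => ?_
  rw [iter]
  have h1 : step s ((q s).piecewise H' H) = step s H' := hR.congr hs fun i hi => by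
    rw [Finset.piecewise_eq_of_mem _ _ _ hi]
  rw [h1]
  congr 1
  refine hR.iter_congr t (hR.inv H' hs) fun i hi => ?_
  rw [Finset.piecewise_eq_of_notMem _ _ _ fun h0 => hi (hR.sub H' hs (Finset.mem_union_right _ h0))]

/-- A potential that does not increase on average in one step with a fresh random function is a
supermartingale for the process with a single one. -/
theorem Reveals.expect_le (hR : Reveals step Inv q D) {Φ : σ → ℝ}
    (hΦ : ∀ s, Inv s → 𝔼 H : ι → V, Φ (step s H) ≤ Φ s) (t : ℕ) : ∀ {s : σ}, Inv s →
    𝔼 H : ι → V, Φ (iter step H t s) ≤ Φ s := by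
  induction t with
  | zero =>
    intro s _
    exact (Finset.expect_const (univ_nonempty (α := ι → V)) (Φ s)).le
  | succ t ih =>
    intro s hs
    rw [hR.expect_iter_succ t hs]
    exact (Finset.expect_le_expect fun H' _ => ih (hR.inv H' hs)).trans (hΦ s hs)

end Machine

end BubbleUp

/-! ### The insertion process as a machine with one new probe per step, and its invariants -/

namespace BubbleUp

universe u v

open Finset
open scoped BigOperators

set_option linter.unusedSectionVars false

variable {n : ℕ} {U : Type u} [DecidableEq U]

/-- The state of the insertion process in front of the next probe of a slot whose number has not been
looked up before. -/
structure State (n : ℕ) (U : Type u) where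
  /-- the hash values, as far as they are known -/
  h : U → ℕ → Fin n
  /-- the table -/
  T : Table n U
  /-- the number of the current insertion -/
  k : ℕ
  /-- the homeless key -/
  y : U
  /-- the index of the last hash of the homeless key that was tried -/
  i : ℕ
  /-- the core keys, in the order in which they became core keys -/
  core : List U
  /-- the hashes, apart from the last one, that were looked up -/
  D : Finset (U × ℕ)
  /-- the number of probes during the last insertion -/
  N : ℕ
  /-- the time of the last insertion -/
  tm : ℕ
  /-- whether the process is still running -/
  run : Bool
  /-- whether an insertion has failed -/
  fail : Bool

/-- The function `h` with the value at `y, j` replaced. -/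
def setHash (h : U → ℕ → Fin n) (y : U) (j : ℕ) (a : Fin n) : U → ℕ → Fin n :=
  Function.update h y (Function.update (h y) j a)

theorem setHash_self (h : U → ℕ → Fin n) (y : U) (j : ℕ) (a : Fin n) : setHash h y j a y j = a := by
  simp [setHash]

theorem setHash_of_ne (h : U → ℕ → Fin n) {y z : U} (hz : z ≠ y) (j j' : ℕ) (a : Fin n) :
    setHash h y j a z j' = h z j' := by
  simp [setHash, Function.update_of_ne hz]

theorem setHash_of_ne' (h : U → ℕ → Fin n) (y z : U) {j j' : ℕ} (hj : j' ≠ j) (a : Fin n) :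
    setHash h y j a z j' = h z j' := by
  unfold setHash
  by_cases hz : z = y
  · subst hz; rw [Function.update_self, Function.update_of_ne hj]
  · rw [Function.update_of_ne hz]

namespace State

variable (d L M : ℕ) (x : ℕ → U)

/-- The state before the first of `M` insertions. -/
def init [NeZero n] : State n U where
  h := fun _ _ => 0
  T := fun _ => none
  k := 1
  y := x 1
  i := 0
  core := []
  D := ∅
  N := 0
  tm := 0
  run := true
  fail := false

/-- Go on to the next insertion, with the table `T'`. -/
def advance (s : State n U) (T' : Table n U) : State n U :=
  { s with T := T', k := s.k + 1, y := x (s.k + 1), i := 0, run := decide (s.k + 1 ≤ M) }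

/-- Look up the next hash of the homeless key. -/
def probed (s : State n U) (a : Fin n) : State n U :=
  { s with
    h := setHash s.h s.y (s.i + 1) a
    D := insert (s.y, s.i + 1) s.D
    N := s.N + if s.k = M then 1 else 0
    tm := s.tm + if s.k = M then 1 else 0 }

/-- Look up the last two hashes of the homeless key, and make it a core key. -/
def promoted (s : State n U) (a b : Fin n) : State n U :=
  { s with
    h := setHash (setHash s.h s.y (d - 1) a) s.y d b
    D := insert (s.y, s.i + 1) s.D
    core := s.core ++ [s.y]
    N := s.N + if s.k = M then 1 else 0
    tm := s.tm + if s.k = M then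
      (promote (setHash (setHash s.h s.y (d - 1) a) s.y d b) d L s.T s.y).2 else 0 }

/-- Go on after a run of core moves. -/
def finish (s : State n U) : Option (Table n U × Option (U × ℕ)) → State n U
  | none => { s with run := false, fail := true }
  | some (T', none) => s.advance M x T'
  | some (T', some (z, j)) => { s with T := T', y := z, i := j }

/-- The next state, if `a` is the next hash of the homeless key and `b` its last hash. -/
def next (s : State n U) (a b : Fin n) : State n U :=
  if s.run then
    if s.i + 1 < d - 1 then
      if s.T a = none then (s.probed M a).advance M x (s.T.put a s.y (s.i + 1))
      else { s.probed M a with i := s.i + 1 }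
    else
      (s.promoted d L M a b).finish M x (promote (s.promoted d L M a b).h d L s.T s.y).1
  else s

variable {d L M x}

theorem next_hit {s : State n U} (hs : s.run = true) (hi : s.i + 1 < d - 1) {a : Fin n}
    (ha : s.T a = none) (b : Fin n) :
    s.next d L M x a b = (s.probed M a).advance M x (s.T.put a s.y (s.i + 1)) := by
  rw [next, if_pos hs, if_pos hi, if_pos ha]

theorem next_miss {s : State n U} (hs : s.run = true) (hi : s.i + 1 < d - 1) {a : Fin n}
    (ha : s.T a ≠ none) (b : Fin n) :
    s.next d L M x a b = { s.probed M a with i := s.i + 1 } := by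
  rw [next, if_pos hs, if_pos hi, if_neg ha]

theorem next_promote {s : State n U} (hs : s.run = true) (hi : ¬ s.i + 1 < d - 1) (a b : Fin n) :
    s.next d L M x a b =
      (s.promoted d L M a b).finish M x (promote (s.promoted d L M a b).h d L s.T s.y).1 := by
  rw [next, if_pos hs, if_neg hi]

theorem next_halted {s : State n U} (hs : s.run = false) (a b : Fin n) :
    s.next d L M x a b = s := by
  rw [next, if_neg (by simp [hs])]

variable (M x) in
/-- The first `k` of the `M` keys. -/
def seen (k : ℕ) : Finset U := (Finset.Icc 1 (min k M)).image x

theorem seen_mono {k l : ℕ} (hkl : k ≤ l) : seen M x k ⊆ seen M x l := by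
  refine Finset.image_subset_image fun j hj => ?_
  simp only [Finset.mem_Icc] at hj ⊢
  omega

theorem mem_seen {k : ℕ} (hk : 1 ≤ k) (hkM : k ≤ M) : x k ∈ seen M x k :=
  Finset.mem_image_of_mem _ (by simp only [Finset.mem_Icc]; omega)

theorem notMem_seen (hx : Set.InjOn x (Set.Icc 1 M)) {k : ℕ} (hkM : k + 1 ≤ M) :
    x (k + 1) ∉ seen M x k := by
  intro h0
  obtain ⟨j, hj, hxj⟩ := Finset.mem_image.1 h0
  simp only [Finset.mem_Icc] at hj
  have := hx (x₁ := j) (x₂ := k + 1) ⟨by omega, by omega⟩ ⟨by omega, by omega⟩ hxj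
  omega

variable (d M x) in
/-- The invariants that concern the keys in the table and the hashes that were looked up. -/
structure WF (s : State n U) : Prop where
  core : CoreWF s.h d s.core.toFinset s.T
  nonCore : ∀ {t z j}, j < d - 1 → s.T t = some (z, j) → z ∉ s.core ∧ z ∈ seen M x s.k ∧
    ∀ j', (z, j') ∈ s.D ↔ 1 ≤ j' ∧ j' ≤ j
  coreD : ∀ z ∈ s.core, z ∈ seen M x s.k ∧ ∀ j', 1 ≤ j' → j' ≤ d - 1 → (z, j') ∈ s.D
  nodup : s.core.Nodup
  sub : ∀ p ∈ s.D, p.1 ∈ seen M x s.k ∧ 1 ≤ p.2 ∧ p.2 ≤ d - 1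
  free : (univ.filter fun t => s.T t = none).card + s.k = n + 1
  one_le : 1 ≤ s.k

variable (d M x) in
/-- The invariants that concern the homeless key. -/
structure Homeless (s : State n U) : Prop where
  le : s.k ≤ M
  seen : s.y ∈ seen M x s.k
  notMem : s.y ∉ s.core
  absent : ∀ t c, s.T t ≠ some (s.y, c)
  lt : s.i < d - 1
  looked : ∀ j', (s.y, j') ∈ s.D ↔ 1 ≤ j' ∧ j' ≤ s.i

variable (d L) in
/-- There is a trail that is so long that it may be the cause of a failure. -/
def LongTrail (s : State n U) : Prop :=
  ∃ v ℓ, L ≤ 3 * ℓ ∧ Trail (coreEdge s.h d) ℓ s.core.toFinset v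

variable (d L M x) in
/-- The invariants of the process. -/
structure Inv (s : State n U) : Prop where
  wf : s.WF d M x
  homeless : s.run = true → s.Homeless d M x
  le : s.k ≤ M + 1
  stopped : s.run = false → s.fail = false → s.k = M + 1
  cause : s.fail = true → s.run = false ∧
    (Bicyclic (coreEdge s.h d) s.core.toFinset ∨ s.LongTrail d L)
  zero : s.k < M → s.N = 0 ∧ s.tm = 0
  time_le : s.tm ≤ s.N * (L + 1)

theorem WF.of_setHash {s : State n U} (hs : s.WF d M x) (hh : s.Homeless d M x) (j : ℕ) (a : Fin n) :
    CoreWF (setHash s.h s.y j a) d s.core.toFinset s.T where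
  inj := hs.core.inj
  core := by
    intro t z c ht hc
    obtain ⟨h1, h2, h3⟩ := hs.core.core ht hc
    refine ⟨h1, ?_, h3⟩
    rw [setHash_of_ne]
    · exact h2
    · rintro rfl
      exact hh.absent _ _ ht

theorem mem_insert_iff_of_ne {s : State n U} {z : U} (hz : z ≠ s.y) (j : ℕ) :
    (z, j) ∈ insert (s.y, s.i + 1) s.D ↔ (z, j) ∈ s.D := by
  simp [hz]

theorem Homeless.mem_D_self {s : State n U} (hh : s.Homeless d M x) (j : ℕ) :
    (s.y, j) ∈ insert (s.y, s.i + 1) s.D ↔ 1 ≤ j ∧ j ≤ s.i + 1 := by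
  rw [Finset.mem_insert, hh.looked]
  simp only [Prod.mk.injEq, true_and]
  omega

theorem WF.sub_insert {s : State n U} (hs : s.WF d M x) (hh : s.Homeless d M x) :
    ∀ p ∈ insert (s.y, s.i + 1) s.D, p.1 ∈ State.seen M x s.k ∧ 1 ≤ p.2 ∧ p.2 ≤ d - 1 := by
  intro p hp
  rcases Finset.mem_insert.1 hp with rfl | hp
  · exact ⟨hh.seen, by simp, hh.lt⟩
  · exact hs.sub p hp

theorem WF.probed {s : State n U} (hs : s.WF d M x) (hh : s.Homeless d M x)
    (a : Fin n) : (s.probed M a).WF d M x where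
  core := hs.of_setHash hh _ _
  nonCore := by
    intro t z j hj ht
    obtain ⟨h1, h2, h3⟩ := hs.nonCore hj ht
    refine ⟨h1, h2, fun j' => ?_⟩
    have : z ≠ s.y := by rintro rfl; exact hh.absent _ _ ht
    exact (mem_insert_iff_of_ne this j').trans (h3 j')
  coreD := fun z hz => ⟨(hs.coreD z hz).1, fun j h1 h2 =>
    Finset.mem_insert_of_mem ((hs.coreD z hz).2 j h1 h2)⟩
  nodup := hs.nodup
  sub := hs.sub_insert hh
  free := hs.free
  one_le := hs.one_le

theorem WF.promoted {s : State n U} (hs : s.WF d M x) (hh : s.Homeless d M x)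
    (hi : ¬ s.i + 1 < d - 1) (a b : Fin n) : (s.promoted d L M a b).WF d M x where
  core := by
    refine ⟨hs.core.inj, fun {t z c} ht hc => ?_⟩
    obtain ⟨h1, h2, h3⟩ := hs.core.core ht hc
    have hz : z ≠ s.y := by rintro rfl; exact hh.absent _ _ ht
    refine ⟨h1, ?_, ?_⟩
    · simp only [State.promoted]
      rw [setHash_of_ne _ hz, setHash_of_ne _ hz, h2]
    · simp only [State.promoted, List.mem_toFinset, List.mem_append] at h3 ⊢
      exact Or.inl h3
  nonCore := by
    intro t z j hj ht
    obtain ⟨h1, h2, h3⟩ := hs.nonCore hj ht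
    have hz : z ≠ s.y := by rintro rfl; exact hh.absent _ _ ht
    refine ⟨by simp [State.promoted, h1, hz], h2, fun j' => ?_⟩
    exact (mem_insert_iff_of_ne hz j').trans (h3 j')
  coreD := by
    intro z hz
    simp only [State.promoted, List.mem_append, List.mem_singleton] at hz ⊢
    rcases hz with hz | rfl
    · exact ⟨(hs.coreD z hz).1, fun j h1 h2 => Finset.mem_insert_of_mem ((hs.coreD z hz).2 j h1 h2)⟩
    · refine ⟨hh.seen, fun j h1 h2 => (hh.mem_D_self j).2 ⟨h1, ?_⟩⟩
      omega
  nodup := by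
    simp only [State.promoted]
    exact List.Nodup.append hs.nodup (by simp) (by simp [hh.notMem])
  sub := hs.sub_insert hh
  free := hs.free
  one_le := hs.one_le

theorem card_free_of_fill {T T' : Table n U} {w : Fin n} (hw : T w = none)
    (hT : ∀ t, T' t = none ↔ T t = none ∧ t ≠ w) :
    (univ.filter fun t => T' t = none).card + 1 = (univ.filter fun t => T t = none).card := by
  have : (univ.filter fun t => T' t = none) = (univ.filter fun t => T t = none).erase w := by
    ext t
    simp only [Finset.mem_filter, Finset.mem_univ, true_and, Finset.mem_erase, hT]
    tauto
  rw [this, Finset.card_erase_add_one (by simp [hw])]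

/-- The result of a successful insertion. -/
theorem Inv.advance (hx : Set.InjOn x (Set.Icc 1 M)) (hd : 2 ≤ d) {s : State n U} {T' : Table n U}
    {w : Fin n} (hs : s.WF d M x) (hkM : s.k ≤ M) (hcore : CoreWF s.h d s.core.toFinset T')
    (hnc : ∀ {t z j}, j < d - 1 → T' t = some (z, j) → z ∉ s.core ∧ z ∈ seen M x s.k ∧
      ∀ j', (z, j') ∈ s.D ↔ 1 ≤ j' ∧ j' ≤ j)
    (hw : s.T w = none) (hT : ∀ t, T' t = none ↔ s.T t = none ∧ t ≠ w)
    (hf : s.fail = false) (hz : s.k < M → s.N = 0 ∧ s.tm = 0) (htm : s.tm ≤ s.N * (L + 1)) :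
    (s.advance M x T').Inv d L M x where
  wf :=
    { core := hcore
      nonCore := fun hj ht => ⟨(hnc hj ht).1, seen_mono (Nat.le_succ _) (hnc hj ht).2.1,
        (hnc hj ht).2.2⟩
      coreD := fun z hz => ⟨seen_mono (Nat.le_succ _) (hs.coreD z hz).1, (hs.coreD z hz).2⟩
      nodup := hs.nodup
      sub := fun p hp => ⟨seen_mono (Nat.le_succ _) (hs.sub p hp).1, (hs.sub p hp).2⟩
      free := by
        have h1 := card_free_of_fill hw hT
        have h2 := hs.free
        change (univ.filter fun t => T' t = none).card + (s.k + 1) = n + 1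
        omega
      one_le := Nat.le_add_left _ _ }
  homeless := by
    intro hr
    have hle : s.k + 1 ≤ M := by simpa [State.advance] using hr
    have hnot : ∀ z ∈ seen M x s.k, z ≠ x (s.k + 1) := fun z hz h0 =>
      notMem_seen hx hle (h0 ▸ hz)
    refine ⟨hle, mem_seen (by simp [State.advance]) hle, fun h0 => hnot _ (hs.coreD _ h0).1 rfl,
      fun t c h0 => ?_, by simp only [State.advance]; omega, fun j => ⟨fun h0 => ?_, fun h0 => ?_⟩⟩
    · by_cases hc : c < d - 1
      · exact hnot _ (hnc hc h0).2.1 rfl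
      · exact hnot _ (hs.coreD _ (List.mem_toFinset.1 (hcore.core h0 hc).2.2)).1 rfl
    · exact absurd rfl (hnot _ (hs.sub _ h0).1)
    · simp only [State.advance] at h0
      omega
  le := by simp only [State.advance]; omega
  stopped := by
    intro hr _
    simp only [State.advance, decide_eq_false_iff_not] at hr ⊢
    omega
  cause := fun h0 => by simp [State.advance, hf] at h0
  zero := fun h0 => hz (by simp only [State.advance] at h0; omega)
  time_le := htm

theorem Inv.fail_eq_false {s : State n U} (hs : s.Inv d L M x) (hr : s.run = true) :
    s.fail = false := by
  by_contra h0
  have := (hs.cause (by simpa using h0)).1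
  simp [hr] at this

theorem Inv.probed_count {s : State n U} (hs : s.Inv d L M x) (a : Fin n) :
    (s.k < M → (s.probed M a).N = 0 ∧ (s.probed M a).tm = 0) ∧
      (s.probed M a).tm ≤ (s.probed M a).N * (L + 1) := by
  have h1 := hs.zero
  have h2 := hs.time_le
  simp only [State.probed]
  refine ⟨fun h0 => ?_, ?_⟩
  · rw [if_neg (by omega)]
    exact h1 h0
  · split_ifs
    · rw [add_mul]; omega
    · simpa using h2

theorem Inv.promoted_count (hL : 1 ≤ L) {s : State n U} (hs : s.Inv d L M x) (a b : Fin n) :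
    (s.k < M → (s.promoted d L M a b).N = 0 ∧ (s.promoted d L M a b).tm = 0) ∧
      (s.promoted d L M a b).tm ≤ (s.promoted d L M a b).N * (L + 1) := by
  have h1 := hs.zero
  have h2 := hs.time_le
  simp only [State.promoted]
  refine ⟨fun h0 => ?_, ?_⟩
  · rw [if_neg (by omega), if_neg (by omega)]
    exact h1 h0
  · split_ifs
    · have := (promote_snd_le (h := setHash (setHash s.h s.y (d - 1) a) s.y d b) (d := d) hL
        s.T s.y).1
      rw [add_mul]; omega
    · simpa using h2

theorem mem_promoted_core (s : State n U) (a b : Fin n) :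
    s.y ∈ (s.promoted d L M a b).core.toFinset := by
  simp [State.promoted]

theorem promoted_erase {s : State n U} (hh : s.Homeless d M x) (a b : Fin n) :
    (s.promoted d L M a b).core.toFinset.erase s.y = s.core.toFinset := by
  ext z
  simp only [State.promoted, List.toFinset_append, Finset.mem_erase, Finset.mem_union,
    List.mem_toFinset, List.mem_singleton]
  constructor
  · rintro ⟨h1, h2 | h2⟩
    · exact h2
    · exact absurd h2 h1
  · intro h1
    exact ⟨fun h0 => hh.notMem (h0 ▸ h1), Or.inl h1⟩

theorem Inv.next (hx : Set.InjOn x (Set.Icc 1 M)) (hd : 2 ≤ d) (hL : 1 ≤ L) {s : State n U}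
    (hs : s.Inv d L M x) (a b : Fin n) : (s.next d L M x a b).Inv d L M x := by
  by_cases hr : s.run = true
  swap
  · rw [next_halted (by simpa using hr)]; exact hs
  have hh := hs.homeless hr
  have hf := hs.fail_eq_false hr
  by_cases hi : s.i + 1 < d - 1
  · have hwf := hs.wf.probed hh a
    obtain ⟨hc1, hc2⟩ := hs.probed_count a
    by_cases ha : s.T a = none
    · rw [next_hit hr hi ha]
      refine Inv.advance hx hd hwf hh.le ?_ ?_ (w := a) ha (fun t => Table.put_eq_none) hf hc1 hc2
      · refine ⟨fun {t t' z c c'} h1 h2 => ?_, fun {t z c} h1 hc => ?_⟩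
        · by_cases ht : t = a <;> by_cases ht' : t' = a
          · rw [ht, ht']
          · subst ht
            rw [Table.put_self] at h1
            rw [Table.put_of_ne _ _ _ ht'] at h2
            simp only [Option.some.injEq, Prod.mk.injEq] at h1
            exact absurd (h1.1 ▸ h2) (hh.absent _ _)
          · subst ht'
            rw [Table.put_self] at h2
            rw [Table.put_of_ne _ _ _ ht] at h1
            simp only [Option.some.injEq, Prod.mk.injEq] at h2
            exact absurd (h2.1 ▸ h1) (hh.absent _ _)
          · rw [Table.put_of_ne _ _ _ ht] at h1
            rw [Table.put_of_ne _ _ _ ht'] at h2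
            exact hs.wf.core.inj h1 h2
        · by_cases ht : t = a
          · subst ht
            rw [Table.put_self] at h1
            simp only [Option.some.injEq, Prod.mk.injEq] at h1
            omega
          · rw [Table.put_of_ne _ _ _ ht] at h1
            exact hwf.core.core h1 hc
      · intro t z j hj h1
        by_cases ht : t = a
        · subst ht
          rw [Table.put_self] at h1
          simp only [Option.some.injEq, Prod.mk.injEq] at h1
          obtain ⟨rfl, rfl⟩ := h1
          exact ⟨hh.notMem, hh.seen, fun j' => hh.mem_D_self j'⟩
        · rw [Table.put_of_ne _ _ _ ht] at h1
          exact hwf.nonCore hj h1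
    · rw [next_miss hr hi ha]
      exact
        { wf := ⟨hwf.core, hwf.nonCore, hwf.coreD, hwf.nodup, hwf.sub, hwf.free, hwf.one_le⟩
          homeless := fun _ => ⟨hh.le, hh.seen, hh.notMem, hh.absent, hi, fun j' => hh.mem_D_self j'⟩
          le := hs.le
          stopped := fun h0 => absurd (hr.symm.trans h0) (by simp)
          cause := fun h0 => absurd (hf.symm.trans h0) (by simp)
          zero := hc1
          time_le := hc2 }
  · rw [next_promote hr hi]
    have hwf := hs.wf.promoted (L := L) hh hi a b
    obtain ⟨hc1, hc2⟩ := hs.promoted_count hL a b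
    have hmem := mem_promoted_core (d := d) (L := L) (M := M) s a b
    rcases hp : (promote (s.promoted d L M a b).h d L s.T s.y).1 with _ | ⟨T', o⟩
    · simp only [finish]
      exact
        { wf := ⟨hwf.core, hwf.nonCore, hwf.coreD, hwf.nodup, hwf.sub, hwf.free, hwf.one_le⟩
          homeless := fun h0 => absurd h0 (by simp)
          le := hs.le
          stopped := fun _ h0 => absurd h0 (by simp)
          -- A failed promotion has made exactly `L + 1` moves, so `promote_moves` gives `L ≤ 2ℓ₁ +
          -- ℓ₂`, and the longer trail has at least `L/3` edges.
          cause := fun _ => ⟨rfl, by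
            rcases promote_moves L hwf.core hh.absent hmem with hb | ⟨ℓ₁, ℓ₂, h1, h2, h3⟩
            · exact Or.inl hb
            · right
              have h4 := (promote_snd_le hL s.T s.y).2 hp
              have hsub := Finset.erase_subset s.y (s.promoted d L M a b).core.toFinset
              change (promote (s.promoted d L M a b).h d L s.T s.y).2 ≤ _ at h3
              rcases le_total ℓ₁ ℓ₂ with h5 | h5
              · exact ⟨_, ℓ₂, by omega, h2.mono hsub⟩
              · exact ⟨_, ℓ₁, by omega, h1.mono hsub⟩⟩
          zero := hc1
          time_le := hc2 }
    · have hspec := promote_spec hwf.core hh.absent hmem hp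
      rcases hspec.outcome with ⟨rfl, w, hw, hT⟩ | ⟨z, j, rfl, hj, ⟨t, ht⟩, habs, hT⟩
      · exact Inv.advance hx hd hwf hh.le hspec.wf
          (fun hj ht => hwf.nonCore hj (hspec.nonCore hj ht)) hw hT hf hc1 hc2
      · simp only [finish]
        exact
          { wf := ⟨hspec.wf, fun hj ht => hwf.nonCore hj (hspec.nonCore hj ht), hwf.coreD, hwf.nodup,
              hwf.sub, by
                simp only [hT]
                exact hwf.free, hwf.one_le⟩
            homeless := fun _ => ⟨hh.le, (hwf.nonCore hj ht).2.1, (hwf.nonCore hj ht).1, habs, hj,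
              (hwf.nonCore hj ht).2.2⟩
            le := hs.le
            stopped := fun h0 => absurd (hr.symm.trans h0) (by simp)
            cause := fun h0 => absurd (hf.symm.trans h0) (by simp)
            zero := hc1
            time_le := hc2 }

theorem inv_init [NeZero n] (hd : 2 ≤ d) (hM : 1 ≤ M) : (init x : State n U).Inv d L M x where
  wf :=
    { core := ⟨fun h => by simp [init] at h, fun h => by simp [init] at h⟩
      nonCore := fun _ h => by simp [init] at h
      coreD := fun _ h => by simp [init] at h
      nodup := by simp [init]
      sub := fun _ h => by simp [init] at h
      free := by simp [init]
      one_le := le_rfl }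
  homeless := fun _ => ⟨hM, mem_seen le_rfl hM, by simp [init], by simp [init],
    by simp only [init]; omega, fun j => by simp only [init, Finset.notMem_empty, false_iff]; omega⟩
  le := by simp [init]
  stopped := fun h => by simp [init] at h
  cause := fun h => by simp [init] at h
  zero := fun _ => ⟨rfl, rfl⟩
  time_le := by simp [init]

end State

end BubbleUp

/-! ### The machine queries fresh hashes and reproduces `place` -/

namespace BubbleUp

universe u v

open Finset
open scoped BigOperators

set_option linter.unusedSectionVars false

variable {n : ℕ} {U : Type u} [DecidableEq U]

namespace State

variable {d L M : ℕ} {x : ℕ → U}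

theorem finish_eq (s : State n U) (o : Option (Table n U × Option (U × ℕ))) :
    (s.finish M x o).h = s.h ∧ (s.finish M x o).D = s.D ∧ (s.finish M x o).core = s.core ∧
      (s.finish M x o).N = s.N ∧ (s.finish M x o).tm = s.tm := by
  rcases o with _ | ⟨T', _ | ⟨z, j⟩⟩ <;> exact ⟨rfl, rfl, rfl, rfl, rfl⟩

theorem next_D {s : State n U} (hr : s.run = true) (a b : Fin n) :
    (s.next d L M x a b).D = insert (s.y, s.i + 1) s.D := by
  by_cases hi : s.i + 1 < d - 1
  · by_cases ha : s.T a = none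
    · rw [next_hit hr hi ha]; rfl
    · rw [next_miss hr hi ha]; rfl
  · rw [next_promote hr hi, (finish_eq _ _).2.1]; rfl

theorem next_N {s : State n U} (hr : s.run = true) (a b : Fin n) :
    (s.next d L M x a b).N = s.N + if s.k = M then 1 else 0 := by
  by_cases hi : s.i + 1 < d - 1
  · by_cases ha : s.T a = none
    · rw [next_hit hr hi ha]; rfl
    · rw [next_miss hr hi ha]; rfl
  · rw [next_promote hr hi, (finish_eq _ _).2.2.2.1]; rfl

theorem next_probe_eq {s : State n U} (hr : s.run = true) (hi : s.i + 1 < d - 1) (a b : Fin n) :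
    (s.next d L M x a b).core = s.core ∧
      (s.next d L M x a b).h = setHash s.h s.y (s.i + 1) a ∧
      (s.next d L M x a b).tm = s.tm + if s.k = M then 1 else 0 := by
  by_cases ha : s.T a = none
  · rw [next_hit hr hi ha]; exact ⟨rfl, rfl, rfl⟩
  · rw [next_miss hr hi ha]; exact ⟨rfl, rfl, rfl⟩

theorem next_promote_eq {s : State n U} (hr : s.run = true) (hi : ¬ s.i + 1 < d - 1) (a b : Fin n) :
    (s.next d L M x a b).core = s.core ++ [s.y] ∧
      (s.next d L M x a b).h = setHash (setHash s.h s.y (d - 1) a) s.y d b ∧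
      (s.next d L M x a b).tm = s.tm + if s.k = M then
        (promote (setHash (setHash s.h s.y (d - 1) a) s.y d b) d L s.T s.y).2 else 0 := by
  rw [next_promote hr hi, (finish_eq _ _).1, (finish_eq _ _).2.2.1, (finish_eq _ _).2.2.2.2]
  exact ⟨rfl, rfl, rfl⟩

variable (d M x) in
/-- The indices of the hash values that matter for the first `M` insertions. -/
def hashes : Finset (U × ℕ) := (Finset.Icc 1 M).image x ×ˢ Finset.Icc 1 d

/-- The value of the `j`-th hash of `y`. -/
def look [NeZero n] (H : hashes d M x → Fin n) (y : U) (j : ℕ) : Fin n :=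
  if hp : (y, j) ∈ hashes d M x then H ⟨(y, j), hp⟩ else 0

variable (d L M x) in
/-- One step of the process, with hash function `H`. -/
def step [NeZero n] (s : State n U) (H : hashes d M x → Fin n) : State n U :=
  s.next d L M x (look H s.y (s.i + 1)) (look H s.y d)

variable (d M x) in
/-- The hashes that are looked up in the next step. -/
def queries (s : State n U) : Finset (hashes d M x) :=
  univ.filter fun p => s.run = true ∧
    (p.1 = (s.y, s.i + 1) ∨ ¬ s.i + 1 < d - 1 ∧ p.1 = (s.y, d))

variable (d M x) in
/-- The hashes that were looked up. -/
def looked (s : State n U) : Finset (hashes d M x) :=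
  univ.filter fun p => p.1 ∈ s.D ∨ p.1.2 = d ∧ p.1.1 ∈ s.core

theorem mem_hashes_of_seen {k : ℕ} {y : U} (hy : y ∈ seen M x k) {j : ℕ} (h1 : 1 ≤ j) (h2 : j ≤ d) :
    (y, j) ∈ hashes d M x := by
  refine Finset.mem_product.2 ⟨?_, Finset.mem_Icc.2 ⟨h1, h2⟩⟩
  refine Finset.image_subset_image (fun i hi => ?_) hy
  simp only [Finset.mem_Icc] at hi ⊢
  omega

theorem next_congr_right {s : State n U} (hi : s.i + 1 < d - 1) (a b b' : Fin n) :
    s.next d L M x a b = s.next d L M x a b' := by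
  unfold next
  simp only [if_pos hi]

/-- For a homeless key precisely the hashes up to its index are known, since a non-core key resumes
where it stopped. Hash `d` is read only at the promotion, and a core key is never promoted again.
Hence no hash is queried twice. -/
theorem reveals [NeZero n] (hx : Set.InjOn x (Set.Icc 1 M)) (hd : 2 ≤ d) (hL : 1 ≤ L) :
    Reveals (step (n := n) d L M x) (Inv d L M x) (queries d M x) (looked d M x) where
  inv := fun H hs => hs.next hx hd hL _ _
  congr := by
    intro s H H' hs hH
    by_cases hr : s.run = true
    swap
    · rw [step, step, next_halted (by simpa using hr), next_halted (by simpa using hr)]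
    have hh := hs.homeless hr
    have h1 : look H s.y (s.i + 1) = look H' s.y (s.i + 1) := by
      unfold look
      split_ifs with hp
      · exact hH _ (by simp [queries, hr])
      · rfl
    unfold step
    rw [h1]
    by_cases hi : s.i + 1 < d - 1
    · exact next_congr_right hi _ _ _
    · have h2 : look H s.y d = look H' s.y d := by
        unfold look
        split_ifs with hp
        · refine hH _ ?_
          simp only [queries, Finset.mem_filter, Finset.mem_univ, true_and]
          exact ⟨hr, Or.inr ⟨hi, trivial⟩⟩
        · rfl
      rw [h2]
  fresh := by
    intro s hs
    rw [Finset.disjoint_left]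
    rintro ⟨⟨z, j⟩, hp⟩ hq hl
    simp only [queries, looked, Finset.mem_filter, Finset.mem_univ, true_and] at hq hl
    obtain ⟨hr, hq⟩ := hq
    have hh := hs.homeless hr
    have h1 := hh.lt
    rcases hq with hq | ⟨hi, hq⟩
    · obtain ⟨rfl, rfl⟩ := Prod.mk.inj hq
      rcases hl with hl | ⟨hl, -⟩
      · have := (hh.looked _).1 hl
        omega
      · omega
    · obtain ⟨rfl, rfl⟩ := Prod.mk.inj hq
      rcases hl with hl | ⟨-, hl⟩
      · have := (hs.wf.sub _ hl).2.2
        simp only at this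
        omega
      · exact hh.notMem hl
  sub := by
    intro s H hs
    by_cases hr : s.run = true
    · rintro ⟨⟨z, j⟩, hp⟩ hq
      simp only [queries, looked, Finset.mem_filter, Finset.mem_univ, true_and, Finset.mem_union,
        step, next_D hr] at hq ⊢
      by_cases hi : s.i + 1 < d - 1
      · rw [(next_probe_eq hr hi _ _).1, Finset.mem_insert]
        tauto
      · rw [(next_promote_eq hr hi _ _).1, Finset.mem_insert, List.mem_append, List.mem_singleton]
        rcases hq with hq | ⟨-, hq | ⟨-, hq⟩⟩
        · tauto
        · tauto
        · obtain ⟨rfl, rfl⟩ := Prod.mk.inj hq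
          tauto
    · rw [step, next_halted (by simpa using hr)]
      have : queries d M x s = ∅ := by simp [queries, hr]
      rw [this, Finset.union_empty]

/-- The hashes `i + 1 ≤ d - 1` and `d` of the homeless key are distinct coordinates, so their values
form a uniform pair. -/
theorem expect_step [NeZero n] (hd : 2 ≤ d) {s : State n U} (hs : s.Inv d L M x)
    (hr : s.run = true) (φ : State n U → ℝ) :
    𝔼 H : hashes d M x → Fin n, φ (s.step d L M x H) = 𝔼 a, 𝔼 b, φ (s.next d L M x a b) := by
  have hh := hs.homeless hr
  have h1 := hh.lt
  have hp : (s.y, s.i + 1) ∈ hashes d M x := mem_hashes_of_seen hh.seen (by omega) (by omega)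
  have hp' : (s.y, d) ∈ hashes d M x := mem_hashes_of_seen hh.seen (by omega) le_rfl
  rw [← expect_apply_apply (ι := hashes d M x) (α := Fin n) (k := ⟨_, hp⟩) (l := ⟨_, hp'⟩)
    (by simp only [ne_eq, Subtype.mk.injEq, Prod.mk.injEq, true_and]; omega)]
  refine Finset.expect_congr rfl fun H _ => ?_
  rw [step, look, look, dif_pos hp, dif_pos hp']

/-- Every running step adds one new entry to `D`, which bounds the number of steps by the number of
relevant hashes. -/
theorem iter_run [NeZero n] (hx : Set.InjOn x (Set.Icc 1 M)) (hd : 2 ≤ d) (hL : 1 ≤ L) (hM : 1 ≤ M)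
    (H : hashes d M x → Fin n) (t : ℕ) (hr : (iter (step d L M x) H t (init x)).run = true) :
    (iter (step d L M x) H t (init x)).D.card = t := by
  have hR := reveals (n := n) hx hd hL
  induction t with
  | zero => simp [iter, init]
  | succ t ih =>
    have hs := hR.inv_iter H t (inv_init hd hM)
    rw [iter_succ'] at hr ⊢
    set s := iter (step d L M x) H t (init x) with hsdef
    have hr' : s.run = true := by
      by_contra h0
      rw [step, next_halted (by simpa using h0)] at hr
      exact h0 hr
    rw [step, next_D hr', Finset.card_insert_of_notMem, ih hr']
    intro h0
    have := ((hs.homeless hr').looked _).1 h0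
    omega

theorem iter_halted [NeZero n] (hx : Set.InjOn x (Set.Icc 1 M)) (hd : 2 ≤ d) (hL : 1 ≤ L)
    (hM : 1 ≤ M) (H : hashes d M x → Fin n) :
    (iter (step d L M x) H ((hashes d M x).card + 1) (init x)).run = false := by
  by_contra h0
  have h1 := iter_run hx hd hL hM H _ (by simpa using h0)
  have hs := (reveals (n := n) hx hd hL).inv_iter H ((hashes d M x).card + 1) (inv_init hd hM)
  have h2 := Finset.card_le_card (s := (iter (step d L M x) H ((hashes d M x).card + 1) (init x)).D)
    (t := hashes d M x) fun p hp => by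
      obtain ⟨h3, h4, h5⟩ := hs.wf.sub p hp
      exact mem_hashes_of_seen h3 h4 (h5.trans (Nat.sub_le _ _))
  omega

section Simulation

variable (d L M x) (g : U → ℕ → Fin n)

/-- The table after the last insertion, predicted from the state `s`. -/
def finalTable (s : State n U) : Option (Table n U) :=
  if s.run then (place g d L s.T s.y s.i 0).1.bind (further d L x g (M - s.k) s.k)
  else if s.fail then none else some s.T

/-- The time of the last insertion, predicted from the state `s`. -/
def finalTime (s : State n U) : ℕ :=
  if s.run then
    if s.k = M then s.tm + (place g d L s.T s.y s.i 0).2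
    else ((place g d L s.T s.y s.i 0).1.bind (further d L x g (M - 1 - s.k) s.k)).elim 0
      fun T => (place g d L T (x M) 0 0).2
  else s.tm

variable {d L M x g}

theorem finalTable_of_run {s : State n U} (hr : s.run = true) : finalTable d L M x g s =
    (place g d L s.T s.y s.i 0).1.bind (further d L x g (M - s.k) s.k) := if_pos hr

theorem finalTime_of_run {s : State n U} (hr : s.run = true) : finalTime d L M x g s =
    if s.k = M then s.tm + (place g d L s.T s.y s.i 0).2
    else ((place g d L s.T s.y s.i 0).1.bind (further d L x g (M - 1 - s.k) s.k)).elim 0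
      fun T => (place g d L T (x M) 0 0).2 := if_pos hr

theorem final_advance {s : State n U} (hk : s.k ≤ M) (hf : s.fail = false)
    (htm : s.k < M → s.tm = 0) (T' : Table n U) :
    finalTable d L M x g (s.advance M x T') = further d L x g (M - s.k) s.k T' ∧
      finalTime d L M x g (s.advance M x T') = if s.k = M then s.tm else
        (further d L x g (M - 1 - s.k) s.k T').elim 0 fun T => (place g d L T (x M) 0 0).2 := by
  unfold finalTable finalTime
  by_cases hkM : s.k = M
  · have h1 : (s.advance M x T').run = false := by simp [advance, hkM]
    have h2 : (s.advance M x T').fail = false := hf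
    rw [h1, h2, hkM]
    simp [further, advance]
  · have h1 : (s.advance M x T').run = true := by
      simp only [advance, decide_eq_true_eq]; omega
    rw [h1]
    obtain ⟨m, rfl⟩ : ∃ m, M = s.k + 1 + m := ⟨M - s.k - 1, by omega⟩
    have e1 : s.k + 1 + m - s.k = m + 1 := by omega
    have e2 : s.k + 1 + m - (s.k + 1) = m := by omega
    have e3 : s.k + 1 + m - 1 - s.k = m := by omega
    have htm' := htm (by omega)
    simp only [if_true, hkM, if_false]
    refine ⟨?_, ?_⟩
    · simp only [advance, e1, e2]
      rfl
    -- For `m = 0` the insertion that starts now is the timed one, and its clock still shows `0`.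
    · rcases m with _ | m
      · simp [advance, htm', further]
      · have e4 : s.k + 1 + (m + 1) - 1 - (s.k + 1) = m := by omega
        have e5 : ¬ s.k + 1 = s.k + 1 + (m + 1) := by omega
        simp only [advance, e3, e4, e5, if_false]
        rfl

/-- In every step the known hashes remain correct and the predictions do not change. -/
theorem next_final {s : State n U} (hs : s.Inv d L M x) 
    (hg : ∀ z ∈ s.core, s.h z (d - 1) = g z (d - 1) ∧ s.h z d = g z d) :
    (∀ z ∈ (s.next d L M x (g s.y (s.i + 1)) (g s.y d)).core,
      (s.next d L M x (g s.y (s.i + 1)) (g s.y d)).h z (d - 1) = g z (d - 1) ∧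
      (s.next d L M x (g s.y (s.i + 1)) (g s.y d)).h z d = g z d) ∧
    finalTable d L M x g (s.next d L M x (g s.y (s.i + 1)) (g s.y d)) = finalTable d L M x g s ∧
    finalTime d L M x g (s.next d L M x (g s.y (s.i + 1)) (g s.y d)) = finalTime d L M x g s := by
  by_cases hr : s.run = true
  swap
  · rw [next_halted (by simpa using hr)]; exact ⟨hg, rfl, rfl⟩
  have hh := hs.homeless hr
  have hf := hs.fail_eq_false hr
  have hlt := hh.lt
  set a := g s.y (s.i + 1) with ha
  set b := g s.y d with hb
  by_cases hi : s.i + 1 < d - 1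
  · refine ⟨fun z hz => ?_, ?_⟩
    · obtain ⟨h1, h2, -⟩ := next_probe_eq (L := L) (M := M) (x := x) hr hi a b
      rw [h1] at hz
      have hzy : z ≠ s.y := fun h0 => hh.notMem (h0 ▸ hz)
      rw [h2, setHash_of_ne _ hzy, setHash_of_ne _ hzy]
      exact hg z hz
    · have hp := place_of_probe g d L s.T s.y 0 hi
      rw [← ha] at hp
      by_cases hTa : s.T a = none
      · rw [if_pos hTa] at hp
        rw [next_hit hr hi hTa]
        obtain ⟨h1, h2⟩ := final_advance (d := d) (L := L) (x := x) (g := g) (s := s.probed M a)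
          hh.le hf (fun h0 => ((hs.probed_count a).1 h0).2) (s.T.put a s.y (s.i + 1))
        rw [h1, h2]
        unfold finalTable finalTime
        rw [if_pos hr, if_pos hr, hp]
        refine ⟨rfl, ?_⟩
        simp only [probed, Option.bind_some]
        split_ifs <;> rfl
      · rw [if_neg hTa] at hp
        rw [next_miss hr hi hTa]
        rw [finalTable_of_run hr, finalTime_of_run hr, hp,
          finalTable_of_run (s := { s.probed M a with i := s.i + 1 }) hr,
          finalTime_of_run (s := { s.probed M a with i := s.i + 1 }) hr]
        refine ⟨rfl, ?_⟩
        simp only [probed]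
        split_ifs
        · ring
        · rfl
  · have hid : s.i + 1 = d - 1 := by omega
    have hwf := hs.wf.promoted (L := L) hh hi a b
    have hmem := mem_promoted_core (d := d) (L := L) (M := M) s a b
    have hg' : ∀ z ∈ (s.promoted d L M a b).core.toFinset,
        (s.promoted d L M a b).h z (d - 1) = g z (d - 1) ∧ (s.promoted d L M a b).h z d = g z d := by
      intro z hz
      simp only [promoted, List.mem_toFinset, List.mem_append, List.mem_singleton] at hz ⊢
      by_cases hzy : z = s.y
      · subst hzy
        rw [setHash_self, setHash_of_ne' _ _ _ (by omega), setHash_self, ← hid]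
        exact ⟨rfl, rfl⟩
      · rw [setHash_of_ne _ hzy, setHash_of_ne _ hzy, setHash_of_ne _ hzy, setHash_of_ne _ hzy]
        exact hg z (hz.resolve_right hzy)
    have hp := place_of_last g d L s.T s.y 0 hid
    -- The state knows `g` only in part, but a promotion reads no more than the last two hashes of
    -- core keys.
    rw [← (promote_congr hg' L hwf.core hh.absent hmem : promote _ d L s.T s.y = _)] at hp
    rw [next_promote hr hi]
    refine ⟨fun z hz => ?_, ?_⟩
    · rw [(finish_eq _ _).2.2.1] at hz
      rw [(finish_eq _ _).1]
      exact hg' z (List.mem_toFinset.2 hz)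
    · have htm : (s.promoted d L M a b).tm = s.tm + if s.k = M then
        (promote (s.promoted d L M a b).h d L s.T s.y).2 else 0 := rfl
      rcases hpo : promote (s.promoted d L M a b).h d L s.T s.y with ⟨_ | ⟨T', _ | ⟨z, j⟩⟩, c⟩
      · rw [hpo] at hp htm
        simp only [resume] at hp
        unfold finalTable finalTime
        rw [if_pos hr, if_pos hr, hp]
        simp only [finish, htm]
        refine ⟨rfl, ?_⟩
        by_cases hk : s.k = M
        · simp [hk]
        · simp [hk, (hs.zero (lt_of_le_of_ne hh.le hk)).2]
      · rw [hpo] at hp htm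
        simp only [resume] at hp
        obtain ⟨h1, h2⟩ := final_advance (d := d) (L := L) (x := x) (g := g)
          (s := s.promoted d L M a b) hh.le hf (fun h0 => by
            have h0 : s.k < M := h0
            rw [htm, if_neg (by omega), (hs.zero h0).2]) T'
        simp only [finish]
        rw [h1, h2]
        unfold finalTable finalTime
        rw [if_pos hr, if_pos hr, hp, htm]
        refine ⟨rfl, ?_⟩
        change (if s.k = M then _ else _) = _
        split_ifs <;> rfl
      · rw [hpo] at hp htm
        simp only [resume] at hp
        simp only [finish]
        rw [finalTable_of_run hr, finalTime_of_run hr, hp,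
          finalTable_of_run (s := { s.promoted d L M a b with T := T', y := z, i := j }) hr,
          finalTime_of_run (s := { s.promoted d L M a b with T := T', y := z, i := j }) hr]
        refine ⟨rfl, ?_⟩
        change (if s.k = M then (s.promoted d L M a b).tm + _ else _) = _
        rw [htm]
        split_ifs
        · simp only; ring
        · rfl

theorem iter_final [NeZero n] (hx : Set.InjOn x (Set.Icc 1 M)) (hd : 2 ≤ d) (hL : 1 ≤ L)
    {H : hashes d M x → Fin n} (hH : ∀ p, H p = g p.1.1 p.1.2) (t : ℕ) {s : State n U}
    (hs : s.Inv d L M x) (hg : ∀ z ∈ s.core, s.h z (d - 1) = g z (d - 1) ∧ s.h z d = g z d) :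
    finalTable d L M x g (iter (step d L M x) H t s) = finalTable d L M x g s ∧
    finalTime d L M x g (iter (step d L M x) H t s) = finalTime d L M x g s := by
  induction t generalizing s with
  | zero => exact ⟨rfl, rfl⟩
  | succ t ih =>
    have hstep : s.step d L M x H = s.next d L M x (g s.y (s.i + 1)) (g s.y d) := by
      by_cases hr : s.run = true
      swap
      · rw [step, next_halted (by simpa using hr), next_halted (by simpa using hr)]
      have hh := hs.homeless hr
      have h1 := hh.lt
      rw [step, look, look, dif_pos (mem_hashes_of_seen hh.seen (by omega) (by omega)),
        dif_pos (mem_hashes_of_seen hh.seen (by omega) le_rfl), hH, hH]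
    obtain ⟨h1, h2, h3⟩ := next_final hs hg
    rw [← hstep] at h1 h2 h3
    obtain ⟨h4, h5⟩ := ih (hs.next hx hd hL _ _) h1
    exact ⟨h4.trans h2, h5.trans h3⟩

theorem final_init [NeZero n] (hM : 1 ≤ M) :
    finalTable d L M x g (init x) = tableAfter g d L x M ∧
      finalTime d L M x g (init x) = insertionTime g d L x M := by
  unfold finalTable finalTime insertionTime
  obtain ⟨m, rfl⟩ : ∃ m, M = 1 + m := ⟨M - 1, by omega⟩
  refine ⟨?_, ?_⟩
  · rw [tableAfter_add]
    simp [init, tableAfter]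
  · rcases m with _ | m
    · simp [init, tableAfter]
    · have h1 : 1 + (m + 1) - 1 = 1 + m := by omega
      rw [h1, tableAfter_add]
      simp [init, tableAfter]

variable (d L M x) in
/-- The final state of the process. -/
noncomputable def last [NeZero n] (H : hashes d M x → Fin n) : State n U :=
  iter (step d L M x) H ((hashes d M x).card + 1) (init x)

/-- The predictions `finalTable` and `finalTime` are constant along the process. At the start they
are the quantities of the policy, and in the halted state they can be read off. -/
theorem last_spec [NeZero n] (hx : Set.InjOn x (Set.Icc 1 M)) (hd : 2 ≤ d) (hL : 1 ≤ L) (hM : 1 ≤ M)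
    {H : hashes d M x → Fin n} (hH : ∀ p, H p = g p.1.1 p.1.2) :
    (tableAfter g d L x M = none ↔ (last d L M x H).fail = true) ∧
      insertionTime g d L x M = (last d L M x H).tm := by
  obtain ⟨h1, h2⟩ := iter_final (g := g) hx hd hL hH ((hashes d M x).card + 1)
    (inv_init (n := n) (L := L) hd hM) (fun z hz => by simp [init] at hz)
  obtain ⟨h3, h4⟩ := final_init (d := d) (L := L) (x := x) (g := g) hM
  rw [h3] at h1
  rw [h4] at h2
  have hr := iter_halted (L := L) hx hd hL hM H
  change (last d L M x H).run = false at hr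
  rw [← h1, ← h2]
  change (finalTable d L M x g (last d L M x H) = none ↔ _) ∧
    finalTime d L M x g (last d L M x H) = _
  unfold finalTable finalTime
  rw [hr]
  simp

end Simulation

end State

end BubbleUp

/-! ### Successful insertions preserve the cuckoo table property -/

namespace BubbleUp

universe u v

open Finset
open scoped BigOperators

set_option linter.unusedSectionVars false

variable {n : ℕ} {U : Type u}

theorem IsCuckooTable.put {h : U → ℕ → Fin n} {d : ℕ} {T : Table n U} {S : Set U}
    (hT : IsCuckooTable h d T S) {x : U} (hx : x ∉ S) {i : ℕ} (hi : 1 ≤ i) (hid : i ≤ d) :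
    IsCuckooTable h d (T.put (h x i) x i) (insert x {z ∈ S | ∀ k, T (h x i) ≠ some (z, k)}) := by
  obtain ⟨h1, h2⟩ := hT
  refine ⟨fun t z j ht => ?_, fun z hz => ?_⟩
  · by_cases hts : t = h x i
    · subst hts
      rw [Table.put_self] at ht
      simp only [Option.some.injEq, Prod.mk.injEq] at ht
      obtain ⟨rfl, rfl⟩ := ht
      exact ⟨Set.mem_insert _ _, hi, hid, rfl⟩
    · rw [Table.put_of_ne _ _ _ hts] at ht
      obtain ⟨h3, h4⟩ := h1 t z j ht
      refine ⟨Set.mem_insert_of_mem _ ⟨h3, fun k hk => hts ?_⟩, h4⟩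
      exact (h2 z h3).unique ⟨j, ht⟩ ⟨k, hk⟩
  · rcases Set.mem_insert_iff.1 hz with rfl | ⟨hzS, hzk⟩
    · refine ⟨h z i, ⟨i, Table.put_self _ _ _ _⟩, fun t ⟨j, ht⟩ => ?_⟩
      by_contra hts
      rw [Table.put_of_ne _ _ _ hts] at ht
      exact hx (h1 t z j ht).1
    · obtain ⟨t, ⟨j, ht⟩, hu⟩ := h2 z hzS
      have hts : t ≠ h x i := by
        rintro rfl
        exact hzk j ht
      refine ⟨t, ⟨j, by simp only [Table.put_of_ne _ _ _ hts, ht]⟩, fun t' ⟨j', ht'⟩ => ?_⟩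
      by_cases hts' : t' = h x i
      · subst hts'
        rw [Table.put_self] at ht'
        simp only [Option.some.injEq, Prod.mk.injEq] at ht'
        exact absurd (ht'.1 ▸ hzS) hx
      · rw [Table.put_of_ne _ _ _ hts'] at ht'
        exact hu t' ⟨j', ht'⟩

theorem IsCuckooTable.put_free {h : U → ℕ → Fin n} {d : ℕ} {T : Table n U} {S : Set U}
    (hT : IsCuckooTable h d T S) {x : U} (hx : x ∉ S) {i : ℕ} (hi : 1 ≤ i) (hid : i ≤ d)
    (hw : T (h x i) = none) : IsCuckooTable h d (T.put (h x i) x i) (insert x S) := by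
  have := hT.put hx hi hid
  simpa [hw] using this

/-- The keys in the table together with the homeless key form the same set before and after an
eviction. This is the invariant behind `place_isCuckooTable`. -/
theorem IsCuckooTable.put_evict {h : U → ℕ → Fin n} {d : ℕ} {T : Table n U} {S : Set U}
    (hT : IsCuckooTable h d T S) {x : U} (hx : x ∉ S) {i : ℕ} (hi : 1 ≤ i) (hid : i ≤ d) {y : U}
    {k : ℕ} (hw : T (h x i) = some (y, k)) :
    ∃ S' : Set U, IsCuckooTable h d (T.put (h x i) x i) S' ∧ y ∉ S' ∧ insert y S' = insert x S := by
  refine ⟨_, hT.put hx hi hid, ?_, ?_⟩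
  · rintro (rfl | ⟨-, h0⟩)
    · exact hx (hT.1 _ _ _ hw).1
    · exact h0 k hw
  · have hy := (hT.1 _ _ _ hw).1
    ext z
    simp only [hw, Set.mem_insert_iff, Set.mem_ofPred_eq, ne_eq, Option.some.injEq, Prod.mk.injEq,
      not_and]
    by_cases hzy : z = y
    · subst hzy; tauto
    · have : ∀ k' : ℕ, y = z → ¬ k = k' := fun _ h0 => absurd h0.symm hzy
      tauto

theorem place_isCuckooTable (h : U → ℕ → Fin n) {d : ℕ} (hd : 2 ≤ d) (L : ℕ) (T : Table n U) (x : U)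
    (i r : ℕ) : ∀ S : Set U, IsCuckooTable h d T S → x ∉ S → ∀ T', (place h d L T x i r).1 = some T' →
      IsCuckooTable h d T' (insert x S) := by
  refine place.induct_unfolding h d L (fun T x _ _ o => ∀ S : Set U, IsCuckooTable h d T S → x ∉ S →
    ∀ T', o.1 = some T' → IsCuckooTable h d T' (insert x S)) ?_ ?_ ?_ ?_ ?_ ?_ T x i r
  · intro T x i r hi j hj S hT hx T' hT'
    simp only [Option.some.injEq] at hT'
    subst hT'
    have h1 := List.find?_some hj
    have h2 := List.mem_of_find?_eq_some hj
    rw [List.mem_range'_1] at h2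
    exact hT.put_free hx (by omega) (by omega) (by simpa using h1)
  · intro T x i r hi _ hw S hT hx T' hT'
    simp only [Option.some.injEq] at hT'
    subst hT'
    exact hT.put_free hx (by omega) (by omega) hw
  · intro T x i r hi _ y k hw o ih S hT hx T' hT'
    obtain ⟨S', h1, h2, h3⟩ := hT.put_evict hx (by omega) (by omega) hw
    rw [← h3]
    exact ih S' h1 h2 T' hT'
  · intro T x i r hi i' hw S hT hx T' hT'
    simp only [Option.some.injEq] at hT'
    subst hT'
    have h4 : 1 ≤ i' ∧ i' ≤ d := by simp only [i']; split <;> omega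
    exact hT.put_free hx h4.1 h4.2 hw
  · intro T x i r hi i' y k hw _ S hT hx T' hT'
    simp at hT'
  · intro T x i r hi i' y k hw _ o ih S hT hx T' hT'
    have h4 : 1 ≤ i' ∧ i' ≤ d := by simp only [i']; split <;> omega
    obtain ⟨S', h1, h2, h3⟩ := hT.put_evict hx h4.1 h4.2 hw
    rw [← h3]
    exact ih S' h1 h2 T' hT'

theorem isCuckooTable_tableAfter (h : U → ℕ → Fin n) {d : ℕ} (hd : 2 ≤ d) (L : ℕ) {x : ℕ → U} {M : ℕ}
    (hx : Set.InjOn x (Set.Icc 1 M)) (k : ℕ) : k ≤ M → ∀ T, tableAfter h d L x k = some T →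
      IsCuckooTable h d T (x '' Set.Icc 1 k) := by
  induction k with
  | zero =>
    intro _ T hT
    simp only [tableAfter, Option.some.injEq] at hT
    subst hT
    exact ⟨fun s y j h0 => by simp at h0, fun y hy => by simp at hy⟩
  | succ k ih =>
    intro hk T hT
    rw [tableAfter, Option.bind_eq_some_iff] at hT
    obtain ⟨T₀, h1, h2⟩ := hT
    have h3 := place_isCuckooTable h hd L T₀ (x (k + 1)) 0 0 _ (ih (by omega) T₀ h1) (by
      rintro ⟨j, ⟨hj1, hj2⟩, hxj⟩
      have := hx (x₁ := j) (x₂ := k + 1) ⟨by omega, by omega⟩ ⟨by omega, by omega⟩ hxj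
      omega) T h2
    have h4 : x '' Set.Icc 1 (k + 1) = insert (x (k + 1)) (x '' Set.Icc 1 k) := by
      rw [← Set.image_insert_eq]
      congr 1
      ext j
      simp only [Set.mem_Icc, Set.mem_insert_iff]
      omega
    rwa [h4]

theorem supports_of_ne_none (h : U → ℕ → Fin n) {d : ℕ} (hd : 2 ≤ d) (L : ℕ) {x : ℕ → U} {M : ℕ}
    (hx : Set.InjOn x (Set.Icc 1 M)) (hM : tableAfter h d L x M ≠ none) : Supports h d L x M := by
  intro k hk
  obtain ⟨j, rfl⟩ := Nat.exists_eq_add_of_le hk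
  rcases hT : tableAfter h d L x k with _ | T
  · rw [tableAfter_add, hT] at hM
    simp at hM
  · exact ⟨T, rfl, isCuckooTable_tableAfter h hd L hx k (by omega) T hT⟩

end BubbleUp

/-! ### Potentials: number of probes, and independence of the edges -/

namespace BubbleUp

universe u v

open Finset
open scoped BigOperators

set_option linter.unusedSectionVars false

section MaxTrail

variable {ι κ V : Type*} [DecidableEq ι] [DecidableEq κ]

theorem Trail.of_le {e : ι → V × V} {ℓ ℓ' : ℕ} (hℓ : ℓ' ≤ ℓ) : ∀ {A : Finset ι} {v : V},
    Trail e ℓ A v → Trail e ℓ' A v := by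
  induction ℓ generalizing ℓ' with
  | zero => intro A v h; obtain rfl : ℓ' = 0 := by omega
            exact h
  | succ ℓ ih =>
    rintro A v ⟨k, hk, w, hj, ht⟩
    rcases ℓ' with _ | ℓ'
    · trivial
    · exact ⟨k, hk, w, hj, ih (by omega) ht⟩

open Classical in
/-- The largest length of a trail in `A` from `v`. -/
noncomputable def maxTrail (e : ι → V × V) (A : Finset ι) (v : V) : ℕ :=
  Nat.findGreatest (fun ℓ => Trail e ℓ A v) A.card

theorem trail_maxTrail (e : ι → V × V) (A : Finset ι) (v : V) : Trail e (maxTrail e A v) A v := by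
  classical
  exact Nat.findGreatest_spec (P := fun ℓ => Trail e ℓ A v) (Nat.zero_le _) trivial

theorem Trail.le_maxTrail {e : ι → V × V} {ℓ : ℕ} {A : Finset ι} {v : V} (h : Trail e ℓ A v) :
    ℓ ≤ maxTrail e A v := by
  classical
  exact Nat.le_findGreatest h.le_card h

theorem maxTrail_le_of_map {e : ι → V × V} {e' : κ → V × V} (φ : ι → κ) {A : Finset ι}
    {B : Finset κ} (hφ : Set.InjOn φ A) (hB : ∀ k ∈ A, φ k ∈ B) (he : ∀ k ∈ A, e k = e' (φ k))
    (v : V) : maxTrail e A v ≤ maxTrail e' B v :=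
  ((trail_maxTrail e A v).map φ hφ hB he).le_maxTrail

theorem maxTrail_mono {e e' : ι → V × V} {A B : Finset ι} (hAB : A ⊆ B) (he : ∀ k ∈ A, e k = e' k)
    (v : V) : maxTrail e A v ≤ maxTrail e' B v :=
  maxTrail_le_of_map id (Set.injOn_id _) (fun _ hk => hAB hk) he v

end MaxTrail

section Overlay

variable {α : Type*} {K : ℕ}

/-- The sequence `e` with an initial segment replaced by the list `l`. -/
def overlay (l : List α) (e : Fin K → α) : Fin K → α := fun i => l.getD i (e i)

theorem overlay_nil (e : Fin K → α) : overlay [] e = e := by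
  funext i; simp [overlay]

theorem overlay_append (l : List α) (e : Fin K → α) (a : α) (h : l.length < K) :
    overlay (l ++ [a]) e = overlay l (Function.update e ⟨l.length, h⟩ a) := by
  funext i
  unfold overlay
  rcases lt_trichotomy i.1 l.length with hi | hi | hi
  · rw [List.getD_append _ _ _ _ hi, List.getD_eq_getElem _ _ hi, List.getD_eq_getElem _ _ hi]
  · have hi' : i = ⟨l.length, h⟩ := Fin.ext hi
    subst hi'
    rw [List.getD_append_right _ _ _ _ le_rfl, List.getD_eq_default _ _ le_rfl]
    simp
  · have hi' : i ≠ ⟨l.length, h⟩ := fun h0 => by rw [h0] at hi; simp at hi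
    rw [List.getD_eq_default _ _ (by simp; omega), List.getD_eq_default _ _ hi.le,
      Function.update_of_ne hi']

theorem overlay_append_of_le (l : List α) (e : Fin K → α) (a : α) (h : K ≤ l.length) :
    overlay (l ++ [a]) e = overlay l e := by
  funext i
  unfold overlay
  have hi : i.1 < l.length := i.2.trans_le h
  rw [List.getD_append _ _ _ _ hi, List.getD_eq_getElem _ _ hi]

/-- A uniform new entry merely resamples the first coordinate that the list does not cover. Entries
beyond position `K` are invisible. -/
theorem expect_overlay_append [Fintype α] [Nonempty α] (l : List α) (f : (Fin K → α) → ℝ) :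
    𝔼 a : α, 𝔼 e : Fin K → α, f (overlay (l ++ [a]) e) = 𝔼 e : Fin K → α, f (overlay l e) := by
  by_cases h : l.length < K
  · simp only [overlay_append l _ _ h]
    exact (Finset.expect_comm univ univ
      (fun (a : α) (e : Fin K → α) => f (overlay l (Function.update e ⟨l.length, h⟩ a)))).trans
      (expect_update (ι := Fin K) ⟨l.length, h⟩ fun e => f (overlay l e))
  · simp only [overlay_append_of_le l _ _ (not_lt.1 h)]
    exact Finset.expect_const univ_nonempty _

end Overlay

variable {n : ℕ} {U : Type u} [DecidableEq U]

namespace State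

variable {d L M : ℕ} {x : ℕ → U}

/-- Halted states are fixed points, so the supermartingale inequality is needed only for running
ones. -/
theorem expect_last_le [NeZero n] (hx : Set.InjOn x (Set.Icc 1 M)) (hd : 2 ≤ d) (hL : 1 ≤ L)
    (hM : 1 ≤ M) {Φ : State n U → ℝ} (hΦ : ∀ s : State n U, s.Inv d L M x → s.run = true →
      𝔼 a, 𝔼 b, Φ (s.next d L M x a b) ≤ Φ s) :
    𝔼 H : hashes d M x → Fin n, Φ (last d L M x H) ≤ Φ (init x) := by
  refine (reveals (n := n) hx hd hL).expect_le (fun s hs => ?_) _ (inv_init hd hM)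
  by_cases hr : s.run = true
  · rw [expect_step hd hs hr]
    exact hΦ s hs hr
  · simp only [step, next_halted (show s.run = false by simpa using hr)]
    exact (Finset.expect_const (univ_nonempty (α := hashes d M x → Fin n)) (Φ s)).le

theorem inv_last [NeZero n] (hx : Set.InjOn x (Set.Icc 1 M)) (hd : 2 ≤ d) (hL : 1 ≤ L)
    (hM : 1 ≤ M) (H : hashes d M x → Fin n) : (last d L M x H).Inv d L M x :=
  (reveals (n := n) hx hd hL).inv_iter H _ (inv_init hd hM)

theorem finish_k (s : State n U) (o : Option (Table n U × Option (U × ℕ))) :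
    s.k ≤ (s.finish M x o).k ∧ (s.finish M x o).k ≤ s.k + 1 := by
  rcases o with _ | ⟨T', _ | ⟨z, j⟩⟩ <;> simp [finish, advance]

theorem next_k {s : State n U} (hr : s.run = true) (a b : Fin n) :
    s.k ≤ (s.next d L M x a b).k ∧ (s.next d L M x a b).k ≤ s.k + 1 := by
  by_cases hi : s.i + 1 < d - 1
  · by_cases ha : s.T a = none
    · rw [next_hit hr hi ha]; exact ⟨Nat.le_succ _, le_rfl⟩
    · rw [next_miss hr hi ha]; exact ⟨le_rfl, Nat.le_succ _⟩
  · rw [next_promote hr hi]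
    exact finish_k (s.promoted d L M a b) _

theorem next_k_of_free (hd : 2 ≤ d) {s : State n U} (hr : s.run = true) {a : Fin n}
    (ha : s.T a = none) (b : Fin n) : (s.next d L M x a b).k = s.k + 1 := by
  by_cases hi : s.i + 1 < d - 1
  · rw [next_hit hr hi ha]; rfl
  · rw [next_promote hr hi]
    have h1 : (s.promoted d L M a b).h s.y (d - 1) = a := by
      simp only [promoted]
      rw [setHash_of_ne' _ _ _ (by omega), setHash_self]
    unfold promote
    rw [h1]
    split
    · simp [finish, advance, promoted]
    · next h0 => rw [ha] at h0; simp at h0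

theorem expect_free {s : State n U} [NeZero n] (hs : s.Inv d L M x) (X Y : ℝ) :
    𝔼 a : Fin n, (if s.T a = none then X else Y) = Y + (n + 1 - s.k : ℝ) / n * (X - Y) := by
  have hn : (n : ℝ) ≠ 0 := Nat.cast_ne_zero.2 (NeZero.ne n)
  have h1 : ∀ a, (if s.T a = none then X else Y) = Y + (if s.T a = none then 1 else 0) * (X - Y) := by
    intro a; split_ifs <;> ring
  have h2 : ((univ.filter fun t => s.T t = none).card : ℝ) = n + 1 - s.k := by
    have := hs.wf.free
    rw [eq_sub_iff_add_eq]
    exact_mod_cast this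
  simp only [h1]
  rw [Finset.expect_add_distrib, Finset.expect_const univ_nonempty, ← Finset.expect_mul,
    Fintype.expect_eq_sum_div_card, Finset.sum_boole, h2, Fintype.card_fin]

theorem expect_next_le [NeZero n] {s : State n U} (hs : s.Inv d L M x) {Φ : State n U → ℝ} {X Y : ℝ}
    (hX : ∀ a b, s.T a = none → Φ (s.next d L M x a b) ≤ X)
    (hY : ∀ a b, Φ (s.next d L M x a b) ≤ Y) :
    𝔼 a, 𝔼 b, Φ (s.next d L M x a b) ≤ Y + (n + 1 - s.k : ℝ) / n * (X - Y) := by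
  rw [← expect_free hs]
  refine Finset.expect_le_expect fun a _ => ?_
  refine Finset.expect_le univ_nonempty fun b _ => ?_
  split_ifs with ha
  · exact hX a b ha
  · exact hY a b

/-- The number of probes is small: each probe finds a free slot with probability at least `F / n`,
where `F` is the number of free slots. -/
theorem expect_choose_mul_le [NeZero n] (hx : Set.InjOn x (Set.Icc 1 M)) (hd : 2 ≤ d) (hL : 1 ≤ L)
    (hM : 1 ≤ M) (hMn : M ≤ n) {r : ℕ} (hr : 1 ≤ r) (hrn : r < n) :
    𝔼 H : hashes d M x → Fin n, ((n - M).choose r : ℝ) * (1 - r / n : ℝ)⁻¹ ^ (last d L M x H).D.card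
      ≤ n.choose r := by
  have hn : (0 : ℝ) < n := Nat.cast_pos.2 (NeZero.pos n)
  set ρ : ℝ := 1 - r / n with hρ
  have hρ0 : 0 < ρ := by
    rw [hρ, sub_pos, div_lt_one hn]; exact_mod_cast hrn
  -- There are `n + 1 - k` free slots, so the binomial coefficient counts the `r`-sets of free
  -- slots. A probe misses each of them with probability `ρ`.
  let Φ : State n U → ℝ := fun s => ((n + 1 - s.k).choose r : ℝ) * ρ⁻¹ ^ s.D.card
  have h1 : 𝔼 H : hashes d M x → Fin n, Φ (last d L M x H) ≤ Φ (init x) := by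
    refine expect_last_le hx hd hL hM fun s hs hrun => ?_
    have hh := hs.homeless hrun
    have hcard : ∀ a b, (s.next d L M x a b).D.card = s.D.card + 1 := by
      intro a b
      rw [next_D hrun, Finset.card_insert_of_notMem]
      intro h0
      have := (hh.looked _).1 h0
      omega
    obtain ⟨F, hF⟩ : ∃ F, n + 1 - s.k = F + 1 := ⟨n - s.k, by have := hh.le; omega⟩
    have hFk : (n + 1 - s.k : ℝ) = F + 1 := by
      have h2 : n + 1 = F + 1 + s.k := by have := hh.le; omega
      have h3 : (n + 1 : ℝ) = F + 1 + s.k := by exact_mod_cast h2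
      linarith
    refine (expect_next_le hs (Φ := Φ) (X := (F.choose r : ℝ) * ρ⁻¹ ^ (s.D.card + 1))
      (Y := ((F + 1).choose r : ℝ) * ρ⁻¹ ^ (s.D.card + 1)) (fun a b ha => ?_) fun a b => ?_).trans ?_
    · simp only [Φ]
      rw [hcard, next_k_of_free hd hrun ha, show n + 1 - (s.k + 1) = F by omega]
    · simp only [Φ]
      rw [hcard]
      gcongr
      have := (next_k (d := d) (L := L) (M := M) (x := x) hrun a b).1
      omega
    · simp only [Φ]
      rw [hF, hFk]
      obtain ⟨r, rfl⟩ : ∃ r', r = r' + 1 := ⟨r - 1, by omega⟩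
      have h4 : ((F : ℝ) + 1) * F.choose r = (F + 1).choose (r + 1) * (r + 1) := by
        exact_mod_cast Nat.add_one_mul_choose_eq F r
      have h5 : ((F + 1).choose (r + 1) : ℝ) = F.choose r + F.choose (r + 1) := by
        exact_mod_cast Nat.choose_succ_succ F r
      have h6 : ((F + 1).choose (r + 1) : ℝ) + (F + 1) / n * (F.choose (r + 1) - (F + 1).choose (r + 1))
          = (F + 1).choose (r + 1) * ρ := by
        have h7 : (F.choose (r + 1) : ℝ) - (F + 1).choose (r + 1) = - F.choose r := by linarith
        rw [h7, hρ]
        push_cast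
        field_simp
        linear_combination -h4
      have h8 : ρ⁻¹ ^ (s.D.card + 1) * ρ = ρ⁻¹ ^ s.D.card := by
        rw [pow_succ, mul_assoc, inv_mul_cancel₀ hρ0.ne', mul_one]
      refine le_of_eq ?_
      rw [← h8]
      linear_combination ρ⁻¹ ^ (s.D.card + 1) * h6
  refine le_trans (Finset.expect_le_expect fun H _ => ?_) (h1.trans (le_of_eq ?_))
  · have h9 := (inv_last (n := n) hx hd hL hM H).le
    refine mul_le_mul_of_nonneg_right ?_ (by positivity)
    exact_mod_cast Nat.choose_le_choose r (by omega)
  · simp [Φ, init]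

/-- The second moment of the number of probes in the last insertion. -/
theorem expect_sq_le [NeZero n] (hx : Set.InjOn x (Set.Icc 1 M)) (hd : 2 ≤ d) (hL : 1 ≤ L)
    (hM : 1 ≤ M) (hMn : M ≤ n) {p : ℝ} (hp : p = (n + 1 - M) / n) :
    𝔼 H : hashes d M x → Fin n, ((last d L M x H).N : ℝ) ^ 2 ≤ 2 / p ^ 2 := by
  have hn : (0 : ℝ) < n := Nat.cast_pos.2 (NeZero.pos n)
  have hMn' : (M : ℝ) ≤ n := by exact_mod_cast hMn
  have hM' : (1 : ℝ) ≤ M := by exact_mod_cast hM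
  have hp0 : 0 < p := by rw [hp]; apply div_pos _ hn; linarith
  have hp1 : p ≤ 1 := by rw [hp, div_le_one hn]; linarith
  -- The probes still to come in the last insertion are dominated by a geometric variable `G` with
  -- success probability `p`, and `𝔼 (N + G)² ≤ N² + 2N/p + 2/p²`.
  let Φ : State n U → ℝ := fun s => (s.N : ℝ) ^ 2 + if s.run then 2 * s.N / p + 2 / p ^ 2 else 0
  have h1 : 𝔼 H : hashes d M x → Fin n, Φ (last d L M x H) ≤ Φ (init x) := by
    refine expect_last_le hx hd hL hM fun s hs hrun => ?_
    have hh := hs.homeless hrun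
    by_cases hk : s.k = M
    · have hN : ∀ a b, ((s.next d L M x a b).N : ℝ) = s.N + 1 := by
        intro a b
        rw [next_N hrun, if_pos hk]
        push_cast
        ring
      refine (expect_next_le hs (Φ := Φ) (X := (s.N + 1 : ℝ) ^ 2)
        (Y := (s.N + 1 : ℝ) ^ 2 + (2 * (s.N + 1) / p + 2 / p ^ 2)) (fun a b ha => ?_)
        fun a b => ?_).trans ?_
      · have h2 : (s.next d L M x a b).run = false := by
          by_contra h0
          have := ((hs.next hx hd hL a b).homeless (by simpa using h0)).le
          rw [next_k_of_free hd hrun ha] at this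
          omega
        simp only [Φ]
        rw [hN, h2]
        simp
      · simp only [Φ]
        rw [hN]
        gcongr
        split_ifs
        · exact le_rfl
        · positivity
      · simp only [Φ, hrun, if_true]
        rw [hk, ← hp]
        have h3 : (s.N + 1 : ℝ) ^ 2 + (2 * (s.N + 1) / p + 2 / p ^ 2) +
            p * ((s.N + 1 : ℝ) ^ 2 - ((s.N + 1 : ℝ) ^ 2 + (2 * (s.N + 1) / p + 2 / p ^ 2))) =
            (s.N : ℝ) ^ 2 + (2 * s.N / p + 2 / p ^ 2) - 1 := by
          field_simp
          ring
        rw [h3]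
        linarith
    · have hlt : s.k < M := lt_of_le_of_ne hh.le hk
      have hN0 := (hs.zero hlt).1
      refine (expect_next_le hs (Φ := Φ) (X := 2 / p ^ 2) (Y := 2 / p ^ 2) (fun a b _ => ?_)
        fun a b => ?_).trans ?_
      iterate 2
        simp only [Φ]
        rw [next_N hrun, if_neg hk, hN0]
        split_ifs
        · simp
        · simp; positivity
      · simp [Φ, hrun, hN0]
  refine le_trans (Finset.expect_le_expect fun H _ => ?_) (h1.trans (le_of_eq ?_))
  · simp only [Φ]
    refine le_add_of_nonneg_right ?_
    split_ifs
    · positivity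
    · exact le_rfl
  · simp [Φ, init]

variable (d) in
/-- The cuckoo graph of the core keys, in the order in which they became core keys. -/
def edges (s : State n U) : List (Fin n × Fin n) := s.core.map (coreEdge s.h d)

theorem edges_next_probe {s : State n U} (hs : s.Inv d L M x) (hr : s.run = true)
    (hi : s.i + 1 < d - 1) (a b : Fin n) : (s.next d L M x a b).edges d = s.edges d := by
  obtain ⟨h1, h2, -⟩ := next_probe_eq (L := L) (M := M) (x := x) hr hi a b
  rw [edges, edges, h1, h2]
  refine List.map_congr_left fun z hz => ?_
  have hzy : z ≠ s.y := fun h0 => (hs.homeless hr).notMem (h0 ▸ hz)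
  unfold coreEdge
  rw [setHash_of_ne _ hzy, setHash_of_ne _ hzy]

theorem coreEdge_next_promote (hd : 2 ≤ d) {s : State n U} (hs : s.Inv d L M x) (hr : s.run = true)
    (hi : ¬ s.i + 1 < d - 1) (a b : Fin n) :
    (∀ z ∈ s.core, coreEdge s.h d z = coreEdge (s.next d L M x a b).h d z) ∧
      coreEdge (s.next d L M x a b).h d s.y = (a, b) := by
  rw [(next_promote_eq hr hi a b).2.1]
  refine ⟨fun z hz => ?_, ?_⟩
  · have hzy : z ≠ s.y := fun h0 => (hs.homeless hr).notMem (h0 ▸ hz)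
    unfold coreEdge
    rw [setHash_of_ne _ hzy, setHash_of_ne _ hzy, setHash_of_ne _ hzy, setHash_of_ne _ hzy]
  · unfold coreEdge
    rw [setHash_self, setHash_of_ne' _ _ _ (by omega), setHash_self]

theorem edges_next_promote (hd : 2 ≤ d) {s : State n U} (hs : s.Inv d L M x) (hr : s.run = true)
    (hi : ¬ s.i + 1 < d - 1) (a b : Fin n) :
    (s.next d L M x a b).edges d = s.edges d ++ [(a, b)] := by
  obtain ⟨h1, h2⟩ := coreEdge_next_promote (L := L) (M := M) (x := x) hd hs hr hi a b
  rw [edges, (next_promote_eq hr hi a b).1, List.map_append, List.map_singleton, h2, edges]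
  congr 1
  exact List.map_congr_left fun z hz => (h1 z hz).symm

/-- The edges of the cuckoo graph are independent and uniform. -/
theorem expect_edges_le [NeZero n] (hx : Set.InjOn x (Set.Icc 1 M)) (hd : 2 ≤ d) (hL : 1 ≤ L)
    (hM : 1 ≤ M) {K : ℕ} (f : (Fin K → Fin n × Fin n) → ℝ) :
    𝔼 H : hashes d M x → Fin n, 𝔼 e, f (overlay ((last d L M x H).edges d) e) ≤ 𝔼 e, f e := by
  refine (expect_last_le hx hd hL hM (Φ := fun s => 𝔼 e, f (overlay (s.edges d) e))
    fun s hs hr => ?_).trans (le_of_eq ?_)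
  · by_cases hi : s.i + 1 < d - 1
    · simp only [edges_next_probe hs hr hi]
      refine (Finset.expect_const univ_nonempty _).trans_le ?_
      exact (Finset.expect_const univ_nonempty _).le
    · simp only [edges_next_promote hd hs hr hi]
      rw [← Finset.expect_product' univ univ (fun a b => 𝔼 e, f (overlay (s.edges d ++ [(a, b)]) e)),
        Finset.univ_product_univ]
      exact (expect_overlay_append (s.edges d) f).le
  · simp [edges, init, overlay_nil]

/-- A key is sent to its position in the order of promotion. The reduction modulo `K` only makes the
map total. -/
theorem exists_index (s : State n U) {K : ℕ} (hK : 0 < K) :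
    ∃ φ : U → Fin K, Set.InjOn φ ((s.core.take K).toFinset : Set U) ∧
      ∀ e, ∀ z ∈ (s.core.take K).toFinset, coreEdge s.h d z = overlay (s.edges d) e (φ z) := by
  have hlt : ∀ z ∈ s.core.take K, s.core.idxOf z < K ∧ s.core.idxOf z < s.core.length := by
    intro z hz
    have h1 := List.idxOf_lt_length_iff.2 hz
    have h2 : s.core.idxOf z = (s.core.take K).idxOf z := by
      conv_lhs => rw [← List.take_append_drop K s.core]
      exact List.idxOf_append_of_mem hz
    rw [List.length_take] at h1
    omega
  have hval : ∀ z ∈ s.core.take K, s.core.idxOf z % K = s.core.idxOf z := fun z hz =>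
    Nat.mod_eq_of_lt (hlt z hz).1
  refine ⟨fun z => ⟨s.core.idxOf z % K, Nat.mod_lt _ hK⟩, ?_, ?_⟩
  · intro z hz w hw hzw
    simp only [Finset.mem_coe, List.mem_toFinset] at hz hw
    simp only [Fin.mk.injEq, hval z hz, hval w hw] at hzw
    exact (List.idxOf_inj (List.mem_of_mem_take hz)).1 hzw
  · intro e z hz
    rw [List.mem_toFinset] at hz
    unfold overlay edges
    simp only [hval z hz]
    rw [List.getD_eq_getElem _ _ (by rw [List.length_map]; exact (hlt z hz).2), List.getElem_map,
      List.getElem_idxOf]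

theorem maxTrail_le_overlay (s : State n U) {K : ℕ} (e : Fin K → Fin n × Fin n)
    (v : Fin n) : maxTrail (coreEdge s.h d) (s.core.take K).toFinset v ≤
      maxTrail (overlay (s.edges d) e) univ v := by
  rcases Nat.eq_zero_or_pos K with rfl | hK
  · have := (trail_maxTrail (coreEdge s.h d) (s.core.take 0).toFinset v).le_card
    simp at this
    simp [this]
  · obtain ⟨φ, h1, h2⟩ := exists_index s hK
    exact maxTrail_le_of_map φ h1 (fun _ _ => Finset.mem_univ _) (h2 e) v

theorem bicyclic_overlay (s : State n U) {K : ℕ} (e : Fin K → Fin n × Fin n)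
    (h : Bicyclic (coreEdge s.h d) (s.core.take K).toFinset) :
    Bicyclic (overlay (s.edges d) e) univ := by
  rcases Nat.eq_zero_or_pos K with rfl | hK
  · obtain ⟨v, ℓ, h⟩ := h
    obtain rfl : ℓ = 0 := by simpa using h.le_card
    obtain ⟨k, hk, -⟩ := h
    simp at hk
  · obtain ⟨φ, h1, h2⟩ := exists_index s hK
    exact h.map φ h1 (fun _ _ => Finset.mem_univ _) (h2 e)

end State

end BubbleUp

/-! ### Trails and bicyclic components in a subcritical random multigraph -/

namespace BubbleUp

universe u v

open Finset
open scoped BigOperators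

set_option linter.unusedSectionVars false

section Random

/-- A constant that bounds moments of trail lengths in a subcritical random multigraph. -/
noncomputable def trailConst : ℝ := ∑' ℓ : ℕ, ((ℓ : ℝ) + 1) ^ 2 * (4 / 5 : ℝ) ^ ℓ

theorem summable_trailConst : Summable fun ℓ : ℕ => ((ℓ : ℝ) + 1) ^ 2 * (4 / 5 : ℝ) ^ ℓ := by
  have h := summable_pow_mul_geometric_of_norm_lt_one (R := ℝ) 2 (r := 4 / 5)
    (by rw [Real.norm_eq_abs, abs_of_pos] <;> norm_num)
  have h1 := ((summable_nat_add_iff 1).2 h).mul_left (5 / 4 : ℝ)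
  refine h1.congr fun ℓ => ?_
  push_cast
  rw [pow_succ]
  ring

theorem sum_le_trailConst (s : Finset ℕ) :
    ∑ ℓ ∈ s, ((ℓ : ℝ) + 1) ^ 2 * (4 / 5 : ℝ) ^ ℓ ≤ trailConst :=
  summable_trailConst.sum_le_tsum s fun _ _ => by positivity

theorem trailConst_nonneg : 0 ≤ trailConst := by simpa using sum_le_trailConst ∅

variable {n K : ℕ} [NeZero n]

/-- There are `n` starting vertices, and the two closing edges cost `((ℓ + 1)/n)²`, so one factor
`1/n` survives the summation over `ℓ`. -/
theorem expect_bicyclic_le (hK : (2 * K / n : ℝ) ≤ 4 / 5) :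
    𝔼 e : Fin K → Fin n × Fin n, ind (Bicyclic e univ) ≤ trailConst / n := by
  have hn : (0 : ℝ) < n := Nat.cast_pos.2 (NeZero.pos n)
  calc 𝔼 e : Fin K → Fin n × Fin n, ind (Bicyclic e univ)
      ≤ 𝔼 e : Fin K → Fin n × Fin n, ∑ v : Fin n, ∑ ℓ ∈ range (K + 1),
          ind (Closes e v ℓ univ v [v]) := by
        refine Finset.expect_le_expect fun e _ => ?_
        refine (ind_mono (q := ∃ v ∈ (univ : Finset (Fin n)), ∃ ℓ ∈ range (K + 1),
          Closes e v ℓ univ v [v]) ?_).trans ((ind_exists_le _ _).trans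
            (Finset.sum_le_sum fun v _ => ind_exists_le _ _))
        rintro ⟨v, ℓ, h⟩
        refine ⟨v, Finset.mem_univ _, ℓ, ?_, h⟩
        have := h.le_card
        simp only [Finset.card_univ, Fintype.card_fin] at this
        simp only [Finset.mem_range]
        omega
    _ = ∑ v : Fin n, ∑ ℓ ∈ range (K + 1), 𝔼 e : Fin K → Fin n × Fin n,
          ind (Closes e v ℓ univ v [v]) := by
        simp only [Finset.expect_sum_comm]
    _ ≤ ∑ v : Fin n, ∑ ℓ ∈ range (K + 1), ((ℓ : ℝ) + 1) ^ 2 * (4 / 5 : ℝ) ^ ℓ / (n : ℝ) ^ 2 := by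
        refine Finset.sum_le_sum fun v _ => Finset.sum_le_sum fun ℓ _ => ?_
        refine (expect_closes_le K v ℓ univ v [v] (by simp)).trans ?_
        simp only [Fintype.card_fin, List.length_singleton, Nat.cast_one]
        have h1 : (2 * K * (1 + ℓ) / (n : ℝ) ^ 2 : ℝ) = (2 * K / n) * ((ℓ + 1) / n) := by
          field_simp
          ring
        rw [h1]
        have h2 : (2 * K / n : ℝ) ^ 2 ≤ 1 := by
          apply pow_le_one₀ (by positivity); linarith
        calc (2 * K / n : ℝ) ^ ℓ * ((2 * K / n) * ((ℓ + 1) / n)) ^ 2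
            = (2 * K / n : ℝ) ^ ℓ * ((2 * K / n : ℝ) ^ 2 * ((ℓ + 1) ^ 2 / (n : ℝ) ^ 2)) := by
              rw [mul_pow (2 * K / n : ℝ), div_pow ((ℓ : ℝ) + 1)]
          _ ≤ (4 / 5 : ℝ) ^ ℓ * (1 * ((ℓ + 1) ^ 2 / (n : ℝ) ^ 2)) := by gcongr
          _ = _ := by ring
    _ = (∑ ℓ ∈ range (K + 1), ((ℓ : ℝ) + 1) ^ 2 * (4 / 5 : ℝ) ^ ℓ) / n := by
        rw [Finset.sum_const, Finset.card_univ, Fintype.card_fin, nsmul_eq_mul, ← Finset.sum_div]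
        field_simp
    _ ≤ trailConst / n := by
        gcongr
        exact sum_le_trailConst _

theorem expect_exists_trail_le (hK : (2 * K / n : ℝ) ≤ 4 / 5) (ℓ : ℕ) :
    𝔼 e : Fin K → Fin n × Fin n, ind (∃ v, Trail e ℓ univ v) ≤ n * (4 / 5 : ℝ) ^ ℓ := by
  calc 𝔼 e : Fin K → Fin n × Fin n, ind (∃ v, Trail e ℓ univ v)
      ≤ 𝔼 e : Fin K → Fin n × Fin n, ∑ v : Fin n, ind (Trail e ℓ univ v) := by
        refine Finset.expect_le_expect fun e _ => ?_
        have := ind_exists_le (univ : Finset (Fin n)) fun v => Trail e ℓ univ v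
        simpa using this
    _ = ∑ v : Fin n, 𝔼 e : Fin K → Fin n × Fin n, ind (Trail e ℓ univ v) :=
        Finset.expect_sum_comm _ _ _
    _ ≤ ∑ v : Fin n, (4 / 5 : ℝ) ^ ℓ := by
        refine Finset.sum_le_sum fun v _ => (expect_trail_le K ℓ univ v (by simp)).trans ?_
        rw [Fintype.card_fin]
        gcongr
    _ = _ := by simp

/-- The square of the largest length is one of the terms of the sum of `ℓ²` over all lengths `ℓ`
that occur. -/
theorem expect_maxTrail_sq_le (hK : (2 * K / n : ℝ) ≤ 4 / 5) (v : Fin n) :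
    𝔼 e : Fin K → Fin n × Fin n, (maxTrail e univ v : ℝ) ^ 2 ≤ trailConst := by
  calc 𝔼 e : Fin K → Fin n × Fin n, (maxTrail e univ v : ℝ) ^ 2
      ≤ 𝔼 e : Fin K → Fin n × Fin n, ∑ ℓ ∈ range (K + 1), (ℓ : ℝ) ^ 2 * ind (Trail e ℓ univ v) := by
        refine Finset.expect_le_expect fun e _ => ?_
        have h1 := trail_maxTrail e univ v
        have h2 := h1.le_card
        simp only [Finset.card_univ, Fintype.card_fin] at h2
        refine le_trans (le_of_eq ?_) (Finset.single_le_sum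
          (f := fun ℓ : ℕ => (ℓ : ℝ) ^ 2 * ind (Trail e ℓ univ v))
          (fun ℓ _ => mul_nonneg (by positivity) (ind_nonneg _))
          (Finset.mem_range.2 (Nat.lt_succ_of_le h2)))
        rw [ind_of h1, mul_one]
    _ = ∑ ℓ ∈ range (K + 1), (ℓ : ℝ) ^ 2 * 𝔼 e : Fin K → Fin n × Fin n, ind (Trail e ℓ univ v) := by
        rw [Finset.expect_sum_comm]
        simp only [Finset.mul_expect]
    _ ≤ ∑ ℓ ∈ range (K + 1), ((ℓ : ℝ) + 1) ^ 2 * (4 / 5 : ℝ) ^ ℓ := by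
        refine Finset.sum_le_sum fun ℓ _ => ?_
        have h1 := expect_trail_le K ℓ (univ : Finset (Fin K)) v (by simp)
        rw [Fintype.card_fin] at h1
        have h2 : (2 * K / n : ℝ) ^ ℓ ≤ (4 / 5 : ℝ) ^ ℓ := by gcongr
        refine mul_le_mul ?_ (h1.trans h2) (Finset.expect_nonneg fun _ _ => ind_nonneg _)
          (by positivity)
        gcongr
        linarith
    _ ≤ trailConst := sum_le_trailConst _

end Random

/-! ### Failure probability and expected time of an insertion -/

variable {n : ℕ} {U : Type u} [DecidableEq U]

namespace State

variable {d L M : ℕ} {x : ℕ → U}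

variable (d) in
/-- The largest length of a trail from `v` among the first `K` edges of the cuckoo graph. -/
noncomputable def trailFrom (K : ℕ) (s : State n U) (v : Fin n) : ℕ :=
  maxTrail (coreEdge s.h d) (s.core.take K).toFinset v

variable (d) in
/-- There are few core keys, and no component of the cuckoo graph is bicyclic. -/
def Good (K : ℕ) (s : State n U) : Prop :=
  s.core.length ≤ K ∧ ¬ Bicyclic (coreEdge s.h d) s.core.toFinset

theorem coreEdge_next (hd : 2 ≤ d) {s : State n U} (hs : s.Inv d L M x) (hr : s.run = true)
    (a b : Fin n) : ∀ z ∈ s.core, coreEdge s.h d z = coreEdge (s.next d L M x a b).h d z := by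
  by_cases hi : s.i + 1 < d - 1
  · intro z hz
    have hzy : z ≠ s.y := fun h0 => (hs.homeless hr).notMem (h0 ▸ hz)
    rw [(next_probe_eq hr hi a b).2.1]
    unfold coreEdge
    rw [setHash_of_ne _ hzy, setHash_of_ne _ hzy]
  · exact (coreEdge_next_promote hd hs hr hi a b).1

theorem core_prefix_next {s : State n U} (hr : s.run = true) (a b : Fin n) :
    s.core <+: (s.next d L M x a b).core := by
  by_cases hi : s.i + 1 < d - 1
  · rw [(next_probe_eq hr hi a b).1]
  · rw [(next_promote_eq hr hi a b).1]
    exact List.prefix_append _ _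

theorem trailFrom_le_next (hd : 2 ≤ d) {s : State n U} (hs : s.Inv d L M x) (hr : s.run = true)
    (a b : Fin n) (K : ℕ) (v : Fin n) : trailFrom d K s v ≤ trailFrom d K (s.next d L M x a b) v := by
  refine maxTrail_mono (fun z hz => ?_) (fun z hz => ?_) v
  · rw [List.mem_toFinset] at hz ⊢
    exact ((core_prefix_next hr a b).take K).subset hz
  · exact coreEdge_next hd hs hr a b z (List.mem_of_mem_take (List.mem_toFinset.1 hz))

theorem good_of_next (hd : 2 ≤ d) {s : State n U} (hs : s.Inv d L M x) (hr : s.run = true)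
    {a b : Fin n} {K : ℕ} (h : Good d K (s.next d L M x a b)) : Good d K s := by
  have h1 := core_prefix_next (d := d) (L := L) (M := M) (x := x) hr a b
  refine ⟨h1.length_le.trans h.1, fun h2 => h.2 (h2.map id (Set.injOn_id _) (fun z hz => ?_)
    fun z hz => ?_)⟩
  · rw [List.mem_toFinset] at hz
    exact List.mem_toFinset.2 (h1.subset hz)
  · exact coreEdge_next hd hs hr a b z (List.mem_toFinset.1 hz)

/-- As long as the state remains good, the time of a step is bounded by lengths of trails from two
fresh random slots. -/
theorem time_next_le (hd : 2 ≤ d) {s : State n U} (hs : s.Inv d L M x) (hr : s.run = true)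
    (a b : Fin n) {K : ℕ} (hg : Good d K (s.next d L M x a b)) :
    (s.next d L M x a b).tm ≤ s.tm + (1 + 2 * trailFrom d K s a + trailFrom d K s b) := by
  have hh := hs.homeless hr
  by_cases hi : s.i + 1 < d - 1
  · rw [(next_probe_eq hr hi a b).2.2]
    split_ifs <;> omega
  · have hid : s.i + 1 = d - 1 := by have := hh.lt; omega
    obtain ⟨h1, h2, h3⟩ := next_promote_eq (L := L) (M := M) (x := x) hr hi a b
    have hwf := hs.wf.promoted (L := L) hh hi a b
    have hmem := mem_promoted_core (d := d) (L := L) (M := M) s a b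
    obtain ⟨hg1, hg2⟩ := hg
    rw [h1] at hg1 hg2
    rw [h2] at hg2
    have hedge := (coreEdge_next_promote (L := L) (M := M) (x := x) hd hs hr hi a b).1
    rw [h2] at hedge
    have htake : (s.core.take K) = s.core := by
      refine List.take_of_length_le ?_
      simp only [List.length_append, List.length_singleton] at hg1
      omega
    have htr : ∀ {ℓ v}, Trail (coreEdge (setHash (setHash s.h s.y (d - 1) a) s.y d b) d) ℓ
        s.core.toFinset v → ℓ ≤ trailFrom d K s v := by
      intro ℓ v ht
      unfold trailFrom
      rw [htake]
      refine (ht.map id (Set.injOn_id _) (fun _ hz => hz) fun z hz => ?_).le_maxTrail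
      exact (hedge z (List.mem_toFinset.1 hz)).symm
    rw [h3]
    rcases promote_moves L hwf.core hh.absent hmem with hb | ⟨ℓ₁, ℓ₂, h4, h5, h6⟩
    · exact absurd hb hg2
    · rw [promoted_erase hh] at h4 h5
      have e1 : (s.promoted d L M a b).h s.y (d - 1) = a := by
        simp only [promoted]
        rw [setHash_of_ne' _ _ _ (by omega), setHash_self]
      have e2 : (s.promoted d L M a b).h s.y d = b := setHash_self _ _ _ _
      rw [e1] at h4
      rw [e2] at h5
      have h7 := htr h4
      have h8 := htr h5
      change (promote (setHash (setHash s.h s.y (d - 1) a) s.y d b) d L s.T s.y).2 ≤ _ at h6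
      split_ifs <;> omega

/-- The expected time of an insertion is controlled by the number of its probes and the mean length
of trails in the cuckoo graph. -/
theorem expect_time_sub_le [NeZero n] (hx : Set.InjOn x (Set.Icc 1 M)) (hd : 2 ≤ d) (hL : 1 ≤ L)
    (hM : 1 ≤ M) (K : ℕ) :
    𝔼 H : hashes d M x → Fin n, ((last d L M x H).tm * ind (Good d K (last d L M x H)) -
      (last d L M x H).N * (1 + 3 * 𝔼 v, (trailFrom d K (last d L M x H) v : ℝ))) ≤ 0 := by
  -- The slots `a` and `b` are fresh, so the cost `1 + 2 trailFrom a + trailFrom b` of a step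
  -- averages to `1 + 3S`. Trail lengths only grow and `Good` can only be lost, so it is safe to
  -- charge every probe with the trails of the final graph.
  refine (expect_last_le hx hd hL hM (Φ := fun s => s.tm * ind (Good d K s) -
    s.N * (1 + 3 * 𝔼 v, (trailFrom d K s v : ℝ))) fun s hs hr => ?_).trans (le_of_eq ?_)
  · have hh := hs.homeless hr
    set S : ℝ := 𝔼 v, (trailFrom d K s v : ℝ) with hS
    have hmono : ∀ a b, S ≤ 𝔼 v, (trailFrom d K (s.next d L M x a b) v : ℝ) := fun a b =>
      Finset.expect_le_expect fun v _ => by exact_mod_cast trailFrom_le_next hd hs hr a b K v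
    by_cases hk : s.k = M
    · have hpt : ∀ a b, ((s.next d L M x a b).tm : ℝ) * ind (Good d K (s.next d L M x a b)) -
          (s.next d L M x a b).N * (1 + 3 * 𝔼 v, (trailFrom d K (s.next d L M x a b) v : ℝ)) ≤
          (s.tm * ind (Good d K s) - (s.N + 1) * (1 + 3 * S) + 1) +
            (2 * (trailFrom d K s a : ℝ) + trailFrom d K s b) := by
        intro a b
        have h1 : ((s.next d L M x a b).tm : ℝ) * ind (Good d K (s.next d L M x a b)) ≤
            s.tm * ind (Good d K s) + (1 + 2 * (trailFrom d K s a : ℝ) + trailFrom d K s b) := by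
          by_cases hg : Good d K (s.next d L M x a b)
          · rw [ind_of hg, ind_of (good_of_next hd hs hr hg), mul_one, mul_one]
            exact_mod_cast time_next_le hd hs hr a b hg
          · rw [ind_of_not hg, mul_zero]
            have := ind_nonneg (Good d K s)
            positivity
        have h2 : ((s.N : ℝ) + 1) * (1 + 3 * S) ≤ (s.next d L M x a b).N *
            (1 + 3 * 𝔼 v, (trailFrom d K (s.next d L M x a b) v : ℝ)) := by
          rw [next_N hr, if_pos hk]
          push_cast
          have := hmono a b
          gcongr
        linarith
      refine (Finset.expect_le_expect fun a _ => Finset.expect_le_expect fun b _ => hpt a b).trans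
        (le_of_eq ?_)
      simp only [Finset.expect_add_distrib, Finset.expect_const (univ_nonempty (α := Fin n)),
        ← Finset.mul_expect, ← hS]
      ring
    · have hlt : s.k < M := lt_of_le_of_ne hh.le hk
      obtain ⟨h1, h2⟩ := hs.zero hlt
      have h3 : ∀ a b, (s.next d L M x a b).N = 0 ∧ (s.next d L M x a b).tm = 0 := by
        intro a b
        refine ⟨by rw [next_N hr, if_neg hk, h1], ?_⟩
        by_cases hi : s.i + 1 < d - 1
        · rw [(next_probe_eq hr hi a b).2.2, if_neg hk, h2]
        · rw [(next_promote_eq hr hi a b).2.2, if_neg hk, h2]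
      simp [h1, h2, h3]
  · simp [init]

variable (K : ℕ)

theorem expect_ind_bicyclic_le [NeZero n] (hx : Set.InjOn x (Set.Icc 1 M)) (hd : 2 ≤ d) (hL : 1 ≤ L)
    (hM : 1 ≤ M) (hK : (2 * K / n : ℝ) ≤ 4 / 5) :
    𝔼 H : hashes d M x → Fin n, ind (Bicyclic (coreEdge (last d L M x H).h d)
      ((last d L M x H).core.take K).toFinset) ≤ trailConst / n := by
  refine le_trans (Finset.expect_le_expect fun H _ => ?_) ((expect_edges_le (n := n) hx hd hL hM
    (K := K) fun e => ind (Bicyclic e univ)).trans (expect_bicyclic_le hK))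
  exact Finset.le_expect univ_nonempty fun e _ => ind_mono (bicyclic_overlay _ e)

theorem expect_ind_not_good_le [NeZero n] (hx : Set.InjOn x (Set.Icc 1 M)) (hd : 2 ≤ d) (hL : 1 ≤ L)
    (hM : 1 ≤ M) (hK : (2 * K / n : ℝ) ≤ 4 / 5) :
    𝔼 H : hashes d M x → Fin n, ind (¬ Good d K (last d L M x H)) ≤
      𝔼 H : hashes d M x → Fin n, ind (K < (last d L M x H).core.length) + trailConst / n := by
  refine le_trans (Finset.expect_le_expect fun H _ => ?_) ((Finset.expect_add_distrib _ _ _).le.trans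
    (add_le_add le_rfl (expect_ind_bicyclic_le (L := L) K hx hd hL hM hK)))
  refine (ind_mono fun h => ?_).trans (ind_or_le _ _)
  by_cases h1 : (last d L M x H).core.length ≤ K
  · right
    rw [List.take_of_length_le h1]
    by_contra h2
    exact h ⟨h1, h2⟩
  · exact Or.inl (not_le.1 h1)

/-- By the invariant `cause`, a failure comes with a bicyclic component or a trail of length at
least `L/3`. If there are at most `K` core keys, both are visible in the random multigraph with `K`
edges. -/
theorem expect_fail_le [NeZero n] (hx : Set.InjOn x (Set.Icc 1 M)) (hd : 2 ≤ d) (hL : 1 ≤ L)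
    (hM : 1 ≤ M) (hK : (2 * K / n : ℝ) ≤ 4 / 5) {ℓ : ℕ} (hℓ : 3 * ℓ < L + 3) :
    𝔼 H : hashes d M x → Fin n, ind ((last d L M x H).fail = true) ≤
      𝔼 H : hashes d M x → Fin n, ind (K < (last d L M x H).core.length) + trailConst / n +
        n * (4 / 5 : ℝ) ^ ℓ := by
  have h1 : 𝔼 H : hashes d M x → Fin n, ind (∃ v, Trail (coreEdge (last d L M x H).h d) ℓ
      ((last d L M x H).core.take K).toFinset v) ≤ n * (4 / 5 : ℝ) ^ ℓ := by
    refine le_trans (Finset.expect_le_expect fun H _ => ?_) ((expect_edges_le (n := n) hx hd hL hM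
      (K := K) fun e => ind (∃ v, Trail e ℓ univ v)).trans (expect_exists_trail_le hK ℓ))
    refine Finset.le_expect univ_nonempty fun e _ => ind_mono ?_
    rintro ⟨v, hv⟩
    exact ⟨v, (trail_maxTrail _ _ v).of_le (hv.le_maxTrail.trans (maxTrail_le_overlay _ e v))⟩
  refine le_trans (Finset.expect_le_expect fun H _ => ?_) ((Finset.expect_add_distrib _ _ _).le.trans
    (add_le_add (expect_ind_not_good_le (L := L) K hx hd hL hM hK) h1))
  refine (ind_mono fun h => ?_).trans (ind_or_le _ _)
  by_cases hg : Good d K (last d L M x H)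
  · right
    rcases ((inv_last (n := n) hx hd hL hM H).cause h).2 with hb | ⟨v, ℓ', h2, h3⟩
    · exact absurd hb hg.2
    · rw [List.take_of_length_le hg.1]
      exact ⟨v, h3.of_le (by omega)⟩
  · exact Or.inl hg

theorem expect_add_affine {ι : Type*} [Fintype ι] [Nonempty ι] (A B C D : ι → ℝ) (a b c e : ℝ) :
    𝔼 i, (A i + (a * B i + b + c * C i + e * D i)) =
      𝔼 i, A i + (a * 𝔼 i, B i + b + c * 𝔼 i, C i + e * 𝔼 i, D i) := by
  simp only [Finset.expect_add_distrib, ← Finset.mul_expect, Finset.expect_const univ_nonempty]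

/-- The number of probes and the lengths of trails are dependent. Young's inequality with weight `p`
reduces their product to second moments, and both resulting terms are of order `1/p`. Off the event
`Good`, the bound `N (L + 1)` is split in the same way. -/
theorem expect_time_le [NeZero n] (hx : Set.InjOn x (Set.Icc 1 M)) (hd : 2 ≤ d) (hL : 1 ≤ L)
    (hM : 1 ≤ M) (hMn : M ≤ n) (hK : (2 * K / n : ℝ) ≤ 4 / 5) {p : ℝ} (hp : p = (n + 1 - M) / n) :
    𝔼 H : hashes d M x → Fin n, ((last d L M x H).tm : ℝ) ≤
      (6 + 2 * trailConst + (L + 1) ^ 2 * (𝔼 H : hashes d M x → Fin n,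
        ind (K < (last d L M x H).core.length) + trailConst / n)) / p := by
  have hn : (0 : ℝ) < n := Nat.cast_pos.2 (NeZero.pos n)
  have hMn' : (M : ℝ) ≤ n := by exact_mod_cast hMn
  have hp0 : 0 < p := by rw [hp]; apply div_pos _ hn; linarith
  set Q : ℝ := 𝔼 H : hashes d M x → Fin n,
        ind (K < (last d L M x H).core.length) + trailConst / n with hQ
  have hN := expect_sq_le (n := n) hx hd hL hM hMn hp
  have hB := expect_ind_not_good_le (n := n) (L := L) K hx hd hL hM hK
  rw [← hQ] at hB
  clear_value Q
  have hT := expect_time_sub_le (n := n) hx hd hL hM K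
  have hS : 𝔼 H : hashes d M x → Fin n, 𝔼 v, ((trailFrom d K (last d L M x H) v : ℝ)) ^ 2 ≤
      trailConst := by
    refine le_trans (Finset.expect_le_expect fun H _ => ?_) ((expect_edges_le (n := n) hx hd hL hM
      (K := K) fun e => 𝔼 v, (maxTrail e univ v : ℝ) ^ 2).trans ?_)
    · refine Finset.le_expect univ_nonempty fun e _ => Finset.expect_le_expect fun v _ => ?_
      have := maxTrail_le_overlay (d := d) (last d L M x H) e v
      unfold trailFrom
      gcongr
    · rw [Finset.expect_comm]
      exact Finset.expect_le univ_nonempty fun v _ => expect_maxTrail_sq_le hK v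
  -- Young's inequality is applied to `N · 1`, three times to `N` times the mean trail length, and
  -- once off `Good`. Each application costs `p/2 · N²`, which adds up to `5/2 · p · N²`.
  have hpt : ∀ H : hashes d M x → Fin n, ((last d L M x H).tm : ℝ) ≤
      ((last d L M x H).tm * ind (Good d K (last d L M x H)) -
        (last d L M x H).N * (1 + 3 * 𝔼 v, (trailFrom d K (last d L M x H) v : ℝ))) +
      (5 / 2 * p * (last d L M x H).N ^ 2 + 1 / (2 * p) +
        3 / (2 * p) * (𝔼 v, ((trailFrom d K (last d L M x H) v : ℝ)) ^ 2) +
        (L + 1) ^ 2 / (2 * p) * ind (¬ Good d K (last d L M x H))) := by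
    intro H
    set s := last d L M x H
    have young : ∀ q : ℝ, (s.N : ℝ) * q ≤ p / 2 * s.N ^ 2 + 1 / (2 * p) * q ^ 2 := by
      intro q
      have h1 : 0 ≤ (p * s.N - q) ^ 2 / (2 * p) := by positivity
      have h2 : (p * s.N - q) ^ 2 / (2 * p) =
          p / 2 * s.N ^ 2 + 1 / (2 * p) * q ^ 2 - s.N * q := by field_simp; ring
      linarith
    have h1 : (s.N : ℝ) * 𝔼 v, (trailFrom d K s v : ℝ) ≤
        p / 2 * s.N ^ 2 + 1 / (2 * p) * 𝔼 v, (trailFrom d K s v : ℝ) ^ 2 := by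
      rw [Finset.mul_expect]
      refine (Finset.expect_le_expect fun v _ => young _).trans (le_of_eq ?_)
      rw [Finset.expect_add_distrib, Finset.expect_const univ_nonempty, ← Finset.mul_expect]
    have h2 := young 1
    have h3 : (s.tm : ℝ) ≤ s.tm * ind (Good d K s) +
        (p / 2 * s.N ^ 2 + (L + 1) ^ 2 / (2 * p) * ind (¬ Good d K s)) := by
      by_cases hg : Good d K s
      · rw [ind_of hg, ind_of_not (not_not.2 hg), mul_one, mul_zero]
        have : 0 ≤ p / 2 * (s.N : ℝ) ^ 2 := by positivity
        linarith
      · rw [ind_of_not hg, ind_of hg]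
        have h4 : (s.tm : ℝ) ≤ s.N * (L + 1) := by
          exact_mod_cast (inv_last (n := n) hx hd hL hM H).time_le
        have h5 := young (L + 1)
        have h6 : 1 / (2 * p) * ((L : ℝ) + 1) ^ 2 = (L + 1) ^ 2 / (2 * p) * 1 := by ring
        linarith
    have h7 : 3 / (2 * p) * (𝔼 v, ((trailFrom d K s v : ℝ)) ^ 2) =
      3 * (1 / (2 * p) * (𝔼 v, ((trailFrom d K s v : ℝ)) ^ 2)) := by ring
    rw [h7]
    nlinarith [h1, h2, h3]
  have hsum := Finset.expect_le_expect (s := univ) fun H _ => hpt H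
  rw [expect_add_affine] at hsum
  have h1 : 5 / 2 * p * (𝔼 H : hashes d M x → Fin n, ((last d L M x H).N : ℝ) ^ 2) ≤ 5 / p := by
    calc _ ≤ 5 / 2 * p * (2 / p ^ 2) := mul_le_mul_of_nonneg_left hN (by positivity)
      _ = 5 / p := by field_simp
  have h2 : 3 / (2 * p) * (𝔼 H : hashes d M x → Fin n,
      𝔼 v, ((trailFrom d K (last d L M x H) v : ℝ)) ^ 2) ≤ 2 * trailConst / p := by
    calc _ ≤ 3 / (2 * p) * trailConst := mul_le_mul_of_nonneg_left hS (by positivity)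
      _ = 3 / 2 * trailConst / p := by field_simp
      _ ≤ _ := by
        gcongr
        · exact trailConst_nonneg
        · norm_num
  have hQ0 : 0 ≤ Q := le_trans (Finset.expect_nonneg fun _ _ => ind_nonneg _) hB
  have h3 : (L + 1 : ℝ) ^ 2 / (2 * p) * (𝔼 H : hashes d M x → Fin n,
      ind (¬ Good d K (last d L M x H))) ≤ (L + 1) ^ 2 * Q / p := by
    calc _ ≤ (L + 1 : ℝ) ^ 2 / (2 * p) * Q := mul_le_mul_of_nonneg_left hB (by positivity)
      _ = (L + 1) ^ 2 * Q / (2 * p) := by ring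
      _ ≤ _ := by
        gcongr
        linarith
  have h4 : 1 / (2 * p) ≤ 1 / p := by
    gcongr
    linarith
  have h5 : (6 + 2 * trailConst + (L + 1) ^ 2 * Q) / p =
      5 / p + 1 / p + 2 * trailConst / p + (L + 1) ^ 2 * Q / p := by ring
  rw [h5]
  linarith

end State

end BubbleUp

/-! ### The number of core keys -/

namespace BubbleUp

universe u v

open Finset
open scoped BigOperators

set_option linter.unusedSectionVars false

variable {n : ℕ} {U : Type u} [DecidableEq U]

namespace State

variable {d L M : ℕ} {x : ℕ → U}

theorem WF.length_core_le {s : State n U} (hs : s.WF d M x) : s.core.length ≤ M := by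
  rw [← List.toFinset_card_of_nodup hs.nodup]
  calc s.core.toFinset.card ≤ (State.seen M x s.k).card := by
        refine Finset.card_le_card fun z hz => (hs.coreD z ?_).1
        simpa using hz
    _ ≤ (Finset.Icc 1 (min s.k M)).card := Finset.card_image_le
    _ ≤ M := by simp

/-- A key becomes a core key only when its first `d - 1` hashes have all been looked up, so many
core keys force many probes. -/
theorem WF.mul_length_core_le {s : State n U} (hs : s.WF d M x) :
    (d - 1) * s.core.length ≤ s.D.card := by
  have h : s.core.toFinset ×ˢ Finset.Icc 1 (d - 1) ⊆ s.D := by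
    rintro ⟨z, j⟩ hz
    simp only [Finset.mem_product, List.mem_toFinset, Finset.mem_Icc] at hz
    exact (hs.coreD z hz.1).2 j hz.2.1 hz.2.2
  have := Finset.card_le_card h
  rwa [Finset.card_product, Nat.card_Icc, List.toFinset_card_of_nodup hs.nodup, Nat.add_sub_cancel,
    mul_comm] at this

/-- If there are many core keys, then so many hashes were looked up that the slots of a random set of
size `r` are unlikely to be all free. -/
theorem expect_core_mul_le [NeZero n] (hx : Set.InjOn x (Set.Icc 1 M)) (hd : 2 ≤ d) (hL : 1 ≤ L)
    (hM : 1 ≤ M) {r : ℕ} (hr : 1 ≤ r) (hrM : M + r ≤ n) {t : ℝ} (ht : 3 * t + 1 ≤ d) (ht0 : 0 ≤ t) :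
    (𝔼 H : hashes d M x → Fin n, ind (2 * n / 5 < (last d L M x H).core.length)) *
      (Real.exp (6 / 5 * t) * (n + 1 - M - r)) ^ r ≤ (n : ℝ) ^ r := by
  have hn : (0 : ℝ) < n := Nat.cast_pos.2 (NeZero.pos n)
  have hrn : (r : ℝ) / n < 1 := by
    rw [div_lt_one hn]; exact_mod_cast (by omega : r < n)
  have hpt : ∀ H : hashes d M x → Fin n,
      ind (2 * n / 5 < (last d L M x H).core.length) *
        (((n - M).choose r : ℝ) * Real.exp (6 / 5 * t) ^ r) ≤
      ((n - M).choose r : ℝ) * (1 - r / n : ℝ)⁻¹ ^ (last d L M x H).D.card := by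
    intro H
    by_cases h : 2 * n / 5 < (last d L M x H).core.length
    · rw [ind_of h, one_mul]
      refine mul_le_mul_of_nonneg_left ?_ (Nat.cast_nonneg _)
      have h1 : (2 * n : ℝ) ≤ (last d L M x H).core.length * 5 := by
        exact_mod_cast ((Nat.div_lt_iff_lt_mul (by norm_num)).1 h).le
      have h2 : ((d - 1 : ℕ) : ℝ) * (last d L M x H).core.length ≤ (last d L M x H).D.card := by
        exact_mod_cast (inv_last (n := n) hx hd hL hM H).wf.mul_length_core_le
      rw [Nat.cast_sub (by omega), Nat.cast_one] at h2
      -- The constant is `6/5 = 3 · 2/5`: at least `3t` probes for each of `2n/5` core keys. That it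
      -- exceeds `1` is what makes the factor `3` in `d` sufficient.
      have h3 : 6 / 5 * t * n ≤ (last d L M x H).D.card := by
        calc 6 / 5 * t * n = 3 * t * (2 * n / 5) := by ring
          _ ≤ (d - 1) * (last d L M x H).core.length :=
            mul_le_mul (by linarith) (by linarith) (by positivity) (by linarith)
          _ ≤ _ := h2
      have h4 : Real.exp (r / n) ≤ (1 - r / n : ℝ)⁻¹ := by
        rw [le_inv_comm₀ (Real.exp_pos _) (by linarith), ← Real.exp_neg]
        exact Real.one_sub_le_exp_neg _
      calc Real.exp (6 / 5 * t) ^ r = Real.exp (6 / 5 * t * n * (r / n)) := by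
            rw [← Real.exp_nat_mul]; congr 1; field_simp
        _ ≤ Real.exp ((last d L M x H).D.card * (r / n)) := by gcongr
        _ = Real.exp (r / n) ^ (last d L M x H).D.card := Real.exp_nat_mul _ _
        _ ≤ _ := pow_le_pow_left₀ (Real.exp_pos _).le h4 _
    · rw [ind_of_not h, zero_mul]
      have : 0 ≤ (1 - r / n : ℝ)⁻¹ := inv_nonneg.2 (by linarith)
      positivity
  have h1 := (Finset.expect_le_expect (s := univ) fun H _ => hpt H).trans
    (expect_choose_mul_le (n := n) hx hd hL hM (by omega) hr (by omega))
  rw [← Finset.expect_mul] at h1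
  set P := 𝔼 H : hashes d M x → Fin n, ind (2 * n / 5 < (last d L M x H).core.length) with hP
  have hP0 : 0 ≤ P := Finset.expect_nonneg fun _ _ => ind_nonneg _
  clear_value P
  -- Both binomial coefficients are compared with powers over `r!`, and the factorials cancel.
  have h2 := Nat.pow_le_choose (α := ℝ) r (n - M)
  have h3 := Nat.choose_le_pow_div (α := ℝ) r n
  have h4 : ((n - M + 1 - r : ℕ) : ℝ) = n + 1 - M - r := by
    rw [Nat.cast_sub (by omega), Nat.cast_add, Nat.cast_sub (by omega), Nat.cast_one]; ring
  rw [h4] at h2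
  have hf : (0 : ℝ) < r.factorial := Nat.cast_pos.2 r.factorial_pos
  have h5 : P * ((n + 1 - M - r : ℝ) ^ r / r.factorial * Real.exp (6 / 5 * t) ^ r) ≤
      (n : ℝ) ^ r / r.factorial :=
    (mul_le_mul_of_nonneg_left (mul_le_mul_of_nonneg_right h2 (by positivity)) hP0).trans
      (h1.trans h3)
  rw [le_div_iff₀ hf] at h5
  refine le_trans (le_of_eq ?_) h5
  rw [mul_pow]
  field_simp

theorem expect_core_le_exp [NeZero n] (hx : Set.InjOn x (Set.Icc 1 M)) (hL : 1 ≤ L) (hM : 1 ≤ M)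
    {ε : ℝ} (hε : 0 < ε) (hε1 : ε < 1) (hd : d = ⌈3 * Real.log ε⁻¹⌉₊ + 1) (hMε : M ≤ (1 - ε) * n)
    {r : ℕ} (hr : 1 ≤ r) (hrε : r ≤ ε * n / 100) :
    𝔼 H : hashes d M x → Fin n, ind (2 * n / 5 < (last d L M x H).core.length) ≤
      Real.exp (-(r / 30)) := by
  have hn : (0 : ℝ) < n := Nat.cast_pos.2 (NeZero.pos n)
  have hlog : 0 < Real.log ε⁻¹ := Real.log_pos ((one_lt_inv₀ hε).2 hε1)
  have hd2 : 2 ≤ d := by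
    have := Nat.ceil_pos.2 (mul_pos (by norm_num : (0 : ℝ) < 3) hlog)
    omega
  set t := Real.log ε⁻¹ with ht
  have hεt : ε = Real.exp (-t) := by
    rw [ht, Real.log_inv, neg_neg, Real.exp_log hε]
  -- For `t ≤ 1/3` the gain `e^(t/5)` is too small, but then `ε ≥ 2/3`, and there are at most `n/3`
  -- keys altogether.
  rcases le_or_gt t (1 / 3) with h | h
  · have h1 : (2 / 3 : ℝ) ≤ ε := by
      rw [hεt]
      have := Real.one_sub_le_exp_neg t
      linarith
    have h2 : M * 3 ≤ n := by
      have : (M : ℝ) * 3 ≤ n := by nlinarith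
      exact_mod_cast this
    refine le_trans (le_of_eq (Finset.expect_eq_zero fun H _ => ind_of_not ?_)) (Real.exp_pos _).le
    have := (inv_last (n := n) hx hd2 hL hM H).wf.length_core_le
    omega
  · have hrM : (M : ℝ) + r ≤ n := by nlinarith [mul_pos hε hn]
    have hdt : 3 * t + 1 ≤ d := by
      rw [hd]; push_cast
      have := Nat.le_ceil (3 * t)
      linarith
    have h1 := expect_core_mul_le (n := n) hx hd2 hL hM hr (by exact_mod_cast hrM) hdt hlog.le
    set P := 𝔼 H : hashes d M x → Fin n, ind (2 * n / 5 < (last d L M x H).core.length) with hP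
    have hP0 : 0 ≤ P := Finset.expect_nonneg fun _ _ => ind_nonneg _
    clear_value P
    -- The right side is at least `e^(t/5) · 99n/100`, and `e^(t/5) ≥ e^(1/15)`. One factor
    -- `e^(1/30)` is kept, and the other pays for `99/100`.
    have h2 : Real.exp (1 / 30) * n ≤ Real.exp (6 / 5 * t) * (n + 1 - M - r) := by
      have h3 : (99 / 100 : ℝ) * (ε * n) ≤ n + 1 - M - r := by linarith
      have h4 : Real.exp (6 / 5 * t) * ε = Real.exp (1 / 5 * t) := by
        rw [hεt, ← Real.exp_add]; congr 1; ring
      have h5 : Real.exp (1 / 30) * Real.exp (1 / 30) ≤ Real.exp (1 / 5 * t) := by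
        rw [← Real.exp_add]
        exact Real.exp_le_exp.2 (by linarith)
      have h6 : (1 + 1 / 30 : ℝ) ≤ Real.exp (1 / 30) := by
        have := Real.add_one_le_exp (1 / 30 : ℝ); linarith
      calc Real.exp (1 / 30) * n ≤ Real.exp (1 / 5 * t) * (99 / 100) * n := by
            gcongr
            nlinarith [Real.exp_pos (1 / 30 : ℝ)]
        _ = Real.exp (6 / 5 * t) * (99 / 100 * (ε * n)) := by rw [← h4]; ring
        _ ≤ _ := by gcongr
    have h3 : P * (Real.exp (1 / 30) * n) ^ r ≤ (n : ℝ) ^ r :=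
      (mul_le_mul_of_nonneg_left (pow_le_pow_left₀ (by positivity) h2 r) hP0).trans h1
    rw [mul_pow, ← mul_assoc] at h3
    have h4 := (mul_le_iff_le_one_left (pow_pos hn r)).1 h3
    rw [← Real.exp_nat_mul] at h4
    rw [Real.exp_neg, ← one_div, le_div_iff₀ (Real.exp_pos _)]
    rwa [show (r / 30 : ℝ) = r * (1 / 30) by ring]

end State

theorem exists_log_le : ∃ n₀ : ℕ, 2 ≤ n₀ ∧ ∀ n : ℕ, n₀ ≤ n →
    30 * Real.log n + 1 ≤ (n : ℝ) ^ (3 / 4 : ℝ) / 100 := by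
  have h1 := ((isLittleO_log_rpow_atTop (r := 3 / 4) (by norm_num)).bound
    (c := 1 / 6000) (by norm_num))
  have h2 := (tendsto_rpow_atTop (y := 3 / 4) (by norm_num)).eventually_ge_atTop 200
  obtain ⟨n₀, h⟩ := Filter.eventually_atTop.1
    ((tendsto_natCast_atTop_atTop (R := ℝ)).eventually (h1.and h2))
  refine ⟨max n₀ 2, le_max_right _ _, fun n hn => ?_⟩
  obtain ⟨h3, h4⟩ := h n ((le_max_left _ _).trans hn)
  rw [Real.norm_eq_abs, Real.norm_eq_abs, abs_of_nonneg (a := (n : ℝ) ^ (3 / 4 : ℝ)) (by positivity)]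
    at h3
  have := le_abs_self (Real.log n)
  linarith

/-- With probability `1 - O(1/n)`, at most `2n/5` keys become core keys. -/
theorem exists_expect_core_le : ∃ C : ℝ, 0 < C ∧ ∀ {n d L M : ℕ} {ε : ℝ} {U : Type u} [DecidableEq U]
    [NeZero n] {x : ℕ → U}, Set.InjOn x (Set.Icc 1 M) → 1 ≤ L → 1 ≤ M →
    (n : ℝ) ^ (-(1 / 4) : ℝ) < ε → ε < 1 → d = ⌈3 * Real.log ε⁻¹⌉₊ + 1 → M ≤ (1 - ε) * n →
    𝔼 H : State.hashes d M x → Fin n, ind (2 * n / 5 < (State.last d L M x H).core.length) ≤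
      C / n := by
  obtain ⟨n₀, hn₀, h⟩ := exists_log_le
  -- With `C = n₀` the bound is trivial for `n < n₀`.
  refine ⟨n₀, by exact_mod_cast (by omega : 0 < n₀), ?_⟩
  intro n d L M ε U _ _ x hx hL hM hnε hε1 hd hMε
  have hn : (0 : ℝ) < n := Nat.cast_pos.2 (NeZero.pos n)
  rcases lt_or_ge n n₀ with hlt | hge
  · refine (Finset.expect_le univ_nonempty fun H _ => ind_le_one _).trans ?_
    rw [le_div_iff₀ hn, one_mul]
    exact_mod_cast hlt.le
  · have hε : 0 < ε := lt_trans (by positivity) hnε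
    have hlog : 0 < Real.log n := Real.log_pos (by exact_mod_cast (by omega : 1 < n))
    have h1 := Nat.le_ceil (30 * Real.log n)
    have h2 := Nat.ceil_lt_add_one (a := 30 * Real.log n) (by positivity)
    -- The lower bound on `ε` leaves room for `r = ⌈30 log n⌉ ≤ εn/100`, and this `r` turns
    -- `e^(-r/30)` into at most `1/n`.
    have h3 : (n : ℝ) ^ (3 / 4 : ℝ) ≤ ε * n := by
      calc (n : ℝ) ^ (3 / 4 : ℝ) = (n : ℝ) ^ (-(1 / 4) : ℝ) * n := by
            rw [← Real.rpow_add_one hn.ne']; norm_num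
        _ ≤ ε * n := by gcongr
    have h4 := h n hge
    refine (State.expect_core_le_exp (n := n) hx hL hM hε hε1 hd hMε
      (r := ⌈30 * Real.log n⌉₊) (Nat.ceil_pos.2 (by positivity)) (by linarith)).trans ?_
    calc Real.exp (-(⌈30 * Real.log n⌉₊ / 30)) ≤ Real.exp (-Real.log n) :=
          Real.exp_le_exp.2 (by linarith)
      _ = 1 / n := by rw [Real.exp_neg, Real.exp_log hn, one_div]
      _ ≤ n₀ / n := by
        gcongr
        exact_mod_cast (by omega : 1 ≤ n₀)

end BubbleUp

/-! ### From fully random hash functions to finite averages -/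

namespace BubbleUp

universe u v

open Finset
open scoped BigOperators

set_option linter.unusedSectionVars false

variable {n : ℕ} {U : Type u} [DecidableEq U] {Ω : Type v} [MeasurableSpace Ω] {μ : Measure Ω}
  [IsProbabilityMeasure μ] {h : U → ℕ → Ω → Fin n} {d L M : ℕ} {x : ℕ → U}

variable (h d M x) in
/-- The hash values that matter for the first `M` insertions. -/
def hashValues (ω : Ω) (p : State.hashes d M x) : Fin n := h p.1.1 p.1.2 ω

theorem State.mem_Icc_of_mem_hashes (p : State.hashes d M x) : p.1.2 ∈ Set.Icc 1 d := by
  have := (Finset.mem_product.1 p.2).2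
  simpa using this

namespace FullyRandom

theorem measurable_hashValues (hh : FullyRandom h d μ) : Measurable (hashValues h d M x) :=
  measurable_pi_lambda _ fun p => hh.measurable _ _ (State.mem_Icc_of_mem_hashes p)

theorem measure_hashValues (hh : FullyRandom h d μ) (z : State.hashes d M x → Fin n) :
    μ (hashValues h d M x ⁻¹' {z}) = (n : ℝ≥0∞)⁻¹ ^ Fintype.card (State.hashes d M x) := by
  have h1 : Function.Injective fun p : State.hashes d M x =>
      ((p.1.1, ⟨p.1.2, State.mem_Icc_of_mem_hashes p⟩) : U × Set.Icc 1 d) := by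
    intro p q hpq
    simp only [Prod.mk.injEq, Subtype.mk.injEq] at hpq
    exact Subtype.ext (Prod.ext hpq.1 hpq.2)
  have h2 := (hh.indep.precomp h1).measure_inter_preimage_eq_mul Finset.univ
    (sets := fun p => {z p}) fun _ _ => MeasurableSet.singleton _
  have h3 : hashValues h d M x ⁻¹' {z} = ⋂ p ∈ (univ : Finset (State.hashes d M x)),
      (fun ω => h p.1.1 p.1.2 ω) ⁻¹' {z p} := by
    ext ω
    simp [funext_iff, hashValues]
  rw [h3]
  refine h2.trans ?_
  refine (Finset.prod_congr rfl fun p _ =>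
    hh.uniform p.1.1 p.1.2 (State.mem_Icc_of_mem_hashes p) (z p)).trans ?_
  rw [Finset.prod_const, Finset.card_univ]

/-- The finitely many relevant hash values form a uniform point of the product space, so integrals
over `Ω` become finite averages. -/
theorem lintegral_hashValues [NeZero n] (hh : FullyRandom h d μ)
    {f : (State.hashes d M x → Fin n) → ℝ} (hf : ∀ z, 0 ≤ f z) :
    ∫⁻ ω, ENNReal.ofReal (f (hashValues h d M x ω)) ∂μ = ENNReal.ofReal (𝔼 z, f z) := by
  have hn : (0 : ℝ) < n := Nat.cast_pos.2 (NeZero.pos n)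
  rw [← lintegral_map (f := fun z => ENNReal.ofReal (f z)) (measurable_of_countable _)
    hh.measurable_hashValues, lintegral_fintype, Finset.expect_eq_sum_div_card,
    Finset.sum_div, ENNReal.ofReal_sum_of_nonneg fun z _ => div_nonneg (hf z) (Nat.cast_nonneg _)]
  refine Finset.sum_congr rfl fun z _ => ?_
  rw [Measure.map_apply hh.measurable_hashValues (MeasurableSet.singleton z), hh.measure_hashValues,
    div_eq_mul_inv, ENNReal.ofReal_mul (hf z), Finset.card_univ, Fintype.card_fun, Fintype.card_fin,
    Nat.cast_pow, ← inv_pow, ENNReal.ofReal_pow (inv_nonneg.2 hn.le), ENNReal.ofReal_inv_of_pos hn,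
    ENNReal.ofReal_natCast]

theorem measure_not_supports_le [NeZero n] (hh : FullyRandom h d μ) (hx : Set.InjOn x (Set.Icc 1 M))
    (hd : 2 ≤ d) (hL : 1 ≤ L) (hM : 1 ≤ M) :
    μ {ω | ¬ Supports (fun y i => h y i ω) d L x M} ≤
      ENNReal.ofReal (𝔼 H : State.hashes d M x → Fin n, ind ((State.last d L M x H).fail = true)) := by
  rw [← hh.lintegral_hashValues fun _ => ind_nonneg _]
  set A : Set Ω := hashValues h d M x ⁻¹' {H | (State.last d L M x H).fail = true} with hA
  have hAm : MeasurableSet A := hh.measurable_hashValues (Set.to_countable _).measurableSet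
  calc μ {ω | ¬ Supports (fun y i => h y i ω) d L x M} ≤ μ A := by
        refine measure_mono fun ω hω => ?_
        have h1 : tableAfter (fun y i => h y i ω) d L x M = none := by
          by_contra h2
          exact hω (supports_of_ne_none _ hd L hx h2)
        exact (State.last_spec (g := fun y i => h y i ω) hx hd hL hM fun _ => rfl).1.1 h1
    _ = ∫⁻ ω, A.indicator 1 ω ∂μ := (lintegral_indicator_one hAm).symm
    _ ≤ _ := by
        refine lintegral_mono (Set.indicator_le fun ω hω => ?_)
        rw [ind_of (by exact hω)]
        simp

theorem lintegral_insertionTime [NeZero n] (hh : FullyRandom h d μ)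
    (hx : Set.InjOn x (Set.Icc 1 M)) (hd : 2 ≤ d) (hL : 1 ≤ L) (hM : 1 ≤ M) :
    ∫⁻ ω, (insertionTime (fun y i => h y i ω) d L x M : ℝ≥0∞) ∂μ =
      ENNReal.ofReal (𝔼 H : State.hashes d M x → Fin n, ((State.last d L M x H).tm : ℝ)) := by
  rw [← hh.lintegral_hashValues fun _ => Nat.cast_nonneg _]
  refine lintegral_congr fun ω => ?_
  rw [(State.last_spec (g := fun y i => h y i ω) (H := hashValues h d M x ω) hx hd hL hM
    fun _ => rfl).2, ENNReal.ofReal_natCast]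

end FullyRandom

theorem supports_zero (g : U → ℕ → Fin n) : Supports g d L x 0 := by
  intro k hk
  obtain rfl : k = 0 := Nat.le_zero.1 hk
  exact ⟨_, rfl, by simp, by simp⟩

/-- The quantity by which the probability of a bad event enters the expected time is bounded. -/
theorem ceil_log_sq_div_le {c : ℝ} (hc : 0 < c) {n : ℕ} (hn : 1 ≤ n) :
    ((⌈c * Real.log n⌉₊ : ℝ) + 1) ^ 2 / n ≤ (2 * c + 2) ^ 2 := by
  have hn' : (1 : ℝ) ≤ n := by exact_mod_cast hn
  have h0 := Real.log_nonneg hn'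
  have h1 := Nat.ceil_lt_add_one (a := c * Real.log n) (by positivity)
  have h2 : Real.log n ≤ 2 * √n := by
    have h3 : Real.log n = 2 * Real.log √n := by
      rw [Real.log_sqrt (by positivity)]; ring
    have h4 := Real.log_le_self (Real.sqrt_nonneg n)
    linarith
  have h5 : 1 ≤ √(n : ℝ) := Real.one_le_sqrt.2 hn'
  have h6 : (⌈c * Real.log n⌉₊ : ℝ) + 1 ≤ (2 * c + 2) * √n := by nlinarith
  rw [div_le_iff₀ (by positivity)]
  calc ((⌈c * Real.log n⌉₊ : ℝ) + 1) ^ 2 ≤ ((2 * c + 2) * √n) ^ 2 := by gcongr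
    _ = (2 * c + 2) ^ 2 * n := by rw [mul_pow, Real.sq_sqrt (by positivity)]

/-- Here `ℓ ≥ 10 log n`, and `4/5 ≤ e^(-1/5)`, so the power is at most `n^(-2)`. This is where the
threshold `30` comes from. -/
theorem mul_pow_le_inv {c : ℝ} (hc : 30 ≤ c) {n ℓ : ℕ} (hn : 1 ≤ n) (hℓ : c * Real.log n ≤ 3 * ℓ) :
    n * (4 / 5 : ℝ) ^ ℓ ≤ 1 / n := by
  have hn' : (1 : ℝ) ≤ n := by exact_mod_cast hn
  have h0 := Real.log_nonneg hn'
  have h1 : (4 / 5 : ℝ) ≤ Real.exp (-(1 / 5)) := by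
    have := Real.one_sub_le_exp_neg (1 / 5)
    linarith
  have h2 : (4 / 5 : ℝ) ^ ℓ ≤ Real.exp (-(2 * Real.log n)) := by
    calc (4 / 5 : ℝ) ^ ℓ ≤ Real.exp (-(1 / 5)) ^ ℓ := by gcongr
      _ = Real.exp (ℓ * -(1 / 5)) := (Real.exp_nat_mul _ _).symm
      _ ≤ _ := Real.exp_le_exp.2 (by nlinarith)
  calc n * (4 / 5 : ℝ) ^ ℓ ≤ n * Real.exp (-(2 * Real.log n)) := by gcongr
    _ = n * (Real.exp (-Real.log n) * Real.exp (-Real.log n)) := by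
      rw [← Real.exp_add]; congr 2; ring
    _ = 1 / n := by
      rw [Real.exp_neg, Real.exp_log (by positivity)]
      field_simp

end BubbleUp

/-! ### The theorem -/

open BubbleUp in
theorem theorem4p1 :
    -- the failure threshold is `c log n`, for any sufficiently large constant `c`
    ∃ c₀ : ℝ, 0 < c₀ ∧ ∀ c : ℝ, c₀ ≤ c →
    ∃ C : ℝ, 0 < C ∧
    ∀ (n d L : ℕ) (ε : ℝ), 1 ≤ n → (n : ℝ) ^ (-(1 / 4) : ℝ) < ε → ε < 1 →
      d = ⌈3 * Real.log ε⁻¹⌉₊ + 1 → L = ⌈c * Real.log n⌉₊ →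
    ∀ (U : Type*) (Ω : Type*) [MeasurableSpace Ω] (μ : Measure Ω) [IsProbabilityMeasure μ]
      (h : U → ℕ → Ω → Fin n) (x : ℕ → U),
      BubbleUp.FullyRandom h d μ →
      Set.InjOn x (Set.Icc 1 ⌊(1 - ε) * n⌋₊) →
      μ {ω | ¬ BubbleUp.Supports (fun y i => h y i ω) d L x ⌊(1 - ε) * n⌋₊}
          ≤ ENNReal.ofReal (C / n) ∧
      ∀ δ : ℝ, ε ≤ δ → 1 ≤ ⌊(1 - δ) * n⌋₊ →
        ∫⁻ ω, (BubbleUp.insertionTime (fun y i => h y i ω) d L x ⌊(1 - δ) * n⌋₊ : ℝ≥0∞) ∂μ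
          ≤ ENNReal.ofReal (C * (δ⁻¹ + Real.log ε⁻¹)) := by
  obtain ⟨C₁, hC₁, hcore⟩ := exists_expect_core_le
  refine ⟨30, by norm_num, fun c hc => ?_⟩
  have hT := trailConst_nonneg
  set C : ℝ := (C₁ + trailConst + 1) + (6 + 2 * trailConst + (2 * c + 2) ^ 2 * (C₁ + trailConst))
    with hC
  refine ⟨C, by positivity, ?_⟩
  intro n d L ε hn hnε hε1 hd hL U Ω _ μ _ h x hh hx
  classical
  have : NeZero n := ⟨by omega⟩
  have hn0 : (0 : ℝ) < n := by exact_mod_cast hn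
  have hε : 0 < ε := lt_trans (by positivity) hnε
  have hlog : 0 < Real.log ε⁻¹ := Real.log_pos ((one_lt_inv₀ hε).2 hε1)
  have hd2 : 2 ≤ d := by
    have := Nat.ceil_pos.2 (mul_pos (by norm_num : (0 : ℝ) < 3) hlog)
    omega
  -- At most `2n/5` edges on `n` vertices: the cuckoo graph has mean degree at most `4/5`, which is
  -- subcritical.
  have hK : (2 * (2 * n / 5 : ℕ) / n : ℝ) ≤ 4 / 5 := by
    have : ((2 * n / 5 : ℕ) : ℝ) ≤ 2 * n / 5 := by
      have := @Nat.cast_div_le ℝ _ _ _ (2 * n) 5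
      push_cast at this
      exact this
    rw [div_le_iff₀ hn0]
    linarith
  have hfloor : ∀ δ : ℝ, ε ≤ δ → 1 ≤ ⌊(1 - δ) * n⌋₊ →
      (⌊(1 - δ) * n⌋₊ : ℝ) ≤ (1 - δ) * n ∧ δ < 1 := by
    intro δ _ hM
    have h1 : 1 ≤ (1 - δ) * n := by
      have := (Nat.one_le_floor_iff _).1 hM
      exact this
    refine ⟨Nat.floor_le (by linarith), ?_⟩
    by_contra h2
    have := mul_nonneg (sub_nonneg.2 (not_lt.1 h2)) hn0.le
    linarith
  have hL1 : ∀ M : ℕ, 1 ≤ M → (M : ℝ) ≤ (1 - ε) * n → 1 ≤ L := by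
    intro M hM hMε
    have h1 : (1 : ℝ) ≤ M := by exact_mod_cast hM
    have h2 : (1 : ℝ) < n := by nlinarith
    rw [hL]
    exact Nat.ceil_pos.2 (mul_pos (by linarith) (Real.log_pos h2))
  constructor
  · rcases Nat.eq_zero_or_pos ⌊(1 - ε) * n⌋₊ with h0 | hM
    · rw [h0]
      simp [supports_zero]
    · obtain ⟨hMε, -⟩ := hfloor ε le_rfl hM
      have hL' := hL1 _ hM hMε
      refine (hh.measure_not_supports_le hx hd2 hL' hM).trans (ENNReal.ofReal_le_ofReal ?_)
      -- The length `(L + 2) / 3` is `L/3` rounded up, the shortest trail that can be the cause of a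
      -- failure.
      have hℓ : 3 * ((L + 2) / 3) < L + 3 := by omega
      have hℓ' : c * Real.log n ≤ 3 * ((L + 2) / 3 : ℕ) := by
        have h1 : c * Real.log n ≤ L := by rw [hL]; exact Nat.le_ceil _
        have h2 : (L : ℝ) ≤ 3 * ((L + 2) / 3 : ℕ) := by
          exact_mod_cast (by omega : L ≤ 3 * ((L + 2) / 3))
        linarith
      refine (State.expect_fail_le (2 * n / 5) hx hd2 hL' hM hK hℓ).trans ?_
      have h1 := hcore hx hL' hM hnε hε1 hd hMε
      have h2 := mul_pow_le_inv hc hn hℓ'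
      calc _ ≤ C₁ / n + trailConst / n + 1 / n := by gcongr
        _ = (C₁ + trailConst + 1) / n := by ring
        _ ≤ C / n := by
          gcongr
          rw [hC]
          have : 0 ≤ 6 + 2 * trailConst + (2 * c + 2) ^ 2 * (C₁ + trailConst) := by positivity
          linarith
  · intro δ hδ hM
    obtain ⟨hMδ, hδ1⟩ := hfloor δ hδ hM
    set M := ⌊(1 - δ) * n⌋₊ with hMdef
    have hMle : M ≤ ⌊(1 - ε) * n⌋₊ := Nat.floor_le_floor (by gcongr)
    have hMε : (M : ℝ) ≤ (1 - ε) * n := hMδ.trans (by gcongr)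
    have hx' : Set.InjOn x (Set.Icc 1 M) := hx.mono (Set.Icc_subset_Icc_right hMle)
    have hL' := hL1 _ hM hMε
    have hδ0 : 0 < δ := hε.trans_le hδ
    have hMn : M ≤ n := by
      have : (M : ℝ) ≤ n := by nlinarith
      exact_mod_cast this
    rw [hh.lintegral_insertionTime hx' hd2 hL' hM]
    refine ENNReal.ofReal_le_ofReal ?_
    refine (State.expect_time_le (2 * n / 5) hx' hd2 hL' hM hMn hK rfl).trans ?_
    have h1 := hcore hx' hL' hM hnε hε1 hd hMε
    have h2 := ceil_log_sq_div_le (c := c) (by linarith) hn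
    rw [← hL] at h2
    -- During insertion `M` there are `n + 1 - M` free slots, more than `δn`, so each probe succeeds
    -- with probability at least `δ`.
    have hp : δ ≤ ((n : ℝ) + 1 - M) / n := by
      rw [le_div_iff₀ hn0]
      linarith
    calc _ ≤ (6 + 2 * trailConst + (L + 1) ^ 2 * (C₁ / n + trailConst / n)) / δ := by gcongr
      _ = (6 + 2 * trailConst + (L + 1) ^ 2 / n * (C₁ + trailConst)) / δ := by ring
      _ ≤ (6 + 2 * trailConst + (2 * c + 2) ^ 2 * (C₁ + trailConst)) / δ := by gcongr
      _ ≤ C / δ := by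
        gcongr
        rw [hC]
        linarith
      -- The bound `C / δ` is already sufficient; the logarithmic term only adds room.
      _ = C * (δ⁻¹ + 0) := by rw [add_zero, div_eq_mul_inv]
      _ ≤ _ := by gcongr
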